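/- Let $n\ge 1$, let $\mathbb B$ be the open unit ball of $\mathbb C^n$ and let $dV$ be Lebesgue measure on $\mathbb B$ normalized so that $V(\mathbb B)=1$. A radial weight is a positive, measurable function $\omega$ on $[0,1)$ that is integrable with respect to $dt$, extended to $\mathbb B$ by $\omega(z)=\omega(|z|)$; put $\hat\omega(r)=\int_r^1\omega(t)\,dt$. Let $\mathcal D$ be the class of radial weights $\omega$ such that * there is $C>0$ with $\hat\omega(r)<C\,\hat\omega\big(\tfrac{1+r}{2}\big)$ for all $0\le r<1$, and * there are $K>1$ and $C>1$ with $\hat\omega(t)\ge C\,\hat\omega\big(1-\tfrac{1-t}{K}\big)$ for all $0<t<1$. Let $A^2_\omega$ be the Hilbert space of holomorphic functions on $\mathbb B$ that belong to $L^2(\mathbb B,\omega\,dV)$. For $z\in\mathbb B$ let $B_z^\omega\in A_\omega^2$ be its reproducing kernel at $z$, that is, $f(z)=\int_{\mathbb B} f\,\overline{B_z^\omega}\,\omega\,dV$ for all $f\in A^2_\omega$. For $f\in L^1(\mathbb B,\omega\,dV)$ and $z\in\mathbb B$ set $$P_\omega f(z)=\int_{\mathbb B} f(\xi)\overline{B_z^\omega(\xi)}\,\omega(\xi)\,dV(\xi),\qquad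 P_\omega^+ f(z)=\int_{\mathbb B} f(\xi)\,|B_z^\omega(\xi)|\,\omega(\xi)\,dV(\xi).$$ Such an operator $T$ is called bounded on $L^p(\mathbb B,\upsilon\,dV)$ if $L^p(\mathbb B,\upsilon\,dV)\subset L^1(\mathbb B,\omega\,dV)$ and there is a constant $C$ with $\|Tf\|_{L^p(\mathbb B,\upsilon\,dV)}\le C\|f\|_{L^p(\mathbb B,\upsilon\,dV)}$ for all $f\in L^p(\mathbb B,\upsilon\,dV)$. **Theorem.** Let $1<p<\infty$, $q=\frac{p}{p-1}$ and $\omega,\upsilon\in\mathcal D$. The following statements are equivalent: (i) $P_\omega^+$ is bounded on $L^p(\mathbb B,\upsilon\,dV)$; (ii) $P_\omega$ is bounded on $L^p(\mathbb B,\upsilon\,dV)$; (iii) $\displaystyle M:=\sup_{0\le r<1}\frac{\hat\upsilon(r)^{1/p}}{\hat\omega(r)}\left(\int_r^1\frac{\omega(s)^q}{\upsilon(s)^{q-1}}\,s^{2n-1}\,ds\right)^{1/q}<\infty$; (iv) $\displaystyle N:=\sup_{0\le r<1}\left(\int_0^r\frac{\upsilon(s)}{\hat\omega(s)^p}\,s^{2n-1}\,ds+1\right)^{1/p}\left(\int_r^1\frac{\omega(s)^q}{\upsilon(s)^{q-1}}\,s^{2n-1}\,ds\right)^{1/q}<\infty$.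 -/

import Mathlib

open MeasureTheory Set
open scoped ENNReal NNReal ComplexConjugate

noncomputable section

/-- Complex Euclidean space `ℂⁿ` with its Hermitian norm. -/
abbrev Cn (n : ℕ) : Type := EuclideanSpace ℂ (Fin n)

/-- The open unit ball of `ℂⁿ`. -/
def unitBall (n : ℕ) : Set (Cn n) := Metric.ball 0 1

/-- The normalized volume measure `dV` on the unit ball (total mass `1`), as a measure on `ℂⁿ`
carried by the ball. -/
def normalizedVolume (n : ℕ) : Measure (Cn n) :=
  ((volume : Measure (Cn n)) (unitBall n))⁻¹ • (volume : Measure (Cn n)).restrict (unitBall n)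

/-- A radial weight, given by its profile: a positive, measurable and integrable function
on `[0,1)` (`IntegrableOn` contains Lebesgue measurability).
Values of `ω` outside `[0,1)` are irrelevant. -/
structure IsRadialWeight (ω : ℝ → ℝ) : Prop where
  pos : ∀ t ∈ Ico (0 : ℝ) 1, 0 < ω t
  integrable : IntegrableOn ω (Ico 0 1)

/-- The tail integral `ω̂(r) = ∫_r^1 ω(t) dt`. -/
def tail (ω : ℝ → ℝ) (r : ℝ) : ℝ := ∫ t in Ico r 1, ω t

/-- The doubling condition `ω̂(r) < C ω̂((1+r)/2)` for `0 ≤ r < 1`. -/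
def IsDoubling (ω : ℝ → ℝ) : Prop :=
  ∃ C : ℝ, 0 < C ∧ ∀ r ∈ Ico (0 : ℝ) 1, tail ω r < C * tail ω ((1 + r) / 2)

/-- The reverse doubling condition `ω̂(t) ≥ C ω̂(1 - (1-t)/K)` for `0 < t < 1`. -/
def IsReverseDoubling (ω : ℝ → ℝ) : Prop :=
  ∃ K : ℝ, 1 < K ∧ ∃ C : ℝ, 1 < C ∧
    ∀ t ∈ Ioo (0 : ℝ) 1, C * tail ω (1 - (1 - t) / K) ≤ tail ω t

/-- The class `𝒟` of radial weights that are both doubling and reverse doubling. -/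
structure IsClassD (ω : ℝ → ℝ) : Prop where
  weight : IsRadialWeight ω
  doubling : IsDoubling ω
  reverseDoubling : IsReverseDoubling ω

/-- The measure `ω dV` on the unit ball, with `ω(z) = ω(|z|)`. -/
def weightedVolume (n : ℕ) (ω : ℝ → ℝ) : Measure (Cn n) :=
  (normalizedVolume n).withDensity fun z => ENNReal.ofReal (ω ‖z‖)

/-- `f` belongs to the weighted Bergman space `A²_ω`: it is holomorphic in the ball and lies
in `L²(ω dV)`. -/
def MemBergmanTwo (n : ℕ) (ω : ℝ → ℝ) (f : Cn n → ℂ) : Prop :=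
  DifferentiableOn ℂ f (unitBall n) ∧ MemLp f 2 (weightedVolume n ω)

/-- `B` represents evaluation at `z` on `A²_ω`: `B ∈ A²_ω` and
`f(z) = ∫ f(w) conj (B(w)) ω(w) dV(w)` for all `f ∈ A²_ω`. -/
def IsReproducingAt (n : ℕ) (ω : ℝ → ℝ) (z : Cn n) (B : Cn n → ℂ) : Prop :=
  MemBergmanTwo n ω B ∧
    ∀ f : Cn n → ℂ, MemBergmanTwo n ω f →
      f z = ∫ w, f w * conj (B w) ∂(weightedVolume n ω)

/-- The reproducing kernel `B_z^ω` of `A²_ω`, for `z` in the ball: the function, unique on the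
ball, that represents evaluation at `z` (it exists by Riesz representation). -/
def bergmanKernel (n : ℕ) (ω : ℝ → ℝ) (z : Cn n) : Cn n → ℂ :=
  Classical.epsilon (IsReproducingAt n ω z)

/-- The Bergman projection `P_ω f(z) = ∫ f(ξ) conj (B_z^ω(ξ)) ω(ξ) dV(ξ)`. -/
def bergmanProj (n : ℕ) (ω : ℝ → ℝ) (f : Cn n → ℂ) (z : Cn n) : ℂ :=
  ∫ ξ, f ξ * conj (bergmanKernel n ω z ξ) ∂(weightedVolume n ω)

/-- The maximal Bergman projection `P_ω⁺ f(z) = ∫ f(ξ) |B_z^ω(ξ)| ω(ξ) dV(ξ)`. -/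
def maxBergmanProj (n : ℕ) (ω : ℝ → ℝ) (f : Cn n → ℂ) (z : Cn n) : ℂ :=
  ∫ ξ, f ξ * ((‖bergmanKernel n ω z ξ‖ : ℝ) : ℂ) ∂(weightedVolume n ω)

/-- The operator `T`, whose domain is `L¹(ω dV)`, is a bounded operator from `L^p(υ dV)` to
`L^p(υ dV)`: every `f ∈ L^p(υ dV)` lies in its domain, `T f ∈ L^p(υ dV)`, and
`‖T f‖ ≤ C ‖f‖` with `C` independent of `f`. -/
def IsBoundedOnLp (n : ℕ) (ω υ : ℝ → ℝ) (p : ℝ) (T : (Cn n → ℂ) → Cn n → ℂ) : Prop :=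
  ∃ C : ℝ≥0, ∀ f : Cn n → ℂ, MemLp f (ENNReal.ofReal p) (weightedVolume n υ) →
    Integrable f (weightedVolume n ω) ∧
    MemLp (T f) (ENNReal.ofReal p) (weightedVolume n υ) ∧
    eLpNorm (T f) (ENNReal.ofReal p) (weightedVolume n υ) ≤
      C * eLpNorm f (ENNReal.ofReal p) (weightedVolume n υ)

/-- `∫_r^1 ω(s)^q / υ(s)^(q-1) s^(2n-1) ds`, with values in `[0,∞]`. -/
def dualTail (n : ℕ) (q : ℝ) (ω υ : ℝ → ℝ) (r : ℝ) : ℝ≥0∞ :=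
  ∫⁻ s in Ico r 1, ENNReal.ofReal (ω s ^ q / υ s ^ (q - 1) * s ^ (2 * n - 1))

/-- `M = sup_{0 ≤ r < 1} υ̂(r)^(1/p) / ω̂(r) (∫_r^1 ω^q / υ^(q-1) s^(2n-1) ds)^(1/q)`. -/
def quantityM (n : ℕ) (p q : ℝ) (ω υ : ℝ → ℝ) : ℝ≥0∞ :=
  ⨆ r ∈ Ico (0 : ℝ) 1,
    ENNReal.ofReal (tail υ r ^ (1 / p) / tail ω r) * dualTail n q ω υ r ^ (1 / q)

/-- `N = sup_{0 ≤ r < 1} (∫_0^r υ / ω̂^p s^(2n-1) ds + 1)^(1/p)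
(∫_r^1 ω^q / υ^(q-1) s^(2n-1) ds)^(1/q)`. -/
def quantityN (n : ℕ) (p q : ℝ) (ω υ : ℝ → ℝ) : ℝ≥0∞ :=
  ⨆ r ∈ Ico (0 : ℝ) 1,
    ((∫⁻ s in Ico 0 r, ENNReal.ofReal (υ s / tail ω s ^ p * s ^ (2 * n - 1))) + 1) ^ (1 / p) *
      dualTail n q ω υ r ^ (1 / q)

end

/-! ### Tail integrals of radial weights -/

/-! The kernel is a power series in one inner product: B_z(ξ) = F(⟨ξ, z⟩) with ⟨ξ, z⟩ = `inner ℂ z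
ξ`, F(w) = Σ c_k w^k, and 1/c_k the squared norm in A²_ω of the k-th power of a unit coordinate
(`lintegral_weightedVolume_pow`, `IsClassD.isReproducingAt_kernel`). Thus c_k is a binomial
coefficient divided by 2n times the moment of ω of order 2k + 2n - 1, and for ω in 𝒟 that moment is
comparable to ω̂(1 - 1/(k+1)).

The analytic core is the mean value estimate ∫ |F(ρ⟨ζ, e⟩)| dσ(ζ) ≤ C / ω̂(ρ) over the sphere
(`IsClassD.exists_lintegral_sphere_kernelFun_le`). The moments form a symbol: each difference in k
gains a factor 1/(k+1), and this passes to reciprocals and products. Write F as an average over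
dilations of a function G whose coefficients are larger by about (k+1)^n. Up to bounded terms,
(1-w)^n G(w) is, in modulus, controlled by the series of n-th differences. Cauchy-Schwarz and
Parseval then bound the mean of |G| on radius R by a multiple of (1-R)^(-n) / ω̂(R). Passing to G
makes the Parseval sum grow fast enough to be governed by k of order 1/(1-R). Undoing the dilations
costs nothing, by reverse doubling.

For (iii) ⇒ (i), take grid points r_j = 1 - Q^(-j) and put w_j = ω̂(r_j), x_j = υ̂(r_j)^(1/p), y_j =
(dual tail at r_j)^(1/q). Condition (iii) gives x_j y_j ≤ M w_j. The x_j decay geometrically by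
reverse doubling of υ. So do the y_j: Hölder's inequality on one shell and reverse doubling of ω
show that each shell carries a fixed proportion of the remaining dual mass (`exists_grid_decay`).
Hence Σ_j y_j / w_min(i,j) is at most a multiple of 1/x_i, and likewise with x and y exchanged
(`tsum_div_min_le`). After integration over spheres these are the two hypotheses of Schur's test for
|B| (`exists_schur_weights`).

(i) ⇒ (ii) is the pointwise bound |P f| ≤ P⁺|f|. For (ii) ⇒ (iii), P multiplies a power ⟨ξ, e⟩^k
times a radial function g(|ξ|) into a ratio of moments times the pure power
(`IsClassD.bergmanProj_radial`). The test takes k of order 1/(1-r) and for g a truncated Hölder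
extremal on [r, 1).

(iii) ⇒ (iv) is a geometric sum over the same shells (`quantityN_lt_top`). (iv) ⇒ (iii) holds since
υ̂(r) is dominated by the υ-mass just below r, where ω̂ is comparable to ω̂(r)
(`exists_tail_div_le`). -/

theorem IsRadialWeight.integrableOn_Ico {ω : ℝ → ℝ} (h : IsRadialWeight ω) {r : ℝ} (hr : 0 ≤ r) :
    IntegrableOn ω (Ico r 1) :=
  h.integrable.mono_set (Ico_subset_Ico_left hr)

theorem IsRadialWeight.tail_pos {ω : ℝ → ℝ} (h : IsRadialWeight ω) {r : ℝ} (hr : r ∈ Ico (0 : ℝ) 1) :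
    0 < tail ω r := by
  unfold tail
  rw [setIntegral_pos_iff_support_of_nonneg_ae]
  · have : Ico r 1 ⊆ Function.support ω ∩ Ico r 1 := fun t ht =>
      ⟨(h.pos t ⟨hr.1.trans ht.1, ht.2⟩).ne', ht⟩
    refine lt_of_lt_of_le ?_ (measure_mono this)
    simp [hr.2]
  · filter_upwards [ae_restrict_mem measurableSet_Ico] with t ht
    exact (h.pos t ⟨hr.1.trans ht.1, ht.2⟩).le
  · exact h.integrableOn_Ico hr.1

theorem IsRadialWeight.ofReal_tail {ω : ℝ → ℝ} (h : IsRadialWeight ω) {r : ℝ} (hr : 0 ≤ r) :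
    ENNReal.ofReal (tail ω r) = ∫⁻ t in Ico r 1, ENNReal.ofReal (ω t) := by
  unfold tail
  rw [ofReal_integral_eq_lintegral_ofReal (h.integrableOn_Ico hr)]
  filter_upwards [ae_restrict_mem measurableSet_Ico] with t ht
  exact (h.pos t ⟨hr.trans ht.1, ht.2⟩).le

theorem IsRadialWeight.tail_anti {ω : ℝ → ℝ} (h : IsRadialWeight ω) {r s : ℝ} (hr : 0 ≤ r)
    (hrs : r ≤ s) : tail ω s ≤ tail ω r := by
  unfold tail
  refine setIntegral_mono_set (h.integrableOn_Ico hr) ?_ (Ico_subset_Ico_left hrs).eventuallyLE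
  filter_upwards [ae_restrict_mem measurableSet_Ico] with t ht
  exact (h.pos t ⟨hr.trans ht.1, ht.2⟩).le

theorem IsRadialWeight.tail_eq_add {ω : ℝ → ℝ} (h : IsRadialWeight ω) {r s : ℝ} (hr : 0 ≤ r)
    (hrs : r ≤ s) (hs : s ≤ 1) : tail ω r = (∫ t in Ico r s, ω t) + tail ω s := by
  unfold tail
  rw [← Ico_union_Ico_eq_Ico hrs hs, setIntegral_union Ico_disjoint_Ico_same measurableSet_Ico]
  · exact (h.integrableOn_Ico hr).mono_set (Ico_subset_Ico_right hs)
  · exact h.integrableOn_Ico (hr.trans hrs)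

theorem IsRadialWeight.tail_strictAnti {ω : ℝ → ℝ} (h : IsRadialWeight ω) {r s : ℝ} (hr : 0 ≤ r)
    (hrs : r < s) (hs : s ≤ 1) : tail ω s < tail ω r := by
  rw [h.tail_eq_add hr hrs.le hs]
  have : 0 < ∫ t in Ico r s, ω t := by
    rw [setIntegral_pos_iff_support_of_nonneg_ae]
    · have : Ico r s ⊆ Function.support ω ∩ Ico r s := fun t ht =>
        ⟨(h.pos t ⟨hr.trans ht.1, ht.2.trans_le hs⟩).ne', ht⟩
      refine lt_of_lt_of_le ?_ (measure_mono this)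
      simp [hrs]
    · filter_upwards [ae_restrict_mem measurableSet_Ico] with t ht
      exact (h.pos t ⟨hr.trans ht.1, ht.2.trans_le hs⟩).le
    · exact (h.integrableOn_Ico hr).mono_set (Ico_subset_Ico_right hs)
  linarith

/-- Iterated doubling: the tail grows at most polynomially in `1 - r`. -/
theorem IsClassD.exists_tail_mul_pow_le {ω : ℝ → ℝ} (h : IsClassD ω) :
    ∃ β : ℕ, ∃ C : ℝ, 1 ≤ C ∧ ∀ r t : ℝ, 0 ≤ r → r ≤ t → t < 1 →
      tail ω r * (1 - t) ^ β ≤ C * (1 - r) ^ β * tail ω t := by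
  obtain ⟨C₀, hC₀, hd⟩ := h.doubling
  -- A constant at least 1 makes surplus doubling steps harmless when the midpoint (1+r)/2
  -- overshoots t.
  set C := max C₀ 1
  have hC1 : 1 ≤ C := le_max_right _ _
  have hd' : ∀ r ∈ Ico (0 : ℝ) 1, tail ω r ≤ C * tail ω ((1 + r) / 2) := fun r hr => by
    have h1 := (h.weight.tail_pos (r := (1 + r) / 2) ⟨by linarith [hr.1], by linarith [hr.2]⟩).le
    exact (hd r hr).le.trans (mul_le_mul_of_nonneg_right (le_max_left _ _) h1)
  have key : ∀ j : ℕ, ∀ r t : ℝ, 0 ≤ r → r ≤ t → t < 1 → 1 - r ≤ 2 ^ j * (1 - t) →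
      tail ω r ≤ C ^ j * tail ω t := by
    intro j
    induction j with
    | zero =>
      intro r t hr hrt ht hj
      have : r = t := by simp at hj; linarith
      simp [this]
    | succ j ih =>
      intro r t hr hrt ht hj
      have hr1 : r < 1 := by linarith
      refine (hd' r ⟨hr, hr1⟩).trans ?_
      rw [pow_succ', mul_assoc]
      refine mul_le_mul_of_nonneg_left ?_ (by linarith)
      have hpos := h.weight.tail_pos (r := t) ⟨by linarith, ht⟩
      rcases le_total ((1 + r) / 2) t with h1 | h1
      · refine ih _ _ (by linarith) h1 ht ?_
        rw [pow_succ] at hj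
        linarith
      · refine (h.weight.tail_anti (by linarith) h1).trans ?_
        exact le_mul_of_one_le_left hpos.le (one_le_pow₀ hC1)
  -- With C < 2^β, the cost C^(j+1) of j + 1 doublings is at most 2^β times the β-th power of 2^j ≤
  -- (1-r)/(1-t).
  obtain ⟨β, hβ⟩ := pow_unbounded_of_one_lt C (one_lt_two : (1 : ℝ) < 2)
  refine ⟨β, 2 ^ β, one_le_pow₀ one_le_two, fun r t hr hrt ht => ?_⟩
  have ht' : 0 < 1 - t := by linarith
  have hpos := h.weight.tail_pos (r := t) ⟨by linarith, ht⟩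
  have hx : 1 ≤ (1 - r) / (1 - t) := by rw [one_le_div ht']; linarith
  obtain ⟨j, hj1, hj2⟩ := exists_nat_pow_near hx (one_lt_two : (1 : ℝ) < 2)
  rw [le_div_iff₀ ht'] at hj1
  rw [div_lt_iff₀ ht'] at hj2
  have h1 := key (j + 1) r t hr hrt ht hj2.le
  have h2 : C ^ (j + 1) * (1 - t) ^ β ≤ 2 ^ β * (1 - r) ^ β := by
    calc C ^ (j + 1) * (1 - t) ^ β ≤ (2 ^ β) ^ (j + 1) * (1 - t) ^ β := by gcongr
      _ = 2 ^ β * (2 ^ j * (1 - t)) ^ β := by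
        rw [mul_pow, ← pow_mul, ← pow_mul]; ring
      _ ≤ 2 ^ β * (1 - r) ^ β := by gcongr
  calc tail ω r * (1 - t) ^ β ≤ C ^ (j + 1) * tail ω t * (1 - t) ^ β := by gcongr
    _ = C ^ (j + 1) * (1 - t) ^ β * tail ω t := by ring
    _ ≤ _ := by gcongr

/-- Reverse doubling says nothing at t = 0; there strict decrease of the tail supplies a contraction
factor. Allowing every Q ≥ K lets two weights share one geometric grid. -/
theorem IsClassD.exists_tail_contract {ω : ℝ → ℝ} (h : IsClassD ω) :
    ∃ K : ℝ, 1 < K ∧ ∃ l : ℝ, 0 < l ∧ l < 1 ∧ ∀ Q, K ≤ Q → ∀ t ∈ Ico (0 : ℝ) 1,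
      tail ω (1 - (1 - t) / Q) ≤ l * tail ω t := by
  obtain ⟨K, hK, C, hC, hr⟩ := h.reverseDoubling
  have hK0 : (0 : ℝ) < K := by linarith
  have h0 := h.weight.tail_pos (r := 0) ⟨le_rfl, one_pos⟩
  have hKi : 1 / K < 1 := by rw [div_lt_one hK0]; exact hK
  have hKi' : 0 < 1 / K := by positivity
  have h1 := h.weight.tail_strictAnti (r := 0) (s := 1 - 1 / K) le_rfl (by linarith) (by linarith)
  set l₀ := tail ω (1 - 1 / K) / tail ω 0
  have hl₀ : l₀ < 1 := by rw [div_lt_one h0]; exact h1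
  refine ⟨K, hK, max (1 / C) l₀, lt_max_of_lt_left (by positivity),
    max_lt (by rw [div_lt_one (by linarith)]; exact hC) hl₀, fun Q hQ t ht => ?_⟩
  have ht' := h.weight.tail_pos ht
  have hmono : tail ω (1 - (1 - t) / Q) ≤ tail ω (1 - (1 - t) / K) := by
    have h2 : (1 - t) / Q ≤ (1 - t) / K :=
      div_le_div_of_nonneg_left (by linarith [ht.2]) hK0 hQ
    have h3 : (1 - t) / K ≤ 1 := by rw [div_le_one hK0]; linarith [ht.1]
    exact h.weight.tail_anti (by linarith) (by linarith)
  refine hmono.trans ?_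
  rcases ht.1.eq_or_lt with h2 | h2
  · subst h2
    calc tail ω (1 - (1 - 0) / K) = l₀ * tail ω 0 := by
          simp only [sub_zero, l₀]; field_simp
      _ ≤ _ := by gcongr; exact le_max_right _ _
  · have h3 := hr t ⟨h2, ht.2⟩
    calc tail ω (1 - (1 - t) / K) ≤ 1 / C * tail ω t := by
          rw [one_div, ← div_eq_inv_mul, le_div_iff₀ (by linarith)]; linarith
      _ ≤ _ := by gcongr; exact le_max_left _ _

/-- Iterated reverse doubling: the tail decays at least like a power of `1 - t`. -/
theorem IsClassD.exists_tail_mul_rpow_le {ω : ℝ → ℝ} (h : IsClassD ω) :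
    ∃ α : ℝ, 0 < α ∧ ∃ C : ℝ, 0 < C ∧ ∀ r t : ℝ, 0 ≤ r → r ≤ t → t < 1 →
      tail ω t * (1 - r) ^ α ≤ C * (1 - t) ^ α * tail ω r := by
  obtain ⟨K, hK, l, hl0, hl1, hd⟩ := h.exists_tail_contract
  have hK0 : (0 : ℝ) < K := by linarith
  have hd := hd K le_rfl
  have key : ∀ j : ℕ, ∀ r ∈ Ico (0 : ℝ) 1, tail ω (1 - (1 - r) / K ^ j) ≤ l ^ j * tail ω r := by
    intro j
    induction j with
    | zero => intro r hr; simp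
    | succ j ih =>
      intro r hr
      have hj : 0 < (1 - r) / K ^ j := div_pos (by linarith [hr.2]) (by positivity)
      have hj' : (1 - r) / K ^ j ≤ 1 := by
        rw [div_le_one (by positivity)]
        exact le_trans (by linarith [hr.1]) (one_le_pow₀ hK.le)
      have h1 := hd (1 - (1 - r) / K ^ j) ⟨by linarith, by linarith⟩
      have h2 : (1 - (1 - (1 - r) / K ^ j)) / K = (1 - r) / K ^ (j + 1) := by
        rw [pow_succ]; field_simp; ring
      rw [h2] at h1
      refine h1.trans ?_
      rw [pow_succ', mul_assoc]
      exact mul_le_mul_of_nonneg_left (ih r hr) hl0.le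
  -- Chosen so that K^(-α) = l: one contraction step then matches one factor K in 1 - t.
  set α := - Real.logb K l
  have hα : 0 < α := by
    have := Real.logb_neg hK hl0 hl1
    simp only [α]; linarith
  have hKα : K ^ α = l⁻¹ := by
    simp only [α]
    rw [Real.rpow_neg hK0.le, Real.rpow_logb hK0 hK.ne' hl0]
  refine ⟨α, hα, l⁻¹, by positivity, fun r t hr hrt ht => ?_⟩
  have ht' : 0 < 1 - t := by linarith
  have hr' : 0 < 1 - r := by linarith
  have hx : 1 ≤ (1 - r) / (1 - t) := by rw [one_le_div ht']; linarith
  obtain ⟨j, hj1, hj2⟩ := exists_nat_pow_near hx hK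
  rw [le_div_iff₀ ht'] at hj1
  rw [div_lt_iff₀ ht'] at hj2
  have hpos := h.weight.tail_pos (r := r) ⟨hr, by linarith⟩
  have h1 : tail ω t ≤ l ^ j * tail ω r := by
    refine le_trans (h.weight.tail_anti ?_ ?_) (key j r ⟨hr, by linarith⟩)
    · have : (1 - r) / K ^ j ≤ 1 := by
        rw [div_le_one (by positivity)]
        exact le_trans (by linarith) (one_le_pow₀ hK.le)
      linarith
    · have : 1 - t ≤ (1 - r) / K ^ j := by
        rw [le_div_iff₀ (by positivity)]; linarith
      linarith
  have h2 : (1 - r) ^ α ≤ (l⁻¹) ^ (j + 1) * (1 - t) ^ α := by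
    calc (1 - r) ^ α ≤ (K ^ (j + 1) * (1 - t)) ^ α :=
          Real.rpow_le_rpow hr'.le hj2.le hα.le
      _ = (l⁻¹) ^ (j + 1) * (1 - t) ^ α := by
        rw [Real.mul_rpow (by positivity) ht'.le, ← hKα, ← Real.rpow_natCast, ← Real.rpow_natCast,
          ← Real.rpow_mul hK0.le, ← Real.rpow_mul hK0.le, mul_comm α]
  calc tail ω t * (1 - r) ^ α ≤ (l ^ j * tail ω r) * ((l⁻¹) ^ (j + 1) * (1 - t) ^ α) := by
        gcongr
    _ = (l ^ j * (l⁻¹) ^ j) * (l⁻¹ * (1 - t) ^ α * tail ω r) := by ring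
    _ = _ := by rw [← mul_pow, mul_inv_cancel₀ hl0.ne', one_pow, one_mul]

/-! ### Moments -/

theorem integral_pow_mul_one_sub_pow (a b : ℕ) :
    ∫ x in (0 : ℝ)..1, x ^ a * (1 - x) ^ b =
      (a.factorial * b.factorial : ℝ) / (a + b + 1).factorial := by
  induction b generalizing a with
  | zero =>
    simp only [pow_zero, mul_one, integral_pow, Nat.factorial_zero, Nat.cast_one, add_zero,
      Nat.factorial_succ]
    have := Nat.factorial_pos a
    push_cast
    field_simp
    simp
  | succ b ih =>
    have h1 : ∀ x : ℝ, x ^ a * (1 - x) ^ (b + 1) = x ^ a * (1 - x) ^ b - x ^ (a + 1) * (1 - x) ^ b :=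
      fun x => by ring
    simp_rw [h1]
    rw [intervalIntegral.integral_sub (by apply Continuous.intervalIntegrable; fun_prop)
      (by apply Continuous.intervalIntegrable; fun_prop), ih, ih]
    rw [show a + 1 + b + 1 = (a + b + 1) + 1 by ring, show a + (b + 1) + 1 = (a + b + 1) + 1 by ring]
    simp only [Nat.factorial_succ]
    have h2 : ((a + b).factorial : ℝ) ≠ 0 := by positivity
    push_cast
    have h3 : (a + b + 1 + 1 : ℝ) ≠ 0 := by positivity
    have h4 : (a + b + 1 : ℝ) ≠ 0 := by positivity
    field_simp
    ring

/-- The moment `∫_0^1 r^x ω(r) dr`. -/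
noncomputable def moment (ω : ℝ → ℝ) (x : ℕ) : ℝ := ∫ r in Ico (0 : ℝ) 1, r ^ x * ω r

theorem IsRadialWeight.integrableOn_mul {ω : ℝ → ℝ} (h : IsRadialWeight ω) {f : ℝ → ℝ}
    (hf : Continuous f) : IntegrableOn (fun r => f r * ω r) (Ico 0 1) := by
  obtain ⟨C, hC⟩ := (isCompact_Icc (a := (0 : ℝ)) (b := 1)).exists_bound_of_continuousOn
    hf.continuousOn
  refine Integrable.bdd_mul (c := C) h.integrable hf.aestronglyMeasurable ?_
  filter_upwards [ae_restrict_mem measurableSet_Ico] with t ht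
  exact hC t (Ico_subset_Icc_self ht)

theorem IsRadialWeight.ofReal_moment {ω : ℝ → ℝ} (h : IsRadialWeight ω) (x : ℕ) :
    ENNReal.ofReal (moment ω x) = ∫⁻ r in Ico (0 : ℝ) 1, ENNReal.ofReal (r ^ x * ω r) := by
  unfold moment
  rw [ofReal_integral_eq_lintegral_ofReal (h.integrableOn_mul (by fun_prop))]
  filter_upwards [ae_restrict_mem measurableSet_Ico] with t ht
  exact mul_nonneg (pow_nonneg ht.1 _) (h.pos t ht).le

theorem IsRadialWeight.moment_nonneg {ω : ℝ → ℝ} (h : IsRadialWeight ω) (x : ℕ) :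
    0 ≤ moment ω x :=
  setIntegral_nonneg measurableSet_Ico fun t ht => mul_nonneg (pow_nonneg ht.1 _) (h.pos t ht).le

theorem IsRadialWeight.pow_mul_tail_le_moment {ω : ℝ → ℝ} (h : IsRadialWeight ω) (x : ℕ) {r : ℝ}
    (hr : 0 ≤ r) : r ^ x * tail ω r ≤ moment ω x := by
  unfold tail moment
  rw [← integral_const_mul]
  calc ∫ t in Ico r 1, r ^ x * ω t ≤ ∫ t in Ico r 1, t ^ x * ω t := by
        refine setIntegral_mono_on ((h.integrableOn_Ico hr).const_mul _)
          ((h.integrableOn_mul (by fun_prop)).mono_set (Ico_subset_Ico_left hr)) measurableSet_Ico ?_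
        intro t ht
        have := (h.pos t ⟨hr.trans ht.1, ht.2⟩).le
        have := ht.1
        gcongr
    _ ≤ _ := by
        refine setIntegral_mono_set (h.integrableOn_mul (by fun_prop)) ?_
          (Ico_subset_Ico_left hr).eventuallyLE
        filter_upwards [ae_restrict_mem measurableSet_Ico] with t ht
        exact mul_nonneg (pow_nonneg ht.1 _) (h.pos t ht).le

theorem IsRadialWeight.moment_pos {ω : ℝ → ℝ} (h : IsRadialWeight ω) (x : ℕ) : 0 < moment ω x :=
  lt_of_lt_of_le (mul_pos (by positivity) (h.tail_pos (r := 1 / 2) (by norm_num)))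
    (h.pow_mul_tail_le_moment x (r := 1 / 2) (by norm_num))

theorem IsRadialWeight.moment_anti {ω : ℝ → ℝ} (h : IsRadialWeight ω) : Antitone (moment ω) := by
  intro a b hab
  refine setIntegral_mono_on (h.integrableOn_mul (by fun_prop)) (h.integrableOn_mul (by fun_prop))
    measurableSet_Ico fun t ht => ?_
  exact mul_le_mul_of_nonneg_right (pow_le_pow_of_le_one ht.1 ht.2.le hab) (h.pos t ht).le

/-- The reciprocal of 1 - 1/(x+1) is 1 + 1/x, and (1 + 1/x)^x ≤ e. So t^x is bounded below on [1 -
1/(x+1), 1), the part of the interval that carries the moment of order x. -/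
theorem one_le_exp_mul_one_sub_inv_pow (x : ℕ) :
    1 ≤ Real.exp 1 * (1 - 1 / ((x : ℝ) + 1)) ^ x := by
  rcases Nat.eq_zero_or_pos x with rfl | hx
  · simp
  have hx' : (0 : ℝ) < x := by exact_mod_cast hx
  have h1 : (1 + 1 / (x : ℝ)) ^ x ≤ Real.exp 1 := by
    calc (1 + 1 / (x : ℝ)) ^ x ≤ (Real.exp (1 / x)) ^ x := by
          gcongr
          linarith [Real.add_one_le_exp (1 / (x : ℝ))]
      _ = Real.exp 1 := by rw [← Real.exp_nat_mul]; congr 1; field_simp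
  have h2 : (1 - 1 / ((x : ℝ) + 1)) * (1 + 1 / (x : ℝ)) = 1 := by field_simp; ring
  have h3 : 0 ≤ (1 - 1 / ((x : ℝ) + 1)) := by
    have : 1 / ((x : ℝ) + 1) ≤ 1 := by rw [div_le_one (by positivity)]; linarith
    linarith
  calc (1 : ℝ) = (1 + 1 / (x : ℝ)) ^ x * (1 - 1 / ((x : ℝ) + 1)) ^ x := by
        rw [← mul_pow, mul_comm, h2, one_pow]
    _ ≤ _ := by gcongr

theorem IsRadialWeight.tail_le_moment {ω : ℝ → ℝ} (h : IsRadialWeight ω) (x : ℕ) :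
    tail ω (1 - 1 / ((x : ℝ) + 1)) ≤ Real.exp 1 * moment ω x := by
  have h3 : 0 ≤ (1 - 1 / ((x : ℝ) + 1)) := by
    have : 1 / ((x : ℝ) + 1) ≤ 1 := by
      rw [div_le_one (by positivity)]; linarith [(Nat.cast_nonneg x : (0 : ℝ) ≤ x)]
    linarith
  have h4 : (1 - 1 / ((x : ℝ) + 1)) < 1 := by
    have : 0 < 1 / ((x : ℝ) + 1) := by positivity
    linarith
  calc tail ω (1 - 1 / ((x : ℝ) + 1)) ≤
      (Real.exp 1 * (1 - 1 / ((x : ℝ) + 1)) ^ x) * tail ω (1 - 1 / ((x : ℝ) + 1)) :=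
        le_mul_of_one_le_left (h.tail_pos ⟨h3, h4⟩).le (one_le_exp_mul_one_sub_inv_pow x)
    _ ≤ _ := by
        rw [mul_assoc]
        exact mul_le_mul_of_nonneg_left (h.pow_mul_tail_le_moment x h3) (Real.exp_pos 1).le

/-- Layer-cake formula for moments. -/
theorem IsRadialWeight.ofReal_moment_succ {ω : ℝ → ℝ} (h : IsRadialWeight ω) (x : ℕ) :
    ENNReal.ofReal (moment ω (x + 1)) =
      ∫⁻ s in Ico (0 : ℝ) 1, ENNReal.ofReal ((x + 1) * s ^ x) * ENNReal.ofReal (tail ω s) := by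
  -- Writing r^(x+1) as the integral of (x+1) s^x over s ≤ r lets Tonelli's theorem turn ω into its
  -- tail.
  have h1 : ∀ r ∈ Ico (0 : ℝ) 1, ENNReal.ofReal (r ^ (x + 1) * ω r) =
      ∫⁻ s in Ico (0 : ℝ) 1, (Iic r).indicator (fun s => ENNReal.ofReal ((x + 1) * s ^ x)) s
        * ENNReal.ofReal (ω r) := by
    intro r hr
    rw [lintegral_mul_const' _ _ ENNReal.ofReal_ne_top, lintegral_indicator measurableSet_Iic,
      Measure.restrict_restrict measurableSet_Iic, ENNReal.ofReal_mul (pow_nonneg hr.1 _)]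
    congr 1
    have : Iic r ∩ Ico 0 1 = Icc 0 r := by
      ext s; simp only [mem_inter_iff, mem_Iic, mem_Ico, mem_Icc]
      constructor
      · rintro ⟨a, b, -⟩; exact ⟨b, a⟩
      · rintro ⟨a, b⟩; exact ⟨b, a, b.trans_lt hr.2⟩
    rw [this, ← ofReal_integral_eq_lintegral_ofReal]
    · rw [integral_Icc_eq_integral_Ioc, ← intervalIntegral.integral_of_le hr.1]
      rw [intervalIntegral.integral_const_mul, integral_pow]
      congr 1
      field_simp
      simp
    · exact (Continuous.integrableOn_Icc (by fun_prop))
    · filter_upwards [ae_restrict_mem measurableSet_Icc] with s hs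
      have := hs.1
      positivity
  rw [h.ofReal_moment, setLIntegral_congr_fun measurableSet_Ico h1]
  rw [lintegral_lintegral_swap]
  · refine setLIntegral_congr_fun measurableSet_Ico fun s hs => ?_
    rw [h.ofReal_tail hs.1, ← lintegral_const_mul' _ _ ENNReal.ofReal_ne_top]
    have : ∀ r, (Iic r).indicator (fun s : ℝ => ENNReal.ofReal ((x + 1) * s ^ x)) s
        * ENNReal.ofReal (ω r) = (Ici s).indicator
          (fun r => ENNReal.ofReal ((x + 1) * s ^ x) * ENNReal.ofReal (ω r)) r := by
      intro r
      by_cases hsr : s ≤ r <;> simp [indicator, hsr]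
    simp_rw [this]
    rw [lintegral_indicator measurableSet_Ici, Measure.restrict_restrict measurableSet_Ici]
    congr 2
    ext r; simp only [mem_inter_iff, mem_Ici, mem_Ico]
    constructor
    · rintro ⟨a, b, c⟩; exact ⟨a, c⟩
    · rintro ⟨a, b⟩; exact ⟨a, hs.1.trans a, b⟩
  · have hm : AEMeasurable (fun r => ENNReal.ofReal (ω r)) (volume.restrict (Ico (0 : ℝ) 1)) :=
      h.integrable.aemeasurable.ennreal_ofReal
    refine AEMeasurable.mul ?_ (hm.comp_quasiMeasurePreserving Measure.quasiMeasurePreserving_fst)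
    have : (Function.uncurry fun (r s : ℝ) => (Iic r).indicator
        (fun s => ENNReal.ofReal ((x + 1) * s ^ x)) s) =
        {p : ℝ × ℝ | p.2 ≤ p.1}.indicator (fun p => ENNReal.ofReal ((x + 1) * p.2 ^ x)) := by
      ext p
      simp [Function.uncurry, indicator]
    refine Measurable.aemeasurable ?_
    change Measurable (Function.uncurry fun (r s : ℝ) => (Iic r).indicator
        (fun s => ENNReal.ofReal ((x + 1) * s ^ x)) s)
    rw [this]
    refine Measurable.indicator (by fun_prop) (measurableSet_le measurable_snd measurable_fst)

/-- In the layer-cake formula, iterated doubling bounds the tail at s by the tail at t = 1 - 1/y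
times 1 + C y^β (1-s)^β. The resulting Beta integral is of order y^(-β), so the factor y^β is
absorbed. -/
theorem IsClassD.exists_moment_le_tail {ω : ℝ → ℝ} (h : IsClassD ω) :
    ∃ C : ℝ, 0 < C ∧ ∀ x : ℕ, moment ω x ≤ C * tail ω (1 - 1 / ((x : ℝ) + 1)) := by
  obtain ⟨β, C, hC, hd⟩ := h.exists_tail_mul_pow_le
  refine ⟨1 + C * β.factorial, by positivity, fun x => ?_⟩
  rcases x with _ | x
  · have : moment ω 0 = tail ω 0 := by simp [moment, tail]
    rw [this]
    simp only [CharP.cast_eq_zero, zero_add, div_one, sub_self]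
    refine le_mul_of_one_le_left (h.weight.tail_pos ⟨le_rfl, one_pos⟩).le ?_
    have : 0 ≤ C * β.factorial := by positivity
    linarith
  set y : ℝ := ((x + 1 : ℕ) : ℝ) + 1 with hy
  have hy0 : 0 < y := by positivity
  set t : ℝ := 1 - 1 / y with ht
  have ht0 : 0 ≤ t := by
    have : 1 / y ≤ 1 := by
      rw [div_le_one hy0, hy]; linarith [(Nat.cast_nonneg (x + 1) : (0 : ℝ) ≤ (x + 1 : ℕ))]
    linarith
  have ht1 : t < 1 := by
    have : 0 < 1 / y := by positivity
    linarith
  have hT := h.weight.tail_pos ⟨ht0, ht1⟩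
  have hbound : ∀ s ∈ Ico (0 : ℝ) 1, tail ω s ≤ tail ω t * (1 + C * y ^ β * (1 - s) ^ β) := by
    intro s hs
    have hs' : 0 ≤ 1 - s := by linarith [hs.2]
    rcases le_total t s with h1 | h1
    · refine (h.weight.tail_anti ht0 h1).trans (le_mul_of_one_le_right hT.le ?_)
      have : 0 ≤ C * y ^ β * (1 - s) ^ β := by positivity
      linarith
    · have h2 := hd s t hs.1 h1 ht1
      have h3 : 1 - t = 1 / y := by rw [ht]; ring
      rw [h3, one_div, inv_pow, ← div_eq_mul_inv, div_le_iff₀ (by positivity)] at h2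
      nlinarith [hT.le]
  have hx1 : (0 : ℝ) ≤ x + 1 := by positivity
  have key : ENNReal.ofReal (moment ω (x + 1)) ≤
      ENNReal.ofReal (∫ s in (0 : ℝ)..1, ((x + 1) * s ^ x) *
        (tail ω t * (1 + C * y ^ β * (1 - s) ^ β))) := by
    rw [h.weight.ofReal_moment_succ, intervalIntegral.integral_of_le zero_le_one,
      ← integral_Ico_eq_integral_Ioc, ofReal_integral_eq_lintegral_ofReal]
    · refine setLIntegral_mono' measurableSet_Ico fun s hs => ?_
      have := hs.1
      rw [← ENNReal.ofReal_mul (by positivity)]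
      exact ENNReal.ofReal_le_ofReal (mul_le_mul_of_nonneg_left (hbound s hs) (by positivity))
    · exact (Continuous.integrableOn_Icc (by fun_prop)).mono_set Ico_subset_Icc_self
    · filter_upwards [ae_restrict_mem measurableSet_Ico] with s hs
      have := hs.1
      have : 0 ≤ 1 - s := by linarith [hs.2]
      positivity
  have hint : ∫ s in (0 : ℝ)..1, ((x + 1) * s ^ x) * (tail ω t * (1 + C * y ^ β * (1 - s) ^ β)) =
      tail ω t * (1 + C * y ^ β * ((x + 1) *
        ((x.factorial * β.factorial : ℝ) / (x + β + 1).factorial))) := by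
    rw [← integral_pow_mul_one_sub_pow]
    have : ∀ s : ℝ, ((x + 1) * s ^ x) * (tail ω t * (1 + C * y ^ β * (1 - s) ^ β)) =
        tail ω t * (x + 1) * s ^ x +
          tail ω t * C * y ^ β * (x + 1) * (s ^ x * (1 - s) ^ β) := fun s => by ring
    simp_rw [this]
    rw [intervalIntegral.integral_add (by apply Continuous.intervalIntegrable; fun_prop)
      (by apply Continuous.intervalIntegrable; fun_prop), intervalIntegral.integral_const_mul,
      intervalIntegral.integral_const_mul, integral_pow]
    field_simp
    simp
  rw [hint] at key
  -- Since y = x + 2, this is (x+1)! (x+2)^β ≤ (x+1+β)!.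
  have hf : y ^ β * ((x + 1) * ((x.factorial * β.factorial : ℝ) / (x + β + 1).factorial))
      ≤ β.factorial := by
    have h1 : (x + 1).factorial * (x + 2) ^ β ≤ (x + 1 + β).factorial :=
      Nat.factorial_mul_pow_le_factorial
    have h2 : ((x + 1).factorial * (x + 2) ^ β : ℝ) ≤ (x + β + 1).factorial := by
      rw [show x + β + 1 = x + 1 + β by ring]
      exact_mod_cast h1
    have h3 : y = x + 2 := by rw [hy]; push_cast; ring
    rw [h3, ← mul_div_assoc, ← mul_div_assoc, div_le_iff₀ (by positivity)]
    rw [Nat.factorial_succ] at h2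
    push_cast at h2
    have h4 : (0 : ℝ) ≤ β.factorial := by positivity
    nlinarith
  have hnn : 0 ≤ tail ω t * (1 + C * y ^ β * ((x + 1) *
        ((x.factorial * β.factorial : ℝ) / (x + β + 1).factorial))) := by positivity
  have key2 := (ENNReal.ofReal_le_ofReal_iff hnn).1 key
  refine key2.trans ?_
  rw [mul_comm]
  refine mul_le_mul_of_nonneg_right ?_ hT.le
  have : 0 ≤ C := by linarith
  nlinarith

/-- The moments occurring in the kernel of the weighted Bergman space on the ball of `ℂⁿ`. -/
noncomputable def ballMoment (n : ℕ) (ω : ℝ → ℝ) (k : ℕ) : ℝ := moment ω (2 * k + (2 * n - 1))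

theorem IsRadialWeight.ballMoment_pos {ω : ℝ → ℝ} (h : IsRadialWeight ω) (n k : ℕ) :
    0 < ballMoment n ω k := h.moment_pos _

/-- The order 2k + 2n - 1, increased by one, is at most 2n(k+1), so the scales 1/(k+1) and 1/(2k+2n)
differ by a bounded factor, which doubling absorbs. -/
theorem IsClassD.exists_tail_le_ballMoment {n : ℕ} (hn : 1 ≤ n) {ω : ℝ → ℝ} (h : IsClassD ω) :
    ∃ C : ℝ, 0 < C ∧ ∀ k : ℕ, tail ω (1 - 1 / ((k : ℝ) + 1)) ≤ C * ballMoment n ω k := by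
  obtain ⟨β, C, hC, hd⟩ := h.exists_tail_mul_pow_le
  refine ⟨C * (2 * n) ^ β * Real.exp 1, by positivity, fun k => ?_⟩
  set x := 2 * k + (2 * n - 1)
  have hx : (x : ℝ) + 1 = 2 * k + 2 * n := by
    have : x + 1 = 2 * k + 2 * n := by omega
    exact_mod_cast this
  have hn' : (1 : ℝ) ≤ n := by exact_mod_cast hn
  have hk : (0 : ℝ) ≤ k := Nat.cast_nonneg k
  have h1 : (k : ℝ) + 1 ≤ x + 1 := by rw [hx]; linarith
  have h2 : 1 / ((k : ℝ) + 1) ≤ 1 := by rw [div_le_one (by positivity)]; linarith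
  have h3 : 1 / ((x : ℝ) + 1) ≤ 1 / ((k : ℝ) + 1) := by gcongr
  have h4 : 0 < 1 / ((x : ℝ) + 1) := by positivity
  have h5 := hd (1 - 1 / ((k : ℝ) + 1)) (1 - 1 / ((x : ℝ) + 1)) (by linarith) (by linarith)
    (by linarith)
  rw [sub_sub_cancel, sub_sub_cancel] at h5
  have h6 := h.weight.tail_le_moment x
  have h7 : 0 < tail ω (1 - 1 / ((x : ℝ) + 1)) := h.weight.tail_pos ⟨by linarith, by linarith⟩
  have h8 : tail ω (1 - 1 / ((k : ℝ) + 1)) ≤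
      C * (((x : ℝ) + 1) / ((k : ℝ) + 1)) ^ β * tail ω (1 - 1 / ((x : ℝ) + 1)) := by
    rw [div_pow, one_pow, div_pow, one_pow, mul_one_div, div_le_iff₀ (by positivity)] at h5
    rw [div_pow]
    calc _ ≤ _ := h5
      _ = _ := by field_simp
  have h9 : ((x : ℝ) + 1) / ((k : ℝ) + 1) ≤ 2 * n := by
    rw [div_le_iff₀ (by positivity), hx]
    nlinarith
  calc _ ≤ _ := h8
    _ ≤ C * (2 * n) ^ β * (Real.exp 1 * moment ω x) := by gcongr
    _ = _ := by unfold ballMoment; ring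

theorem IsClassD.exists_moment_le_ballMoment {n : ℕ} (hn : 1 ≤ n) {ω : ℝ → ℝ} (h : IsClassD ω) :
    ∃ C : ℝ, 0 < C ∧ ∀ k : ℕ, moment ω k ≤ C * ballMoment n ω k := by
  obtain ⟨C₁, hC₁, h1⟩ := h.exists_moment_le_tail
  obtain ⟨C₂, hC₂, h2⟩ := h.exists_tail_le_ballMoment hn
  refine ⟨C₁ * C₂, by positivity, fun k => (h1 k).trans ?_⟩
  rw [mul_assoc]
  exact mul_le_mul_of_nonneg_left (h2 k) hC₁.le

/-- The tail at `R` is controlled by all the moments, with polynomial loss. -/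
theorem IsClassD.exists_tail_le_mul_ballMoment {n : ℕ} (hn : 1 ≤ n) {ω : ℝ → ℝ} (h : IsClassD ω) :
    ∃ β : ℕ, ∃ C : ℝ, 0 < C ∧ ∀ k : ℕ, ∀ R ∈ Ico (0 : ℝ) 1,
      tail ω R ≤ C * (1 + (((k : ℝ) + 1) * (1 - R)) ^ β) * ballMoment n ω k := by
  obtain ⟨β, C, hC, hd⟩ := h.exists_tail_mul_pow_le
  obtain ⟨C₂, hC₂, h2⟩ := h.exists_tail_le_ballMoment hn
  refine ⟨β, C * C₂, by positivity, fun k R hR => ?_⟩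
  have hk : (0 : ℝ) ≤ k := Nat.cast_nonneg k
  have h3 : 1 / ((k : ℝ) + 1) ≤ 1 := by rw [div_le_one (by positivity)]; linarith
  have h4 : 0 < 1 / ((k : ℝ) + 1) := by positivity
  have hR' : 0 ≤ 1 - R := by linarith [hR.2]
  have hT := h.weight.tail_pos (r := 1 - 1 / ((k : ℝ) + 1)) ⟨by linarith, by linarith⟩
  have hX : 0 ≤ (((k : ℝ) + 1) * (1 - R)) ^ β := by positivity
  have h5 : tail ω R ≤ C * (1 + (((k : ℝ) + 1) * (1 - R)) ^ β) * tail ω (1 - 1 / ((k : ℝ) + 1)) := by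
    rcases le_total (1 - 1 / ((k : ℝ) + 1)) R with h5 | h5
    · refine (h.weight.tail_anti (by linarith) h5).trans (le_mul_of_one_le_left hT.le ?_)
      nlinarith
    · have h6 := hd R _ hR.1 h5 (by linarith)
      rw [sub_sub_cancel, div_pow, one_pow, mul_one_div, div_le_iff₀ (by positivity)] at h6
      calc _ ≤ _ := h6
        _ = C * (((k : ℝ) + 1) * (1 - R)) ^ β * tail ω (1 - 1 / ((k : ℝ) + 1)) := by
          rw [mul_pow]; ring
        _ ≤ _ := by gcongr; linarith
  calc _ ≤ _ := h5
    _ ≤ C * (1 + (((k : ℝ) + 1) * (1 - R)) ^ β) * (C₂ * ballMoment n ω k) := by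
      gcongr
      exact h2 k
    _ = _ := by ring

/-- Up to its binomial coefficient, the left side is a single term of the expansion of (r +
(1-r))^(k+i) = 1, and that coefficient is at least (k+1)^i / i!. -/
theorem pow_mul_one_sub_pow_le (k i : ℕ) {r : ℝ} (h0 : 0 ≤ r) (h1 : r ≤ 1) :
    r ^ k * (1 - r) ^ i ≤ i.factorial / ((k : ℝ) + 1) ^ i := by
  have h1' : 0 ≤ 1 - r := by linarith
  have h2 : r ^ k * (1 - r) ^ i * ((k + i).choose k : ℝ) ≤ 1 := by
    have h3 := add_pow r (1 - r) (k + i)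
    rw [add_sub_cancel, one_pow] at h3
    refine le_trans ?_ h3.ge
    refine le_trans (le_of_eq ?_) (Finset.single_le_sum (f := fun m => r ^ m * (1 - r) ^ (k + i - m) *
      ((k + i).choose m : ℝ)) (fun m _ => by positivity) (Finset.mem_range.2 (show k < k + i + 1 by omega)))
    simp
  have h3 : k.factorial * (k + 1) ^ i ≤ (k + i).factorial := Nat.factorial_mul_pow_le_factorial
  have h4 : (k + i).choose k * k.factorial * i.factorial = (k + i).factorial := by
    have := Nat.choose_mul_factorial_mul_factorial (show k ≤ k + i by omega)
    simpa using this
  have h5 : (k + 1) ^ i ≤ (k + i).choose k * i.factorial := by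
    have : k.factorial * (k + 1) ^ i ≤ k.factorial * ((k + i).choose k * i.factorial) := by
      rw [← h4] at h3; linarith
    exact Nat.le_of_mul_le_mul_left this k.factorial_pos
  have h6 : ((k : ℝ) + 1) ^ i ≤ (k + i).choose k * i.factorial := by exact_mod_cast h5
  rw [le_div_iff₀ (by positivity)]
  calc r ^ k * (1 - r) ^ i * ((k : ℝ) + 1) ^ i
      ≤ r ^ k * (1 - r) ^ i * ((k + i).choose k * i.factorial) := by gcongr
    _ = (r ^ k * (1 - r) ^ i * ((k + i).choose k)) * i.factorial := by ring
    _ ≤ _ := mul_le_of_le_one_left (by positivity) h2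

/-- The moments `∫ r^{2k+2n-1} (1-r²)^i ω(r) dr`, which are the iterated differences in `k` of
`ballMoment` up to sign. -/
noncomputable def diffMoment (n : ℕ) (ω : ℝ → ℝ) (i k : ℕ) : ℝ :=
  ∫ r in Ico (0 : ℝ) 1, (r ^ (2 * k + (2 * n - 1)) * (1 - r ^ 2) ^ i) * ω r

theorem diffMoment_zero (n : ℕ) (ω : ℝ → ℝ) (k : ℕ) : diffMoment n ω 0 k = ballMoment n ω k := by
  simp [diffMoment, ballMoment, moment]

theorem IsRadialWeight.diffMoment_succ {ω : ℝ → ℝ} (h : IsRadialWeight ω) (n i k : ℕ) :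
    diffMoment n ω i (k + 1) - diffMoment n ω i k = -diffMoment n ω (i + 1) k := by
  unfold diffMoment
  rw [← integral_sub (h.integrableOn_mul (by fun_prop)) (h.integrableOn_mul (by fun_prop)),
    ← integral_neg]
  congr 1
  ext r
  ring

/-- Half of the power r^(2k) pays for (1-r)^i and yields (k+1)^(-i). The other half leaves the
moment of order k, which doubling compares with `ballMoment`. -/
theorem IsClassD.exists_abs_diffMoment_le {n : ℕ} (hn : 1 ≤ n) {ω : ℝ → ℝ} (h : IsClassD ω)
    (i : ℕ) : ∃ C : ℝ, 0 ≤ C ∧ ∀ k : ℕ,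
      |diffMoment n ω i k| ≤ C * (ballMoment n ω k / ((k : ℝ) + 1) ^ i) := by
  obtain ⟨C, hC, hm⟩ := h.exists_moment_le_ballMoment hn
  refine ⟨2 ^ i * i.factorial * C, by positivity, fun k => ?_⟩
  have hnn : 0 ≤ diffMoment n ω i k := by
    refine setIntegral_nonneg measurableSet_Ico fun r hr => ?_
    have := hr.1
    have : 0 ≤ 1 - r ^ 2 := by nlinarith [hr.1, hr.2]
    have := (h.weight.pos r hr).le
    positivity
  rw [abs_of_nonneg hnn]
  calc diffMoment n ω i k
      ≤ ∫ r in Ico (0 : ℝ) 1, (2 ^ i * (i.factorial / ((k : ℝ) + 1) ^ i)) * (r ^ k * ω r) := by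
        refine setIntegral_mono_on (h.weight.integrableOn_mul (by fun_prop))
          ((h.weight.integrableOn_mul (by fun_prop)).const_mul _) measurableSet_Ico fun r hr => ?_
        have h0 := hr.1
        have h1 : 0 ≤ 1 - r := by linarith [hr.2]
        have hω := (h.weight.pos r hr).le
        rw [← mul_assoc]
        refine mul_le_mul_of_nonneg_right ?_ hω
        have h2 : (1 - r ^ 2) ^ i ≤ 2 ^ i * (1 - r) ^ i := by
          rw [← mul_pow]
          refine pow_le_pow_left₀ (by nlinarith) (by nlinarith) _
        have h3 : r ^ (2 * k + (2 * n - 1)) ≤ r ^ k * r ^ k := by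
          rw [← pow_add]
          exact pow_le_pow_of_le_one h0 hr.2.le (by omega)
        have h5 : 0 ≤ 1 - r ^ 2 := by nlinarith
        calc r ^ (2 * k + (2 * n - 1)) * (1 - r ^ 2) ^ i
            ≤ (r ^ k * r ^ k) * (2 ^ i * (1 - r) ^ i) := by gcongr
          _ = 2 ^ i * (r ^ k * (1 - r) ^ i) * r ^ k := by ring
          _ ≤ _ := by
            gcongr
            exact pow_mul_one_sub_pow_le k i h0 hr.2.le
    _ = (2 ^ i * (i.factorial / ((k : ℝ) + 1) ^ i)) * moment ω k := integral_const_mul _ _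
    _ ≤ (2 ^ i * (i.factorial / ((k : ℝ) + 1) ^ i)) * (C * ballMoment n ω k) := by
        gcongr
        exact hm k
    _ = _ := by ring

/-! ### Sequences with symbol-type difference bounds -/

/-- The forward difference of a sequence. -/
def fdiff (f : ℕ → ℝ) (k : ℕ) : ℝ := f (k + 1) - f k

/-- The first `j` differences of `f` satisfy `|Δ^i f(k)| ≲ γ(k) (k+1)^{-i}`. -/
def SymbolBound : ℕ → (ℕ → ℝ) → (ℕ → ℝ) → Prop
  | 0, f, γ => ∃ C : ℝ, 0 ≤ C ∧ ∀ k, |f k| ≤ C * γ k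
  | j + 1, f, γ => (∃ C : ℝ, 0 ≤ C ∧ ∀ k, |f k| ≤ C * γ k) ∧
      SymbolBound j (fdiff f) (fun k => γ k / ((k : ℝ) + 1))

namespace SymbolBound

theorem bound {j : ℕ} {f γ : ℕ → ℝ} (h : SymbolBound j f γ) :
    ∃ C : ℝ, 0 ≤ C ∧ ∀ k, |f k| ≤ C * γ k := by
  cases j with
  | zero => exact h
  | succ j => exact h.1

theorem of_succ {j : ℕ} {f γ : ℕ → ℝ} (h : SymbolBound (j + 1) f γ) : SymbolBound j f γ := by
  induction j generalizing f γ with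
  | zero => exact h.1
  | succ j ih => exact ⟨h.1, ih h.2⟩

theorem mono {j : ℕ} {f γ δ : ℕ → ℝ} (h : SymbolBound j f γ) (C : ℝ) (hC : 0 ≤ C)
    (hγ : ∀ k, γ k ≤ C * δ k) : SymbolBound j f δ := by
  have key : ∀ {f γ δ : ℕ → ℝ}, (∃ C : ℝ, 0 ≤ C ∧ ∀ k, |f k| ≤ C * γ k) → (∀ k, γ k ≤ C * δ k) →
      ∃ C : ℝ, 0 ≤ C ∧ ∀ k, |f k| ≤ C * δ k := by
    rintro f γ δ ⟨C', hC', hf⟩ hγ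
    refine ⟨C' * C, by positivity, fun k => (hf k).trans ?_⟩
    rw [mul_assoc]
    exact mul_le_mul_of_nonneg_left (hγ k) hC'
  induction j generalizing f γ δ with
  | zero => exact key h hγ
  | succ j ih =>
    refine ⟨key h.1 hγ, ih h.2 fun k => ?_⟩
    rw [← mul_div_assoc]
    exact div_le_div_of_nonneg_right (hγ k) (by positivity)

theorem congr {j : ℕ} {f γ δ : ℕ → ℝ} (h : SymbolBound j f γ) (hγ : ∀ k, γ k = δ k) :
    SymbolBound j f δ :=
  h.mono 1 zero_le_one fun k => by rw [hγ, one_mul]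

theorem add {j : ℕ} {f g γ : ℕ → ℝ} (hf : SymbolBound j f γ) (hg : SymbolBound j g γ) :
    SymbolBound j (fun k => f k + g k) γ := by
  have key : ∀ {f g γ : ℕ → ℝ}, (∃ C : ℝ, 0 ≤ C ∧ ∀ k, |f k| ≤ C * γ k) →
      (∃ C : ℝ, 0 ≤ C ∧ ∀ k, |g k| ≤ C * γ k) →
      ∃ C : ℝ, 0 ≤ C ∧ ∀ k, |f k + g k| ≤ C * γ k := by
    rintro f g γ ⟨C, hC, h1⟩ ⟨C', hC', h2⟩
    refine ⟨C + C', by positivity, fun k => (abs_add_le _ _).trans ?_⟩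
    rw [add_mul]
    exact add_le_add (h1 k) (h2 k)
  induction j generalizing f g γ with
  | zero => exact key hf hg
  | succ j ih =>
    refine ⟨key hf.1 hg.1, ?_⟩
    have : fdiff (fun k => f k + g k) = fun k => fdiff f k + fdiff g k := by
      ext k; simp only [fdiff]; ring
    rw [this]
    exact ih hf.2 hg.2

theorem neg {j : ℕ} {f γ : ℕ → ℝ} (hf : SymbolBound j f γ) :
    SymbolBound j (fun k => -f k) γ := by
  induction j generalizing f γ with
  | zero => obtain ⟨C, hC, h⟩ := hf; exact ⟨C, hC, fun k => by rw [abs_neg]; exact h k⟩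
  | succ j ih =>
    refine ⟨?_, ?_⟩
    · obtain ⟨C, hC, h⟩ := hf.1
      exact ⟨C, hC, fun k => by rw [abs_neg]; exact h k⟩
    · have : fdiff (fun k => -f k) = fun k => -fdiff f k := by
        ext k; simp only [fdiff]; ring
      rw [this]
      exact ih hf.2

theorem div_succ_le {δ : ℕ → ℝ} (hδ : ∀ k, 0 ≤ δ k) (k : ℕ) : δ k / ((k : ℝ) + 1) ≤ 1 * δ k := by
  rw [one_mul]
  exact div_le_self (hδ k) (by linarith [(Nat.cast_nonneg k : (0 : ℝ) ≤ k)])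

/-- The discrete Leibniz rule. Writing g(k+1) as g + Δg avoids any assumption on how δ changes under
a shift. -/
theorem mul {j : ℕ} {f g γ δ : ℕ → ℝ} (hf : SymbolBound j f γ) (hg : SymbolBound j g δ)
    (hγ : ∀ k, 0 ≤ γ k) (hδ : ∀ k, 0 ≤ δ k) :
    SymbolBound j (fun k => f k * g k) (fun k => γ k * δ k) := by
  have key : ∀ {f g γ δ : ℕ → ℝ}, (∀ k, 0 ≤ γ k) → (∃ C : ℝ, 0 ≤ C ∧ ∀ k, |f k| ≤ C * γ k) →
      (∃ C : ℝ, 0 ≤ C ∧ ∀ k, |g k| ≤ C * δ k) →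
      ∃ C : ℝ, 0 ≤ C ∧ ∀ k, |f k * g k| ≤ C * (γ k * δ k) := by
    rintro f g γ δ hγ ⟨C, hC, h1⟩ ⟨C', hC', h2⟩
    refine ⟨C * C', by positivity, fun k => ?_⟩
    rw [abs_mul]
    calc |f k| * |g k| ≤ (C * γ k) * (C' * δ k) :=
          mul_le_mul (h1 k) (h2 k) (abs_nonneg _) (mul_nonneg hC (hγ k))
      _ = _ := by ring
  induction j generalizing f g γ δ with
  | zero => exact key hγ hf hg
  | succ j ih =>
    refine ⟨key hγ hf.1 hg.1, ?_⟩
    have e : fdiff (fun k => f k * g k) =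
        fun k => fdiff f k * (g k + fdiff g k) + f k * fdiff g k := by
      ext k; simp only [fdiff]; ring
    rw [e]
    have hγ' : ∀ k : ℕ, 0 ≤ γ k / ((k : ℝ) + 1) := fun k => div_nonneg (hγ k) (by positivity)
    have hδ' : ∀ k : ℕ, 0 ≤ δ k / ((k : ℝ) + 1) := fun k => div_nonneg (hδ k) (by positivity)
    refine add ?_ ?_
    · refine (ih hf.2 (hg.of_succ.add (hg.2.mono 1 zero_le_one (div_succ_le hδ))) hγ' hδ).congr ?_
      intro k; ring
    · refine (ih hf.of_succ hg.2 hγ hδ').congr ?_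
      intro k; ring

theorem shift {j : ℕ} {f γ : ℕ → ℝ} (hf : SymbolBound j f γ) (hγ : ∀ k, 0 ≤ γ k)
    {C : ℝ} (hC : 0 ≤ C) (hreg : ∀ k, γ (k + 1) ≤ C * γ k) :
    SymbolBound j (fun k => f (k + 1)) γ := by
  have key : ∀ {f γ : ℕ → ℝ}, (∃ C : ℝ, 0 ≤ C ∧ ∀ k, |f k| ≤ C * γ k) →
      (∀ k, γ (k + 1) ≤ C * γ k) → ∃ C : ℝ, 0 ≤ C ∧ ∀ k, |f (k + 1)| ≤ C * γ k := by
    rintro f γ ⟨C', hC', h1⟩ hreg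
    refine ⟨C' * C, by positivity, fun k => (h1 _).trans ?_⟩
    rw [mul_assoc]
    exact mul_le_mul_of_nonneg_left (hreg k) hC'
  induction j generalizing f γ with
  | zero => exact key hf hreg
  | succ j ih =>
    refine ⟨key hf.1 hreg, ?_⟩
    refine ih (f := fdiff f) hf.2 (fun k => div_nonneg (hγ k) (by positivity)) fun k => ?_
    rw [← mul_div_assoc]
    have h1 : 0 ≤ γ (k + 1) := hγ _
    calc γ (k + 1) / (((k + 1 : ℕ) : ℝ) + 1) ≤ γ (k + 1) / ((k : ℝ) + 1) := by
          gcongr; linarith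
      _ ≤ _ := by gcongr; exact hreg k

/-- The difference of 1/μ is -Δμ(k) / (μ(k) μ(k+1)), so the bound follows from the product rule by
induction. The regularity `hreg` controls the shifted reciprocal. -/
theorem inv {μ : ℕ → ℝ} (hpos : ∀ k, 0 < μ k) (hμ : ∀ j, SymbolBound j μ μ) {C : ℝ} (hC : 0 ≤ C)
    (hreg : ∀ k, μ k ≤ C * μ (k + 1)) (j : ℕ) :
    SymbolBound j (fun k => (μ k)⁻¹) (fun k => (μ k)⁻¹) := by
  have hi : ∀ k, 0 ≤ (μ k)⁻¹ := fun k => (inv_pos.2 (hpos k)).le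
  have h0 : ∃ C : ℝ, 0 ≤ C ∧ ∀ k, |(μ k)⁻¹| ≤ C * (μ k)⁻¹ :=
    ⟨1, zero_le_one, fun k => by rw [one_mul, abs_of_nonneg (hi k)]⟩
  have hr : ∀ k, (μ (k + 1))⁻¹ ≤ C * (μ k)⁻¹ := fun k => by
    have := hpos k
    have := hpos (k + 1)
    rw [← div_eq_mul_inv, le_div_iff₀ (by positivity), inv_mul_le_iff₀ (by positivity), mul_comm]
    exact hreg k
  induction j with
  | zero => exact h0
  | succ j ih =>
    refine ⟨h0, ?_⟩
    have e : fdiff (fun k => (μ k)⁻¹) =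
        fun k => -(fdiff μ k * ((μ k)⁻¹ * (μ (k + 1))⁻¹)) := by
      ext k
      have := (hpos k).ne'
      have := (hpos (k + 1)).ne'
      simp only [fdiff]
      field_simp
      ring
    rw [e]
    refine neg ?_
    have h1 := ih.mul (ih.shift hi hC hr) hi hi
    have h2 := (hμ (j + 1)).2.mul h1 (fun k => div_nonneg (hpos k).le (by positivity))
      (fun k => mul_nonneg (hi k) (hi k))
    refine h2.congr fun k => ?_
    have := (hpos k).ne'
    field_simp

theorem zero (j : ℕ) {γ : ℕ → ℝ} (hγ : ∀ k, 0 ≤ γ k) : SymbolBound j (fun _ => 0) γ := by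
  induction j generalizing γ with
  | zero => exact ⟨0, le_rfl, by simp⟩
  | succ j ih =>
    refine ⟨⟨0, le_rfl, by simp⟩, ?_⟩
    have : fdiff (fun _ : ℕ => (0 : ℝ)) = fun _ => 0 := by ext k; simp [fdiff]
    rw [this]
    exact ih fun k => div_nonneg (hγ k) (by positivity)

theorem const (j : ℕ) (c : ℝ) : SymbolBound j (fun _ => c) (fun _ => 1) := by
  have h0 : ∃ C : ℝ, 0 ≤ C ∧ ∀ k : ℕ, |c| ≤ C * (fun _ : ℕ => (1 : ℝ)) k :=
    ⟨|c|, abs_nonneg c, by simp⟩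
  cases j with
  | zero => exact h0
  | succ j =>
    refine ⟨h0, ?_⟩
    have : fdiff (fun _ : ℕ => c) = fun _ => 0 := by ext k; simp [fdiff]
    rw [this]
    exact zero j fun k => by positivity

theorem linear (j : ℕ) {c : ℝ} (hc : 0 ≤ c) :
    SymbolBound j (fun k => (k : ℝ) + c) (fun k => (k : ℝ) + 1) := by
  have h0 : ∃ C : ℝ, 0 ≤ C ∧ ∀ k : ℕ, |(k : ℝ) + c| ≤ C * ((k : ℝ) + 1) := by
    refine ⟨c + 1, by positivity, fun k => ?_⟩
    rw [abs_of_nonneg (by positivity)]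
    have : (0 : ℝ) ≤ k := Nat.cast_nonneg k
    nlinarith
  cases j with
  | zero => exact h0
  | succ j =>
    refine ⟨h0, ?_⟩
    have : fdiff (fun k : ℕ => (k : ℝ) + c) = fun _ => 1 := by
      ext k; simp only [fdiff]; push_cast; ring
    rw [this]
    refine (const j 1).congr fun k => ?_
    field_simp

/-- Raising N by one multiplies the binomial coefficient by (k+N+1)/(N+1), a linear symbol, so the
product rule applies. -/
theorem choose (j N : ℕ) :
    SymbolBound j (fun k => ((k + N).choose N : ℝ)) (fun k => ((k : ℝ) + 1) ^ N) := by
  induction N with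
  | zero => simpa using const j 1
  | succ N ih =>
    have h1 := (const j (1 / ((N : ℝ) + 1))).mul
      ((ih.mul (linear j (c := (N : ℝ) + 1) (by positivity)) (fun k => by positivity)
        (fun k => by positivity))) (fun k => by positivity) (fun k => by positivity)
    have e : (fun k : ℕ => ((k + (N + 1)).choose (N + 1) : ℝ)) = fun k =>
        1 / ((N : ℝ) + 1) * (((k + N).choose N : ℝ) * ((k : ℝ) + (N + 1))) := by
      ext k
      have := Nat.add_one_mul_choose_eq (k + N) N
      have h2 : ((k + N + 1 : ℕ) : ℝ) * ((k + N).choose N : ℝ) =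
        ((k + N + 1).choose (N + 1) : ℝ) * ((N + 1 : ℕ) : ℝ) := by exact_mod_cast this
      push_cast at h2
      rw [← add_assoc k N 1]
      field_simp
      linarith
    rw [e]
    refine h1.congr fun k => ?_
    rw [pow_succ]; ring

theorem iterate_fdiff {j : ℕ} {f γ : ℕ → ℝ} (h : SymbolBound j f γ) :
    ∃ C : ℝ, 0 ≤ C ∧ ∀ k, |fdiff^[j] f k| ≤ C * (γ k / ((k : ℝ) + 1) ^ j) := by
  induction j generalizing f γ with
  | zero => simpa using h.bound
  | succ j ih =>
    obtain ⟨C, hC, h1⟩ := ih h.2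
    refine ⟨C, hC, fun k => ?_⟩
    rw [Function.iterate_succ_apply, pow_succ', ← div_div]
    exact h1 k

end SymbolBound

/-- A difference in k inserts a factor -(1-r²) under the integral, so the family `diffMoment n ω i`
is closed under differences up to sign; the induction must therefore run over all i at once. -/
theorem IsClassD.symbolBound_ballMoment {n : ℕ} (hn : 1 ≤ n) {ω : ℝ → ℝ} (h : IsClassD ω)
    (j : ℕ) : SymbolBound j (ballMoment n ω) (ballMoment n ω) := by
  have key : ∀ j i : ℕ, SymbolBound j (diffMoment n ω i)
      (fun k => ballMoment n ω k / ((k : ℝ) + 1) ^ i) := by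
    intro j
    induction j with
    | zero => intro i; exact h.exists_abs_diffMoment_le hn i
    | succ j ih =>
      intro i
      refine ⟨h.exists_abs_diffMoment_le hn i, ?_⟩
      have : fdiff (diffMoment n ω i) = fun k => -diffMoment n ω (i + 1) k := by
        ext k; exact h.weight.diffMoment_succ n i k
      rw [this]
      refine ((ih (i + 1)).neg).congr fun k => ?_
      rw [pow_succ, div_div]
  have h1 := key j 0
  have : diffMoment n ω 0 = ballMoment n ω := funext fun k => diffMoment_zero n ω k
  rw [this] at h1
  exact h1.congr fun k => by simp

theorem IsClassD.symbolBound_inv_ballMoment {n : ℕ} (hn : 1 ≤ n) {ω : ℝ → ℝ} (h : IsClassD ω)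
    (j : ℕ) : SymbolBound j (fun k => (ballMoment n ω k)⁻¹) (fun k => (ballMoment n ω k)⁻¹) := by
  obtain ⟨C, hC, hm⟩ := h.exists_moment_le_ballMoment hn
  refine SymbolBound.inv (h.weight.ballMoment_pos n) (h.symbolBound_ballMoment hn) hC.le
    (fun k => (h.weight.moment_anti ?_).trans (hm (k + 1))) j
  omega

/-- Coefficients of the radially differentiated kernel: the kernel coefficient divided by the Beta
integral `∫_0^1 x^k (1-x)^{n-1} dx`. -/
noncomputable def diffKernelCoeff (n : ℕ) (ω : ℝ → ℝ) (k : ℕ) : ℝ :=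
  (((k + (n - 1)).choose (n - 1) : ℝ) * ((k + n).choose n : ℝ)) * (ballMoment n ω k)⁻¹

theorem IsClassD.symbolBound_diffKernelCoeff {n : ℕ} (hn : 1 ≤ n) {ω : ℝ → ℝ} (h : IsClassD ω)
    (j : ℕ) : SymbolBound j (diffKernelCoeff n ω)
      (fun k => ((k : ℝ) + 1) ^ (n - 1) * ((k : ℝ) + 1) ^ n * (ballMoment n ω k)⁻¹) := by
  have hi : ∀ k, 0 ≤ (ballMoment n ω k)⁻¹ := fun k => (inv_pos.2 (h.weight.ballMoment_pos n k)).le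
  exact ((SymbolBound.choose j (n - 1)).mul (SymbolBound.choose j n) (fun k => by positivity)
    (fun k => by positivity)).mul (h.symbolBound_inv_ballMoment hn j) (fun k => by positivity) hi

/-- The n differences remove exactly the growth (k+1)^n that the second binomial coefficient
introduced. -/
theorem IsClassD.exists_fdiff_diffKernelCoeff_le {n : ℕ} (hn : 1 ≤ n) {ω : ℝ → ℝ}
    (h : IsClassD ω) : ∃ C : ℝ, 0 ≤ C ∧ ∀ k,
      |fdiff^[n] (diffKernelCoeff n ω) k| ≤ C * (((k : ℝ) + 1) ^ (n - 1) * (ballMoment n ω k)⁻¹) := by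
  obtain ⟨C, hC, h1⟩ := (h.symbolBound_diffKernelCoeff hn n).iterate_fdiff
  refine ⟨C, hC, fun k => (h1 k).trans (le_of_eq ?_)⟩
  field_simp

/-- The reciprocal moments grow at most polynomially. -/
theorem IsClassD.exists_inv_ballMoment_le {n : ℕ} (hn : 1 ≤ n) {ω : ℝ → ℝ} (h : IsClassD ω) :
    ∃ β : ℕ, ∃ C : ℝ, 0 < C ∧ ∀ k : ℕ, (ballMoment n ω k)⁻¹ ≤ C * ((k : ℝ) + 1) ^ β := by
  obtain ⟨β, C, hC, hd⟩ := h.exists_tail_le_mul_ballMoment hn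
  have h0 := h.weight.tail_pos (r := 0) ⟨le_rfl, one_pos⟩
  refine ⟨β, 2 * C / tail ω 0, by positivity, fun k => ?_⟩
  have h1 := hd k 0 ⟨le_rfl, one_pos⟩
  have hm := h.weight.ballMoment_pos n k
  rw [sub_zero, mul_one] at h1
  have h2 : (1 : ℝ) ≤ ((k : ℝ) + 1) ^ β :=
    one_le_pow₀ (by linarith [(Nat.cast_nonneg k : (0 : ℝ) ≤ k)])
  rw [inv_le_iff_one_le_mul₀ hm, div_mul_eq_mul_div, div_mul_eq_mul_div, le_div_iff₀ h0, one_mul]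
  refine h1.trans ?_
  rw [mul_comm 2 C, mul_assoc C 2]
  gcongr
  linarith

/-! ### Multiplication of power series by powers of `1 - w` -/

theorem succ_pow_le_factorial_mul_choose (k N : ℕ) :
    ((k : ℝ) + 1) ^ N ≤ N.factorial * (k + N).choose N := by
  have h3 : k.factorial * (k + 1) ^ N ≤ (k + N).factorial := Nat.factorial_mul_pow_le_factorial
  have h4 : (k + N).choose N * N.factorial * k.factorial = (k + N).factorial := by
    have := Nat.choose_mul_factorial_mul_factorial (show N ≤ k + N by omega)
    simpa using this
  have : k.factorial * (k + 1) ^ N ≤ k.factorial * (N.factorial * (k + N).choose N) := by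
    rw [← h4] at h3; linarith
  exact_mod_cast Nat.le_of_mul_le_mul_left this k.factorial_pos

theorem summable_poly_mul_pow {f : ℕ → ℝ} {C : ℝ} {N : ℕ} (hf : ∀ k, |f k| ≤ C * ((k : ℝ) + 1) ^ N)
    {w : ℂ} (hw : ‖w‖ < 1) : Summable fun k => ‖(f k : ℂ) * w ^ k‖ := by
  have hs1 := summable_choose_mul_geometric_of_norm_lt_one (R := ℝ) N (r := ‖w‖) (by simpa using hw)
  have hs2 := hs1.mul_left (C * N.factorial)
  refine hs2.of_nonneg_of_le (fun k => norm_nonneg _) fun k => ?_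
  rw [norm_mul, norm_pow, Complex.norm_real, Real.norm_eq_abs]
  have h2 := succ_pow_le_factorial_mul_choose k N
  have hC : 0 ≤ C := by
    have := (abs_nonneg _).trans (hf 0)
    simpa using this
  calc |f k| * ‖w‖ ^ k ≤ (C * ((k : ℝ) + 1) ^ N) * ‖w‖ ^ k := by gcongr; exact hf k
    _ ≤ (C * (N.factorial * (k + N).choose N)) * ‖w‖ ^ k := by gcongr
    _ = _ := by ring

theorem one_sub_mul_tsum {f : ℕ → ℝ} {w : ℂ} (hf : Summable fun k => ‖(f k : ℂ) * w ^ k‖)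
    (hf' : Summable fun k => ‖(fdiff f k : ℂ) * w ^ k‖) :
    (1 - w) * ∑' k, (f k : ℂ) * w ^ k = f 0 + w * ∑' k, (fdiff f k : ℂ) * w ^ k := by
  have h1 := hf.of_norm
  have h2 := hf'.of_norm
  have h3 : ∑' k, (f k : ℂ) * w ^ k = f 0 + ∑' k, (f (k + 1) : ℂ) * w ^ (k + 1) := by
    rw [h1.tsum_eq_zero_add]; simp
  have h4 : w * ∑' k, (fdiff f k : ℂ) * w ^ k =
      ∑' k, (f (k + 1) : ℂ) * w ^ (k + 1) - w * ∑' k, (f k : ℂ) * w ^ k := by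
    rw [← tsum_mul_left, ← tsum_mul_left, ← Summable.tsum_sub]
    · congr 1; ext k; simp only [fdiff]; push_cast; ring
    · exact (summable_nat_add_iff 1 (f := fun k => (f k : ℂ) * w ^ k)).2 h1
    · exact h1.mul_left w
  rw [h4]
  linear_combination h3

/-- Summation by parts, (1-w) Σ f_k w^k = f_0 + w Σ (Δf)_k w^k, iterated j times. The boundary terms
stay bounded because |1-w| ≤ 2. -/
theorem norm_one_sub_pow_mul_tsum_le (j : ℕ) {f : ℕ → ℝ}
    (hf : ∀ i ≤ j, ∀ w : ℂ, ‖w‖ < 1 → Summable fun k => ‖(fdiff^[i] f k : ℂ) * w ^ k‖) :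
    ∃ C : ℝ, 0 ≤ C ∧ ∀ w : ℂ, ‖w‖ < 1 →
      ‖1 - w‖ ^ j * ‖∑' k, (f k : ℂ) * w ^ k‖ ≤ C + ‖∑' k, (fdiff^[j] f k : ℂ) * w ^ k‖ := by
  induction j generalizing f with
  | zero => exact ⟨0, le_rfl, fun w _ => by simp⟩
  | succ j ih =>
    obtain ⟨C, hC, h1⟩ := ih (f := fdiff f) fun i hi w hw => by
      have := hf (i + 1) (by omega) w hw
      simpa only [Function.iterate_succ_apply] using this
    refine ⟨2 ^ j * |f 0| + C, by positivity, fun w hw => ?_⟩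
    have h2 := one_sub_mul_tsum (f := f) (hf 0 (by omega) w hw) (by simpa using hf 1 (by omega) w hw)
    have h3 : ‖1 - w‖ ≤ 2 := by
      calc ‖1 - w‖ ≤ ‖(1 : ℂ)‖ + ‖w‖ := norm_sub_le _ _
        _ ≤ 2 := by rw [norm_one]; linarith
    rw [pow_succ, mul_assoc, ← norm_mul, h2]
    simp only [Function.iterate_succ_apply]
    calc ‖1 - w‖ ^ j * ‖(f 0 : ℂ) + w * ∑' k, (fdiff f k : ℂ) * w ^ k‖
        ≤ ‖1 - w‖ ^ j * (|f 0| + ‖∑' k, (fdiff f k : ℂ) * w ^ k‖) := by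
          gcongr
          refine (norm_add_le _ _).trans ?_
          rw [Complex.norm_real, Real.norm_eq_abs, norm_mul]
          gcongr
          exact mul_le_of_le_one_left (norm_nonneg _) hw.le
      _ = ‖1 - w‖ ^ j * |f 0| + ‖1 - w‖ ^ j * ‖∑' k, (fdiff f k : ℂ) * w ^ k‖ := by ring
      _ ≤ 2 ^ j * |f 0| + (C + ‖∑' k, (fdiff^[j] (fdiff f) k : ℂ) * w ^ k‖) := by
          gcongr
          exact h1 w hw
      _ = _ := by ring

theorem abs_iterate_fdiff_poly_le (i : ℕ) {f : ℕ → ℝ} {C : ℝ} {N : ℕ}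
    (hf : ∀ k, |f k| ≤ C * ((k : ℝ) + 1) ^ N) :
    ∃ C' : ℝ, ∀ k, |fdiff^[i] f k| ≤ C' * ((k : ℝ) + 1) ^ N := by
  induction i generalizing f C with
  | zero => exact ⟨C, hf⟩
  | succ i ih =>
    simp only [Function.iterate_succ_apply]
    have hC : 0 ≤ C := by
      have := (abs_nonneg _).trans (hf 0)
      simpa using this
    refine ih (C := C * 2 ^ N + C) fun k => ?_
    have hk : (0 : ℝ) ≤ k := Nat.cast_nonneg k
    calc |fdiff f k| ≤ |f (k + 1)| + |f k| := abs_sub _ _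
      _ ≤ C * (((k + 1 : ℕ) : ℝ) + 1) ^ N + C * ((k : ℝ) + 1) ^ N := add_le_add (hf _) (hf _)
      _ ≤ C * (2 * ((k : ℝ) + 1)) ^ N + C * ((k : ℝ) + 1) ^ N := by
        gcongr
        push_cast; linarith
      _ = _ := by rw [mul_pow]; ring

/-! ### Polar coordinates and the invariant probability measure on the sphere -/

theorem finrank_real_Cn (n : ℕ) : Module.finrank ℝ (Cn n) = 2 * n := by
  have := finrank_real_of_complex (Cn n)
  simpa using this

theorem nontrivial_Cn {n : ℕ} (hn : 1 ≤ n) : Nontrivial (Cn n) := by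
  have : Nonempty (Fin n) := ⟨⟨0, hn⟩⟩
  infer_instance

/-- The (unnormalized) surface measure of the unit sphere, as a measure on `ℂⁿ`. -/
noncomputable def surfaceMeasure (n : ℕ) : Measure (Cn n) :=
  (volume : Measure (Cn n)).toSphere.map Subtype.val

theorem lintegral_polar {n : ℕ} (hn : 1 ≤ n) {g : Cn n → ℝ≥0∞} (hg : Measurable g) :
    ∫⁻ x, g x = ∫⁻ r in Ioi (0 : ℝ), ENNReal.ofReal (r ^ (2 * n - 1)) *
      ∫⁻ ζ, g (r • ζ) ∂(surfaceMeasure n) := by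
  have := nontrivial_Cn hn
  have hmp := (volume : Measure (Cn n)).measurePreserving_homeomorphUnitSphereProd
  have hG : Measurable fun p : Metric.sphere (0 : Cn n) 1 × Ioi (0 : ℝ) =>
      g ((p.2 : ℝ) • (p.1 : Cn n)) := by
    refine hg.comp ?_
    fun_prop
  calc ∫⁻ x, g x = ∫⁻ x in {(0 : Cn n)}ᶜ, g x := by rw [restrict_compl_singleton]
    _ = ∫⁻ x : ({(0 : Cn n)}ᶜ : Set (Cn n)), g x ∂(Measure.comap Subtype.val volume) :=
        (lintegral_subtype_comap (measurableSet_singleton _).compl g).symm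
    _ = ∫⁻ x : ({(0 : Cn n)}ᶜ : Set (Cn n)),
          (fun p : Metric.sphere (0 : Cn n) 1 × Ioi (0 : ℝ) => g ((p.2 : ℝ) • (p.1 : Cn n)))
            (homeomorphUnitSphereProd (Cn n) x) ∂(Measure.comap Subtype.val volume) := by
        refine lintegral_congr fun x => ?_
        have := homeomorphUnitSphereProd_symm_apply_coe (Cn n) (homeomorphUnitSphereProd (Cn n) x)
        rw [Homeomorph.symm_apply_apply] at this
        simp only [← this]
    _ = ∫⁻ p : Metric.sphere (0 : Cn n) 1 × Ioi (0 : ℝ), g ((p.2 : ℝ) • (p.1 : Cn n))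
          ∂((volume : Measure (Cn n)).toSphere.prod
            (Measure.volumeIoiPow (Module.finrank ℝ (Cn n) - 1))) :=
        hmp.lintegral_comp_emb (Homeomorph.measurableEmbedding _)
          (fun p : Metric.sphere (0 : Cn n) 1 × Ioi (0 : ℝ) => g ((p.2 : ℝ) • (p.1 : Cn n)))
    _ = ∫⁻ r : Ioi (0 : ℝ), ∫⁻ ζ : Metric.sphere (0 : Cn n) 1, g ((r : ℝ) • (ζ : Cn n))
          ∂(volume : Measure (Cn n)).toSphere
          ∂(Measure.volumeIoiPow (Module.finrank ℝ (Cn n) - 1)) :=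
        lintegral_prod_symm' _ hG
    _ = _ := by
        have hm : Measurable fun r : Ioi (0 : ℝ) => ∫⁻ ζ : Metric.sphere (0 : Cn n) 1,
            g ((r : ℝ) • (ζ : Cn n)) ∂(volume : Measure (Cn n)).toSphere :=
          hG.lintegral_prod_left'
        rw [Measure.volumeIoiPow, lintegral_withDensity_eq_lintegral_mul _ (by fun_prop) hm,
          finrank_real_Cn, ← lintegral_subtype_comap measurableSet_Ioi]
        refine lintegral_congr fun r => ?_
        simp only [Pi.mul_apply, surfaceMeasure]
        rw [lintegral_map (by fun_prop) measurable_subtype_coe]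

/-- The rotation invariant probability measure on the unit sphere, as a measure on `ℂⁿ`. -/
noncomputable def sphereMeasure (n : ℕ) : Measure (Cn n) :=
  (normalizedVolume n).map fun x => ‖x‖⁻¹ • x

theorem measurable_normalize (n : ℕ) : Measurable fun x : Cn n => ‖x‖⁻¹ • x := by fun_prop

theorem volume_unitBall_ne_zero (n : ℕ) : (volume : Measure (Cn n)) (unitBall n) ≠ 0 :=
  (Metric.measure_ball_pos _ _ one_pos).ne'

theorem volume_unitBall_ne_top (n : ℕ) : (volume : Measure (Cn n)) (unitBall n) ≠ ∞ :=
  measure_ball_lt_top.ne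

theorem measurableSet_unitBall (n : ℕ) : MeasurableSet (unitBall n) := measurableSet_ball

instance isProbabilityMeasure_normalizedVolume (n : ℕ) :
    IsProbabilityMeasure (normalizedVolume n) := by
  constructor
  simp only [normalizedVolume, Measure.smul_apply, Measure.restrict_apply_univ, smul_eq_mul]
  exact ENNReal.inv_mul_cancel (volume_unitBall_ne_zero n) (volume_unitBall_ne_top n)

instance isProbabilityMeasure_sphereMeasure (n : ℕ) : IsProbabilityMeasure (sphereMeasure n) :=
  Measure.isProbabilityMeasure_map (measurable_normalize n).aemeasurable

theorem ae_mem_unitBall (n : ℕ) : ∀ᵐ x ∂(normalizedVolume n), x ∈ unitBall n :=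
  Measure.ae_smul_measure (ae_restrict_mem (measurableSet_unitBall n)) _

theorem lintegral_normalizedVolume_eq {n : ℕ} (hn : 1 ≤ n) {g : Cn n → ℝ≥0∞} (hg : Measurable g) :
    ∫⁻ x, g x ∂(normalizedVolume n) = ((volume : Measure (Cn n)) (unitBall n))⁻¹ *
      ∫⁻ r in Ico (0 : ℝ) 1, ENNReal.ofReal (r ^ (2 * n - 1)) *
      ∫⁻ ζ, g (r • ζ) ∂(surfaceMeasure n) := by
  rw [normalizedVolume, lintegral_smul_measure, smul_eq_mul,
    ← lintegral_indicator (measurableSet_unitBall n),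
    lintegral_polar hn (hg.indicator (measurableSet_unitBall n))]
  congr 1
  have h1 : ∀ r ∈ Ioi (0 : ℝ), ENNReal.ofReal (r ^ (2 * n - 1)) *
      ∫⁻ ζ, (unitBall n).indicator g (r • ζ) ∂(surfaceMeasure n) =
      (Iio 1).indicator (fun r => ENNReal.ofReal (r ^ (2 * n - 1)) *
        ∫⁻ ζ, g (r • ζ) ∂(surfaceMeasure n)) r := by
    intro r hr
    have h2 : ∫⁻ ζ, (unitBall n).indicator g (r • ζ) ∂(surfaceMeasure n) =
        ∫⁻ ζ, (Iio 1).indicator (fun r : ℝ => g (r • ζ)) r ∂(surfaceMeasure n) := by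
      unfold surfaceMeasure
      have hm1 : Measurable fun ζ : Cn n => (unitBall n).indicator g (r • ζ) :=
        (hg.indicator (measurableSet_unitBall n)).comp (measurable_const_smul r)
      have hm2 : Measurable fun ζ : Cn n => (Iio 1).indicator (fun r : ℝ => g (r • ζ)) r := by
        by_cases h : r < 1 <;> simp [indicator, h]
        exact hg.comp (measurable_const_smul r)
      rw [lintegral_map hm1 measurable_subtype_coe, lintegral_map hm2 measurable_subtype_coe]
      refine lintegral_congr fun ζ => ?_
      have : r • (ζ : Cn n) ∈ unitBall n ↔ r < 1 := by
        have hζ : ‖(ζ : Cn n)‖ = 1 := by simp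
        rw [unitBall, mem_ball_zero_iff, norm_smul, hζ, mul_one, Real.norm_eq_abs,
          abs_of_pos (mem_Ioi.1 hr)]
      simp only [indicator, this, mem_Iio]
    rw [h2]
    by_cases h : r < 1 <;> simp [indicator, h]
  rw [setLIntegral_congr_fun measurableSet_Ioi h1, lintegral_indicator measurableSet_Iio,
    Measure.restrict_restrict measurableSet_Iio]
  have h3 : Iio 1 ∩ Ioi (0 : ℝ) = Ioo 0 1 := by ext; simp [and_comm]
  rw [h3]
  exact setLIntegral_congr Ioo_ae_eq_Ico

theorem lintegral_pow_Ico {m : ℕ} (hm : 1 ≤ m) :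
    ∫⁻ r in Ico (0 : ℝ) 1, ENNReal.ofReal (r ^ (m - 1)) = (m : ℝ≥0∞)⁻¹ := by
  rw [← ofReal_integral_eq_lintegral_ofReal, integral_Ico_eq_integral_Ioc,
    ← intervalIntegral.integral_of_le zero_le_one, integral_pow]
  · obtain ⟨k, rfl⟩ : ∃ k, m = k + 1 := ⟨m - 1, by omega⟩
    simp only [Nat.add_sub_cancel, one_pow, ne_eq, Nat.add_eq_zero_iff, one_ne_zero, and_false,
      not_false_eq_true, zero_pow, sub_zero]
    rw [one_div, ENNReal.ofReal_inv_of_pos (by positivity)]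
    congr 1
    rw [← ENNReal.ofReal_natCast]; push_cast; rfl
  · exact (Continuous.integrableOn_Icc (by fun_prop)).mono_set Ico_subset_Icc_self
  · filter_upwards [ae_restrict_mem measurableSet_Ico] with r hr
    exact pow_nonneg hr.1 _

theorem lintegral_surfaceMeasure_congr {n : ℕ} {f g : Cn n → ℝ≥0∞} (hf : Measurable f)
    (hg : Measurable g) (h : ∀ ζ, ‖ζ‖ = 1 → f ζ = g ζ) :
    ∫⁻ ζ, f ζ ∂(surfaceMeasure n) = ∫⁻ ζ, g ζ ∂(surfaceMeasure n) := by
  unfold surfaceMeasure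
  rw [lintegral_map hf measurable_subtype_coe, lintegral_map hg measurable_subtype_coe]
  exact lintegral_congr fun ζ => h _ (by simp)

/-- Projecting the ball radially onto the sphere integrates out the Jacobian, and ∫ r^(2n-1) dr =
1/(2n) over [0, 1) accounts for the constant. -/
theorem lintegral_sphereMeasure_eq {n : ℕ} (hn : 1 ≤ n) {g : Cn n → ℝ≥0∞} (hg : Measurable g) :
    ∫⁻ ζ, g ζ ∂(sphereMeasure n) = ((volume : Measure (Cn n)) (unitBall n))⁻¹ *
      ((2 * n : ℕ) : ℝ≥0∞)⁻¹ * ∫⁻ ζ, g ζ ∂(surfaceMeasure n) := by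
  unfold sphereMeasure
  rw [lintegral_map hg (measurable_normalize n),
    lintegral_normalizedVolume_eq hn (g := fun x => g (‖x‖⁻¹ • x))
      (hg.comp (measurable_normalize n)), mul_assoc]
  congr 1
  rw [← lintegral_pow_Ico (m := 2 * n) (by omega), ← lintegral_mul_const _ (by fun_prop)]
  -- The radius 0, where the radial projection is degenerate, is discarded.
  rw [setLIntegral_congr (Ioo_ae_eq_Ico (a := (0 : ℝ)) (b := 1)).symm,
    setLIntegral_congr (Ioo_ae_eq_Ico (a := (0 : ℝ)) (b := 1)).symm]
  refine setLIntegral_congr_fun measurableSet_Ioo fun r hr => ?_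
  congr 1
  refine lintegral_surfaceMeasure_congr
    ((hg.comp (measurable_normalize n)).comp (measurable_const_smul r)) hg fun ζ hζ => ?_
  congr 1
  rw [norm_smul, hζ, mul_one, Real.norm_eq_abs, abs_of_pos hr.1, smul_smul,
    inv_mul_cancel₀ hr.1.ne', one_smul]

/-- Integration in polar coordinates for the normalized volume of the ball. -/
theorem lintegral_normalizedVolume {n : ℕ} (hn : 1 ≤ n) {g : Cn n → ℝ≥0∞} (hg : Measurable g) :
    ∫⁻ x, g x ∂(normalizedVolume n) = ((2 * n : ℕ) : ℝ≥0∞) *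
      ∫⁻ r in Ico (0 : ℝ) 1, ENNReal.ofReal (r ^ (2 * n - 1)) *
      ∫⁻ ζ, g (r • ζ) ∂(sphereMeasure n) := by
  have h2n : ((2 * n : ℕ) : ℝ≥0∞) ≠ 0 := by
    rw [Ne, Nat.cast_eq_zero]; omega
  have h2n' : ((2 * n : ℕ) : ℝ≥0∞) ≠ ∞ := ENNReal.natCast_ne_top _
  have hv : ((volume : Measure (Cn n)) (unitBall n))⁻¹ ≠ ∞ :=
    ENNReal.inv_ne_top.2 (volume_unitBall_ne_zero n)
  rw [lintegral_normalizedVolume_eq hn hg, ← lintegral_const_mul' _ _ hv,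
    ← lintegral_const_mul' _ _ h2n']
  refine lintegral_congr fun r => ?_
  rw [lintegral_sphereMeasure_eq hn (g := fun ζ => g (r • ζ))
    (hg.comp (measurable_const_smul r))]
  calc _ = (((2 * n : ℕ) : ℝ≥0∞) * ((2 * n : ℕ) : ℝ≥0∞)⁻¹) * (((volume : Measure (Cn n)) (unitBall n))⁻¹
        * (ENNReal.ofReal (r ^ (2 * n - 1)) * ∫⁻ ζ, g (r • ζ) ∂(surfaceMeasure n))) := by
        rw [ENNReal.mul_inv_cancel h2n h2n', one_mul]
    _ = _ := by ring

/-! ### Unitary invariance of the measures and transitivity on the sphere -/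

theorem measurePreserving_isometry_volume {n : ℕ} (U : Cn n ≃ₗᵢ[ℂ] Cn n) :
    MeasurePreserving U (volume : Measure (Cn n)) volume := by
  let V : Cn n ≃ₗᵢ[ℝ] Cn n := { U.toLinearEquiv.restrictScalars ℝ with norm_map' := U.norm_map }
  exact V.measurePreserving

theorem measurePreserving_isometry {n : ℕ} (U : Cn n ≃ₗᵢ[ℂ] Cn n) :
    MeasurePreserving U (normalizedVolume n) (normalizedVolume n) := by
  have h1 := (measurePreserving_isometry_volume U).restrict_preimage (measurableSet_unitBall n)
  have h2 : U ⁻¹' (unitBall n) = unitBall n := by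
    ext x; simp [unitBall]
  rw [h2] at h1
  exact h1.smul_measure _

theorem lintegral_sphereMeasure_isometry {n : ℕ} (U : Cn n ≃ₗᵢ[ℂ] Cn n) {g : Cn n → ℝ≥0∞}
    (hg : Measurable g) : ∫⁻ ζ, g (U ζ) ∂(sphereMeasure n) = ∫⁻ ζ, g ζ ∂(sphereMeasure n) := by
  have hU : Measurable U := U.continuous.measurable
  unfold sphereMeasure
  rw [lintegral_map (f := fun ζ => g (U ζ)) (hg.comp hU) (measurable_normalize n), lintegral_map hg (measurable_normalize n)]
  rw [← (measurePreserving_isometry U).lintegral_comp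
    (f := fun x => g (‖x‖⁻¹ • x)) (hg.comp (measurable_normalize n))]
  refine lintegral_congr fun x => ?_
  have : U (‖x‖⁻¹ • x) = ‖x‖⁻¹ • U x := by
    rw [RCLike.real_smul_eq_coe_smul (K := ℂ), map_smul, ← RCLike.real_smul_eq_coe_smul (K := ℂ)]
  simp only [this, U.norm_map]

theorem ae_norm_eq_one {n : ℕ} (hn : 1 ≤ n) : ∀ᵐ ζ ∂(sphereMeasure n), ‖ζ‖ = 1 := by
  have := nontrivial_Cn hn
  unfold sphereMeasure
  rw [ae_map_iff (measurable_normalize n).aemeasurable (measurableSet_eq_fun (by fun_prop) (by fun_prop))]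
  have h0 : ∀ᵐ x ∂(normalizedVolume n), x ≠ 0 := by
    refine Measure.ae_smul_measure (ae_restrict_of_ae ?_) _
    rw [ae_iff]
    simp
  filter_upwards [h0] with x hx
  rw [norm_smul, norm_inv, norm_norm, inv_mul_cancel₀ (norm_ne_zero_iff.2 hx)]

/-- The first basis vector of `ℂⁿ`. -/
noncomputable def baseVec {n : ℕ} (hn : 1 ≤ n) : Cn n := EuclideanSpace.single ⟨0, hn⟩ 1

theorem norm_baseVec {n : ℕ} (hn : 1 ≤ n) : ‖baseVec hn‖ = 1 := by simp [baseVec]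

theorem inner_baseVec {n : ℕ} (hn : 1 ≤ n) (x : Cn n) : inner ℂ (baseVec hn) x = x ⟨0, hn⟩ := by
  simp [baseVec, EuclideanSpace.inner_single_left]

/-- Completing e to an orthonormal basis gives the unitary map; integrals of functions of ⟨ζ, e⟩
over the sphere therefore do not depend on e. -/
theorem exists_isometry_map_baseVec {n : ℕ} (hn : 1 ≤ n) {e : Cn n} (he : ‖e‖ = 1) :
    ∃ U : Cn n ≃ₗᵢ[ℂ] Cn n, U (baseVec hn) = e := by
  have hv : Orthonormal ℂ (({⟨0, hn⟩} : Set (Fin n)).domRestrict (fun _ : Fin n => e)) := by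
    constructor
    · intro i; simpa using he
    · intro i j hij
      exact absurd (Subsingleton.elim i j) hij
  obtain ⟨b, hb⟩ := hv.exists_orthonormalBasis_extension_of_card_eq (by simp)
  refine ⟨b.repr.symm, ?_⟩
  rw [baseVec, b.repr_symm_single]
  exact hb _ (mem_singleton _)

theorem lintegral_sphereMeasure_inner {n : ℕ} (hn : 1 ≤ n) {e : Cn n} (he : ‖e‖ = 1)
    {g : ℂ → ℝ≥0∞} (hg : Measurable g) :
    ∫⁻ ζ, g (inner ℂ e ζ) ∂(sphereMeasure n) =
      ∫⁻ ζ, g (inner ℂ (baseVec hn) ζ) ∂(sphereMeasure n) := by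
  obtain ⟨U, hU⟩ := exists_isometry_map_baseVec hn he
  have hm : Measurable fun ζ : Cn n => g (inner ℂ e ζ) :=
    hg.comp (by fun_prop)
  rw [← lintegral_sphereMeasure_isometry U hm]
  refine lintegral_congr fun ζ => ?_
  rw [← hU, U.inner_map_map]

/-! ### Gaussian integrals, which yield the norms of powers of a coordinate -/

theorem integral_complex_gaussian (k : ℕ) :
    ∫ u : ℂ, ‖u‖ ^ (2 * k) * Real.exp (-‖u‖ ^ 2) = Real.pi * k.factorial := by
  have h := Complex.integral_rpow_mul_exp_neg_rpow (p := 2) (q := (2 * k : ℕ)) (by norm_num)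
    (lt_of_lt_of_le (by norm_num) (Nat.cast_nonneg _))
  have h2 : (((2 * k : ℕ) : ℝ) + 2) / 2 = k + 1 := by push_cast; ring
  rw [h2, Real.Gamma_nat_eq_factorial] at h
  have h3 : ∀ u : ℂ, ‖u‖ ^ (((2 * k : ℕ)) : ℝ) * Real.exp (-‖u‖ ^ (2 : ℝ)) =
      ‖u‖ ^ (2 * k) * Real.exp (-‖u‖ ^ 2) := fun u => by
    rw [Real.rpow_natCast, ← Real.rpow_natCast ‖u‖ 2]; norm_num
  simp_rw [h3] at h
  rw [h]; ring

theorem lintegral_gaussian {n : ℕ} (hn : 1 ≤ n) : ∃ c : ℝ≥0∞, ∀ k : ℕ,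
    ∫⁻ x : Cn n, ENNReal.ofReal (‖x ⟨0, hn⟩‖ ^ (2 * k) * Real.exp (-‖x‖ ^ 2)) =
      c * ENNReal.ofReal k.factorial := by
  set L := (EuclideanSpace.equiv (Fin n) ℂ).symm
  have := L.isAddHaarMeasure_map (volume : Measure (Fin n → ℂ))
  -- Only uniqueness of Haar measure up to a scalar is used: the scalar goes into c, which does not
  -- depend on k and cancels later.
  have hv := Measure.isAddLeftInvariant_eq_smul (volume : Measure (Cn n))
    ((volume : Measure (Fin n → ℂ)).map L)
  set s := Measure.addHaarScalarFactor (volume : Measure (Cn n))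
    ((volume : Measure (Fin n → ℂ)).map L)
  refine ⟨s * ENNReal.ofReal (Real.pi ^ n), fun k => ?_⟩
  set d : Fin n → ℕ := fun i => if i = ⟨0, hn⟩ then k else 0 with hd
  set f : Fin n → ℂ → ℝ := fun i u => ‖u‖ ^ (2 * d i) * Real.exp (-‖u‖ ^ 2) with hf
  have hfi : ∀ i, ∫ u, f i u = Real.pi * (d i).factorial := fun i => integral_complex_gaussian _
  have hfint : ∀ i, Integrable (f i) := fun i => by
    -- A function with nonzero Bochner integral is integrable, because the integral of a
    -- nonintegrable function is 0 by convention.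
    refine not_imp_comm.1 integral_undef ?_
    rw [hfi]
    have := Real.pi_pos
    positivity
  have hprod : ∫ y : Fin n → ℂ, ∏ i, f i (y i) = Real.pi ^ n * k.factorial := by
    rw [integral_fintype_prod_volume_eq_prod]
    simp_rw [hfi]
    rw [Finset.prod_mul_distrib]
    congr 1
    · simp
    · rw [Finset.prod_eq_single (⟨0, hn⟩ : Fin n)]
      · simp [hd]
      · intro i _ hi; simp [hd, hi]
      · simp
  have hpt : ∀ y : Fin n → ℂ, ∏ i, f i (y i) =
      ‖(L y) ⟨0, hn⟩‖ ^ (2 * k) * Real.exp (-‖L y‖ ^ 2) := by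
    intro y
    rw [hf]
    simp only
    rw [Finset.prod_mul_distrib, ← Real.exp_sum]
    congr 1
    · rw [Finset.prod_eq_single (⟨0, hn⟩ : Fin n)]
      · simp [hd, L]
      · intro i _ hi; simp [hd, hi]
      · simp
    · rw [EuclideanSpace.norm_sq_eq, Finset.sum_neg_distrib]
      rfl
  have hmeas : Measurable fun x : Cn n =>
      ENNReal.ofReal (‖x ⟨0, hn⟩‖ ^ (2 * k) * Real.exp (-‖x‖ ^ 2)) := by fun_prop
  conv_lhs => rw [hv]
  rw [lintegral_smul_measure, lintegral_map hmeas L.continuous.measurable]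
  simp_rw [← hpt]
  rw [← ofReal_integral_eq_lintegral_ofReal]
  · rw [hprod, ENNReal.ofReal_mul (by positivity), mul_assoc]
    rfl
  · exact Integrable.fintype_prod hfint
  · refine Filter.Eventually.of_forall fun y => ?_
    change 0 ≤ ∏ i, f i (y i)
    rw [hpt]
    exact mul_nonneg (by positivity) (Real.exp_pos _).le

theorem lintegral_radial_gaussian (m : ℕ) :
    ∫⁻ r in Ioi (0 : ℝ), ENNReal.ofReal (r ^ (2 * m + 1) * Real.exp (-r ^ 2)) =
      ENNReal.ofReal (m.factorial / 2) := by
  have h := integral_rpow_mul_exp_neg_rpow (p := 2) (q := (2 * m + 1 : ℕ)) (by norm_num)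
    (lt_of_lt_of_le (by norm_num) (Nat.cast_nonneg _))
  have h2 : (((2 * m + 1 : ℕ) : ℝ) + 1) / 2 = m + 1 := by push_cast; ring
  rw [h2, Real.Gamma_nat_eq_factorial] at h
  have h3 : ∀ u : ℝ, u ^ (((2 * m + 1 : ℕ)) : ℝ) * Real.exp (-u ^ (2 : ℝ)) =
      u ^ (2 * m + 1) * Real.exp (-u ^ 2) := fun u => by
    rw [Real.rpow_natCast, ← Real.rpow_natCast u 2]; norm_num
  simp_rw [h3] at h
  rw [← ofReal_integral_eq_lintegral_ofReal, h]
  · congr 1; ring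
  · refine not_imp_comm.1 integral_undef ?_
    rw [h]
    positivity
  · filter_upwards [ae_restrict_mem measurableSet_Ioi] with r hr
    have := mem_Ioi.1 hr
    positivity

/-- The monomial norms on the sphere. -/
theorem lintegral_sphereMeasure_pow {n : ℕ} (hn : 1 ≤ n) {e : Cn n} (he : ‖e‖ = 1) (k : ℕ) :
    ∫⁻ ζ, ‖inner ℂ e ζ‖ₑ ^ (2 * k) ∂(sphereMeasure n) =
      ((k + (n - 1)).choose (n - 1) : ℝ≥0∞)⁻¹ := by
  rw [lintegral_sphereMeasure_inner hn he (g := fun u => ‖u‖ₑ ^ (2 * k)) (by fun_prop)]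
  simp_rw [inner_baseVec hn]
  obtain ⟨c, hc⟩ := lintegral_gaussian hn
  set T : ℕ → ℝ≥0∞ := fun k => ∫⁻ ζ : Cn n, ‖ζ ⟨0, hn⟩‖ₑ ^ (2 * k) ∂(surfaceMeasure n) with hT
  -- The same Gaussian integral in polar coordinates is a radial Gamma integral times `T k`. This
  -- determines `T k` up to a factor independent of k, and k = 0 fixes that factor because the
  -- sphere has mass 1.
  have hpolar : ∀ k : ℕ, c * ENNReal.ofReal k.factorial =
      ENNReal.ofReal ((k + (n - 1)).factorial / 2) * T k := by
    intro k
    rw [← hc k, lintegral_polar hn (by fun_prop), ← lintegral_radial_gaussian,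
      ← lintegral_mul_const _ (by fun_prop)]
    refine setLIntegral_congr_fun measurableSet_Ioi fun r hr => ?_
    have hr : 0 < r := hr
    simp only
    rw [show 2 * (k + (n - 1)) + 1 = (2 * n - 1) + 2 * k by omega, pow_add, mul_assoc,
      ENNReal.ofReal_mul (by positivity), mul_assoc]
    congr 1
    rw [hT]
    simp only
    rw [← lintegral_const_mul' _ _ ENNReal.ofReal_ne_top]
    refine lintegral_surfaceMeasure_congr (by fun_prop) (by fun_prop) fun ζ hζ => ?_
    rw [norm_smul, hζ, mul_one, Real.norm_eq_abs, abs_of_pos hr, PiLp.smul_apply, norm_smul,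
      mul_pow, Real.norm_eq_abs, abs_of_pos hr, mul_assoc, mul_comm (‖ζ ⟨0, hn⟩‖ ^ (2 * k)),
      ← mul_assoc, ENNReal.ofReal_mul (by positivity)]
    congr 1
    rw [ENNReal.ofReal_pow (norm_nonneg _), ofReal_norm]
  set d := ((volume : Measure (Cn n)) (unitBall n))⁻¹ * ((2 * n : ℕ) : ℝ≥0∞)⁻¹
  have hS : ∀ k : ℕ, ∫⁻ ζ : Cn n, ‖ζ ⟨0, hn⟩‖ₑ ^ (2 * k) ∂(sphereMeasure n) = d * T k := fun k =>
    lintegral_sphereMeasure_eq hn (by fun_prop)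
  have hS0 : d * T 0 = 1 := by
    rw [← hS 0]; simp
  have h0 : d * c = ENNReal.ofReal ((n - 1).factorial / 2) := by
    have := hpolar 0
    simp only [Nat.factorial_zero, Nat.cast_one, ENNReal.ofReal_one, mul_one, zero_add] at this
    rw [this, mul_left_comm, hS0, mul_one]
  have hk : ENNReal.ofReal ((n - 1).factorial / 2) * ENNReal.ofReal k.factorial =
      ENNReal.ofReal ((k + (n - 1)).factorial / 2) * (d * T k) := by
    rw [← h0, mul_assoc, hpolar k]; ring
  rw [hS]
  have hpos : (0 : ℝ) < (k + (n - 1)).factorial / 2 := by positivity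
  have hch : ((k + (n - 1)).choose (n - 1) : ℝ) * (n - 1).factorial * k.factorial =
      (k + (n - 1)).factorial := by
    have := Nat.choose_mul_factorial_mul_factorial (show n - 1 ≤ k + (n - 1) by omega)
    simp only [Nat.add_sub_cancel] at this
    exact_mod_cast this
  have hcp : (0 : ℝ) < ((k + (n - 1)).choose (n - 1) : ℝ) := by
    exact_mod_cast Nat.choose_pos (by omega)
  rw [← ENNReal.ofReal_mul (by positivity)] at hk
  have h5 : d * T k = ENNReal.ofReal ((((n - 1).factorial : ℝ) / 2 * k.factorial) /
      ((k + (n - 1)).factorial / 2)) := by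
    rw [ENNReal.ofReal_div_of_pos hpos, ENNReal.eq_div_iff (ENNReal.ofReal_pos.2 hpos).ne'
      ENNReal.ofReal_ne_top, hk]
  rw [h5, ← ENNReal.ofReal_natCast, ← ENNReal.ofReal_inv_of_pos hcp]
  congr 1
  rw [← hch]
  field_simp

/-! ### Rotations about a complex line and averaging -/

/-- The linear map acting as `a` on the line spanned by the unit vector `e` and as `c` on its
orthogonal complement. -/
noncomputable def twist {n : ℕ} (e : Cn n) (a c : ℂ) (w : Cn n) : Cn n :=
  c • w + ((a - c) * inner ℂ e w) • e

theorem inner_twist {n : ℕ} {e : Cn n} (he : ‖e‖ = 1) (a c : ℂ) (w : Cn n) :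
    inner ℂ e (twist e a c w) = a * inner ℂ e w := by
  have : inner ℂ e e = (1 : ℂ) := by rw [inner_self_eq_norm_sq_to_K, he]; simp
  rw [twist, inner_add_right, inner_smul_right, inner_smul_right, this]
  ring

theorem norm_sq_twist {n : ℕ} {e : Cn n} (he : ‖e‖ = 1) (a c : ℂ) (w : Cn n) :
    ‖twist e a c w‖ ^ 2 = ‖a‖ ^ 2 * ‖inner ℂ e w‖ ^ 2 +
      ‖c‖ ^ 2 * ‖w - (inner ℂ e w : ℂ) • e‖ ^ 2 := by
  have h1 : inner ℂ e e = (1 : ℂ) := by rw [inner_self_eq_norm_sq_to_K, he]; simp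
  have h2 : inner ℂ e (w - (inner ℂ e w : ℂ) • e) = 0 := by
    rw [inner_sub_right, inner_smul_right, h1, mul_one, sub_self]
  have h3 : twist e a c w = (a * inner ℂ e w) • e + c • (w - (inner ℂ e w : ℂ) • e) := by
    rw [twist, smul_sub, smul_smul, sub_mul, sub_smul]; abel
  have h4 : inner ℂ ((a * inner ℂ e w) • e) (c • (w - (inner ℂ e w : ℂ) • e)) = 0 := by
    rw [inner_smul_left, inner_smul_right, h2, mul_zero, mul_zero]
  have h5 := norm_add_sq_eq_norm_sq_add_norm_sq_of_inner_eq_zero _ _ h4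
  rw [h3]
  rw [pow_two, h5, norm_smul, norm_smul, norm_mul, he]
  ring

theorem norm_twist_le {n : ℕ} {e : Cn n} (he : ‖e‖ = 1) {a c : ℂ} (ha : ‖a‖ ≤ 1) (hc : ‖c‖ ≤ 1)
    (w : Cn n) : ‖twist e a c w‖ ≤ ‖w‖ := by
  have h1 := norm_sq_twist he a c w
  have h2 := norm_sq_twist he 1 1 w
  have h3 : twist e 1 1 w = w := by simp [twist]
  rw [h3, norm_one] at h2
  refine le_of_sq_le_sq ?_ (norm_nonneg _)
  rw [h1, h2]
  gcongr

theorem norm_twist {n : ℕ} {e : Cn n} (he : ‖e‖ = 1) {a c : ℂ} (ha : ‖a‖ = 1) (hc : ‖c‖ = 1)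
    (w : Cn n) : ‖twist e a c w‖ = ‖w‖ := by
  have h1 := norm_sq_twist he a c w
  have h2 := norm_sq_twist he 1 1 w
  have h3 : twist e 1 1 w = w := by simp [twist]
  rw [h3, norm_one] at h2
  rw [ha, hc, ← h2] at h1
  exact (sq_eq_sq₀ (norm_nonneg _) (norm_nonneg _)).1 h1

theorem exists_isometry_eq_twist {n : ℕ} {e : Cn n} (he : ‖e‖ = 1) {a c : ℂ} (ha : ‖a‖ = 1)
    (hc : ‖c‖ = 1) : ∃ U : Cn n ≃ₗᵢ[ℂ] Cn n, ∀ w, U w = twist e a c w := by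
  let L : Cn n →ₗ[ℂ] Cn n :=
    { toFun := twist e a c
      map_add' := fun x y => by
        simp only [twist, inner_add_right, smul_add, mul_add, add_smul]; abel
      map_smul' := fun x y => by
        simp only [twist, inner_smul_right, smul_add, smul_smul, RingHom.id_apply]
        congr 2 <;> ring }
  let I : Cn n →ₗᵢ[ℂ] Cn n := { L with norm_map' := fun w => norm_twist he ha hc w }
  exact ⟨I.toLinearIsometryEquiv rfl, fun w => rfl⟩

theorem twist_one_zero {n : ℕ} (e w : Cn n) : twist e 1 0 w = (inner ℂ e w : ℂ) • e := by
  simp [twist]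

theorem lintegral_average {n : ℕ} {μ : Measure (Cn n)} [SFinite μ] {T : ℝ → Cn n → Cn n}
    (hT : Measurable (Function.uncurry T)) (hmp : ∀ θ, MeasurePreserving (T θ) μ μ)
    {g : Cn n → ℝ≥0∞} (hg : Measurable g) :
    ENNReal.ofReal (2 * Real.pi) * ∫⁻ x, g x ∂μ =
      ∫⁻ x, (∫⁻ θ in Ioc 0 (2 * Real.pi), g (T θ x)) ∂μ := by
  rw [lintegral_lintegral_swap]
  · simp_rw [(hmp _).lintegral_comp hg]
    rw [lintegral_const, Measure.restrict_apply_univ, Real.volume_Ioc, sub_zero, mul_comm]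
  · exact (hg.comp (hT.comp measurable_swap)).aemeasurable

theorem integral_average {n : ℕ} {μ : Measure (Cn n)} [SFinite μ] {T : ℝ → Cn n → Cn n}
    (hT : Measurable (Function.uncurry T)) (hmp : ∀ θ, MeasurePreserving (T θ) μ μ)
    {g : Cn n → ℂ} (hg : Measurable g) (hgi : Integrable g μ) :
    Integrable (fun x => (2 * Real.pi)⁻¹ • ∫ θ in (0 : ℝ)..(2 * Real.pi), g (T θ x)) μ ∧
    ∫ x, (2 * Real.pi)⁻¹ • (∫ θ in (0 : ℝ)..(2 * Real.pi), g (T θ x)) ∂μ = ∫ x, g x ∂μ := by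
  have h2pi : (0 : ℝ) < 2 * Real.pi := by positivity
  have hint : Integrable (fun p : ℝ × Cn n => g (T p.1 p.2))
      ((volume.restrict (Ioc 0 (2 * Real.pi))).prod μ) := by
    have hgT : Measurable fun p : ℝ × Cn n => g (T p.1 p.2) := hg.comp hT
    rw [integrable_prod_iff hgT.aestronglyMeasurable]
    refine ⟨Filter.Eventually.of_forall fun θ => ((hmp θ).integrable_comp hg.aestronglyMeasurable).2 hgi,
      ?_⟩
    have : ∀ θ, ∫ x, ‖g (T θ x)‖ ∂μ = ∫ x, ‖g x‖ ∂μ := fun θ => by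
      have := integral_map (μ := μ) (hmp θ).measurable.aemeasurable
        (f := fun x => ‖g x‖) hg.norm.aestronglyMeasurable
      rw [(hmp θ).map_eq] at this
      exact this.symm
    simp_rw [this]
    exact integrable_const _
  have e : ∀ x, (∫ θ in (0 : ℝ)..(2 * Real.pi), g (T θ x)) =
      ∫ θ in Ioc 0 (2 * Real.pi), g (T θ x) := fun x =>
    intervalIntegral.integral_of_le h2pi.le
  simp_rw [e]
  refine ⟨Integrable.smul (2 * Real.pi)⁻¹ hint.integral_prod_right, ?_⟩
  rw [integral_smul, ← integral_integral_swap (f := fun θ x => g (T θ x)) hint]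
  have : ∀ θ, ∫ x, g (T θ x) ∂μ = ∫ x, g x ∂μ := fun θ => by
    have := integral_map (μ := μ) (hmp θ).measurable.aemeasurable
      (f := g) hg.aestronglyMeasurable
    rw [(hmp θ).map_eq] at this
    exact this.symm
  simp_rw [this]
  rw [integral_const, measureReal_restrict_apply_univ, Real.volume_real_Ioc_of_le h2pi.le, sub_zero,
    smul_smul, inv_mul_cancel₀ h2pi.ne', one_smul]

/-! ### Orthogonality on circles -/

theorem circleAverage_pow (m : ℕ) :
    Real.circleAverage (fun c : ℂ => c ^ m) 0 1 = if m = 0 then 1 else 0 := by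
  have : DiffContOnCl ℂ (fun c : ℂ => c ^ m) (Metric.ball 0 |1|) :=
    (by fun_prop : Differentiable ℂ fun c : ℂ => c ^ m).diffContOnCl
  rw [this.circleAverage]
  by_cases h : m = 0 <;> simp [h]

/-- On the unit circle c · conj c = 1, so the product collapses to a power |j-k| of c or of its
conjugate, and the mean value property applies. -/
theorem circleAverage_pow_mul_conj_pow (j k : ℕ) :
    Real.circleAverage (fun c : ℂ => c ^ j * conj c ^ k) 0 1 = if j = k then 1 else 0 := by
  have hc : ∀ c ∈ Metric.sphere (0 : ℂ) |1|, c * conj c = 1 := fun c hc => by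
    rw [Complex.mul_conj, Complex.normSq_eq_norm_sq]
    have : ‖c‖ = 1 := by simpa using hc
    simp [this]
  rcases le_total k j with h | h
  · obtain ⟨m, rfl⟩ := Nat.exists_eq_add_of_le h
    have : Real.circleAverage (fun c : ℂ => c ^ (k + m) * conj c ^ k) 0 1 =
        Real.circleAverage (fun c : ℂ => c ^ m) 0 1 := by
      refine Real.circleAverage_congr_sphere fun c hc' => ?_
      rw [pow_add, mul_right_comm, ← mul_pow, hc c hc', one_pow, one_mul]
    rw [this, circleAverage_pow]
    simp
  · obtain ⟨m, rfl⟩ := Nat.exists_eq_add_of_le h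
    have : Real.circleAverage (fun c : ℂ => c ^ j * conj c ^ (j + m)) 0 1 =
        Real.circleAverage (fun c : ℂ => conj (c ^ m)) 0 1 := by
      refine Real.circleAverage_congr_sphere fun c hc' => ?_
      rw [pow_add, ← mul_assoc, ← mul_pow, hc c hc', one_pow, one_mul, map_pow]
    rw [this]
    have h2 : Real.circleAverage (fun c : ℂ => conj (c ^ m)) 0 1 =
        conj (Real.circleAverage (fun c : ℂ => c ^ m) 0 1) := by
      rw [Real.circleAverage_def, Real.circleAverage_def, Complex.real_smul, Complex.real_smul,
        map_mul, Complex.conj_ofReal, intervalIntegral.integral_of_le (by positivity),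
        intervalIntegral.integral_of_le (by positivity), integral_conj]
    rw [h2, circleAverage_pow]
    by_cases hm : m = 0 <;> simp [hm]

/-- Extraction of a Taylor coefficient by averaging over a circle. -/
theorem circleAverage_mul_conj_pow {φ : ℂ → ℂ} (hφ : DifferentiableOn ℂ φ (Metric.ball 0 1))
    {u : ℂ} (hu : ‖u‖ < 1) (k : ℕ) :
    Real.circleAverage (fun c : ℂ => φ (c * u) * conj (c * u) ^ k) 0 1 =
      ((k.factorial : ℂ)⁻¹ * iteratedDeriv k φ 0) * ((‖u‖ ^ (2 * k) : ℝ) : ℂ) := by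
  set a : ℕ → ℂ := fun j => (j.factorial : ℂ)⁻¹ * iteratedDeriv j φ 0
  have hs : ∀ v : ℂ, ‖v‖ < 1 → HasSum (fun j => a j * v ^ j) (φ v) := fun v hv => by
    have := Complex.hasSum_taylorSeries_on_ball hφ (z := v) (by simpa using hv)
    refine (this.congr_fun ?_)
    intro j
    simp only [sub_zero, smul_eq_mul, a]
    ring
  have hsum : Summable fun j => ‖a j * u ^ j‖ := (hs u hu).summable.norm
  have hnc : ∀ θ, ‖circleMap 0 1 θ‖ = 1 := fun θ => by simp
  set F : ℕ → ℝ → ℂ := fun j θ =>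
    a j * (circleMap 0 1 θ * u) ^ j * conj (circleMap 0 1 θ * u) ^ k with hF
  have hFc : ∀ j, Continuous (F j) := fun j => by
    have : Continuous (circleMap (0 : ℂ) 1) := continuous_circleMap 0 1
    have h2 : Continuous fun θ => conj (circleMap (0 : ℂ) 1 θ * u) :=
      Complex.continuous_conj.comp (by fun_prop)
    fun_prop
  have hFn : ∀ j θ, ‖F j θ‖ ≤ ‖a j * u ^ j‖ := fun j θ => by
    simp only [hF, norm_mul, norm_pow, RCLike.norm_conj, hnc, one_mul]
    exact mul_le_of_le_one_right (by positivity) (pow_le_one₀ (norm_nonneg _) hu.le)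
  -- The Taylor series converges absolutely at u, and rotation does not change the moduli of its
  -- terms, so it may be integrated termwise.
  have hmain := hasSum_integral_of_summable_integral_norm
    (μ := volume.restrict (Ioc 0 (2 * Real.pi))) (F := F)
    (fun j => (hFc j).integrableOn_Ioc) (by
      refine (hsum.mul_left (2 * Real.pi)).of_nonneg_of_le
        (fun j => integral_nonneg fun θ => norm_nonneg _) fun j => ?_
      calc ∫ θ in Ioc 0 (2 * Real.pi), ‖F j θ‖ ≤ ∫ θ in Ioc 0 (2 * Real.pi), ‖a j * u ^ j‖ := by
            refine integral_mono (hFc j).norm.integrableOn_Ioc (integrable_const _) (hFn j)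
        _ = _ := by
            rw [integral_const, measureReal_restrict_apply_univ,
              Real.volume_real_Ioc_of_le (by positivity), sub_zero, smul_eq_mul])
  have hlim : ∀ θ, ∑' j, F j θ = φ (circleMap 0 1 θ * u) * conj (circleMap 0 1 θ * u) ^ k := by
    intro θ
    have h1 : ‖circleMap 0 1 θ * u‖ < 1 := by rw [norm_mul, hnc, one_mul]; exact hu
    exact ((hs _ h1).mul_right _).tsum_eq
  simp_rw [hlim] at hmain
  have hint : ∀ j, ∫ θ in Ioc 0 (2 * Real.pi), F j θ =
      if j = k then (2 * Real.pi : ℝ) * (a k * ((‖u‖ ^ (2 * k) : ℝ) : ℂ)) else 0 := by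
    intro j
    have h1 := circleAverage_pow_mul_conj_pow j k
    rw [Real.circleAverage_def, Complex.real_smul, intervalIntegral.integral_of_le (by positivity)] at h1
    have h2 : ∫ θ in Ioc 0 (2 * Real.pi), F j θ = (a j * u ^ j * conj u ^ k) *
        ∫ θ in Ioc 0 (2 * Real.pi), circleMap 0 1 θ ^ j * conj (circleMap 0 1 θ) ^ k := by
      rw [← integral_const_mul]
      congr 1; ext θ
      simp only [hF, map_mul, mul_pow]
      ring
    have hpi : ((2 * Real.pi : ℝ) : ℂ) ≠ 0 := by
      exact_mod_cast (by positivity : (2 * Real.pi : ℝ) ≠ 0)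
    have h3 : ∫ θ in Ioc 0 (2 * Real.pi), circleMap 0 1 θ ^ j * conj (circleMap 0 1 θ) ^ k =
        ((2 * Real.pi : ℝ) : ℂ) * if j = k then 1 else 0 := by
      rw [← h1]
      push_cast at hpi ⊢
      field_simp
    rw [h2, h3]
    by_cases hjk : j = k
    · subst hjk
      simp only [if_true, mul_one]
      have : u ^ j * conj u ^ j = ((‖u‖ ^ (2 * j) : ℝ) : ℂ) := by
        rw [← mul_pow, Complex.mul_conj, Complex.normSq_eq_norm_sq, pow_mul]
        push_cast; rfl
      rw [mul_assoc (a j), this]; ring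
    · simp [hjk]
  have hval := hmain.unique ((hasSum_single k (fun j hj => by rw [hint, if_neg hj])))
  rw [hint, if_pos rfl] at hval
  rw [Real.circleAverage_def, intervalIntegral.integral_of_le (by positivity), hval,
    Complex.real_smul, ← mul_assoc, ← Complex.ofReal_mul, inv_mul_cancel₀ (by positivity),
    Complex.ofReal_one, one_mul]

/-! ### The measures `ω dV` -/

theorem lintegral_weightedVolume {n : ℕ} (hn : 1 ≤ n) {ω : ℝ → ℝ} (hm : Measurable ω)
    {g : Cn n → ℝ≥0∞} (hg : Measurable g) :
    ∫⁻ x, g x ∂(weightedVolume n ω) = ((2 * n : ℕ) : ℝ≥0∞) *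
      ∫⁻ r in Ico (0 : ℝ) 1, ENNReal.ofReal (r ^ (2 * n - 1) * ω r) *
      ∫⁻ ζ, g (r • ζ) ∂(sphereMeasure n) := by
  have hω : Measurable fun x : Cn n => ENNReal.ofReal (ω ‖x‖) :=
    (hm.comp measurable_norm).ennreal_ofReal
  rw [weightedVolume, lintegral_withDensity_eq_lintegral_mul _ hω hg,
    lintegral_normalizedVolume hn (hω.mul hg)]
  congr 1
  refine setLIntegral_congr_fun measurableSet_Ico fun r hr => ?_
  simp only [Pi.mul_apply]
  rw [ENNReal.ofReal_mul (pow_nonneg hr.1 _), mul_assoc]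
  congr 1
  rw [← lintegral_const_mul' _ _ ENNReal.ofReal_ne_top]
  refine lintegral_congr_ae ?_
  filter_upwards [ae_norm_eq_one hn] with ζ hζ
  rw [norm_smul, hζ, mul_one, Real.norm_eq_abs, abs_of_nonneg hr.1]

theorem weightedVolume_absolutelyContinuous (n : ℕ) (ω : ℝ → ℝ) :
    weightedVolume n ω ≪ normalizedVolume n := withDensity_absolutelyContinuous _ _

theorem ae_weightedVolume_mem_unitBall (n : ℕ) (ω : ℝ → ℝ) :
    ∀ᵐ x ∂(weightedVolume n ω), x ∈ unitBall n :=
  (weightedVolume_absolutelyContinuous n ω).ae_le (ae_mem_unitBall n)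

theorem IsRadialWeight.isFiniteMeasure {n : ℕ} (hn : 1 ≤ n) {ω : ℝ → ℝ} (h : IsRadialWeight ω)
    (hm : Measurable ω) : IsFiniteMeasure (weightedVolume n ω) := by
  constructor
  rw [← setLIntegral_one, setLIntegral_univ, lintegral_weightedVolume hn hm measurable_const]
  simp only [lintegral_const, measure_univ, mul_one]
  rw [← h.ofReal_moment]
  exact ENNReal.mul_lt_top (ENNReal.natCast_lt_top _) ENNReal.ofReal_lt_top

theorem sigmaFinite_weightedVolume (n : ℕ) {ω : ℝ → ℝ} (hm : Measurable ω) :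
    SigmaFinite (weightedVolume n ω) := by
  have hω : Measurable fun x : Cn n => ENNReal.ofReal (ω ‖x‖) :=
    (hm.comp measurable_norm).ennreal_ofReal
  exact SigmaFinite.withDensity_of_ne_top (Filter.Eventually.of_forall fun _ => ENNReal.ofReal_ne_top)

theorem measurePreserving_weightedVolume {n : ℕ} {ω : ℝ → ℝ} (hm : Measurable ω)
    (U : Cn n ≃ₗᵢ[ℂ] Cn n) :
    MeasurePreserving U (weightedVolume n ω) (weightedVolume n ω) := by
  have hω : Measurable fun x : Cn n => ENNReal.ofReal (ω ‖x‖) :=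
    (hm.comp measurable_norm).ennreal_ofReal
  have hU : Measurable U := U.continuous.measurable
  refine ⟨hU, ?_⟩
  refine Measure.ext fun s hs => ?_
  rw [Measure.map_apply hU hs, weightedVolume, withDensity_apply _ (hU hs), withDensity_apply _ hs,
    ← lintegral_indicator hs, ← lintegral_indicator (hU hs),
    ← (measurePreserving_isometry U).lintegral_comp (hω.indicator hs)]
  refine lintegral_congr fun x => ?_
  by_cases hx : U x ∈ s <;> simp [indicator, hx]

/-! ### The kernel as a power series -/

/-- Taylor coefficients of the reproducing kernel. -/
noncomputable def kernelCoeff (n : ℕ) (ω : ℝ → ℝ) (k : ℕ) : ℝ :=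
  ((k + (n - 1)).choose (n - 1) : ℝ) / (2 * n * ballMoment n ω k)

/-- The one-variable function `F` with `B_z(ξ) = F(⟨ξ, z⟩)`. -/
noncomputable def kernelFun (n : ℕ) (ω : ℝ → ℝ) (w : ℂ) : ℂ :=
  ∑' k, (kernelCoeff n ω k : ℂ) * w ^ k

theorem IsRadialWeight.kernelCoeff_pos {n : ℕ} (hn : 1 ≤ n) {ω : ℝ → ℝ} (h : IsRadialWeight ω)
    (k : ℕ) : 0 < kernelCoeff n ω k := by
  have h1 : (0 : ℝ) < ((k + (n - 1)).choose (n - 1) : ℝ) := by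
    exact_mod_cast Nat.choose_pos (by omega)
  have h2 := h.ballMoment_pos n k
  have h3 : (0 : ℝ) < n := by exact_mod_cast hn
  unfold kernelCoeff
  positivity

/-- This dictates the form of `kernelCoeff`: the coefficients of a kernel built from orthogonal
powers are the reciprocals of their squared norms. -/
theorem lintegral_weightedVolume_pow {n : ℕ} (hn : 1 ≤ n) {ω : ℝ → ℝ} (h : IsRadialWeight ω)
    (hm : Measurable ω) {e : Cn n} (he : ‖e‖ = 1) (k : ℕ) :
    ∫⁻ w, ‖inner ℂ e w‖ₑ ^ (2 * k) ∂(weightedVolume n ω) =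
      ENNReal.ofReal (kernelCoeff n ω k)⁻¹ := by
  have h1 : (0 : ℝ) < ((k + (n - 1)).choose (n - 1) : ℝ) := by
    exact_mod_cast Nat.choose_pos (by omega)
  have h2 := h.ballMoment_pos n k
  have h3 : (0 : ℝ) < n := by exact_mod_cast hn
  rw [lintegral_weightedVolume hn hm (by fun_prop)]
  have : ∀ r ∈ Ico (0 : ℝ) 1, ENNReal.ofReal (r ^ (2 * n - 1) * ω r) *
      ∫⁻ ζ, ‖inner ℂ e (r • ζ)‖ₑ ^ (2 * k) ∂(sphereMeasure n) =
      ENNReal.ofReal (r ^ (2 * k + (2 * n - 1)) * ω r) *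
        ((k + (n - 1)).choose (n - 1) : ℝ≥0∞)⁻¹ := by
    intro r hr
    have hr0 := hr.1
    have e1 : ∀ ζ : Cn n, ‖(inner ℂ e (r • ζ) : ℂ)‖ₑ ^ (2 * k) =
        ENNReal.ofReal (r ^ (2 * k)) * ‖(inner ℂ e ζ : ℂ)‖ₑ ^ (2 * k) := fun ζ => by
      rw [inner_smul_right_eq_smul, enorm_smul, mul_pow, Real.enorm_eq_ofReal hr0,
        ENNReal.ofReal_pow hr0]
    simp_rw [e1]
    rw [lintegral_const_mul' _ _ ENNReal.ofReal_ne_top, lintegral_sphereMeasure_pow hn he,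
      ← mul_assoc, ← ENNReal.ofReal_mul (mul_nonneg (by positivity) (h.pos r hr).le)]
    congr 2
    ring
  rw [setLIntegral_congr_fun measurableSet_Ico this, lintegral_mul_const' _ _ (by
    rw [ENNReal.inv_ne_top]
    exact_mod_cast (Nat.choose_pos (by omega)).ne'), ← h.ofReal_moment]
  rw [← ENNReal.ofReal_natCast, ← ENNReal.ofReal_natCast, ← ENNReal.ofReal_inv_of_pos h1,
    ← ENNReal.ofReal_mul (h.moment_nonneg _), ← ENNReal.ofReal_mul (by positivity)]
  congr 1
  unfold kernelCoeff
  unfold ballMoment at h2 ⊢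
  push_cast
  field_simp

theorem IsClassD.exists_kernelCoeff_le {n : ℕ} (hn : 1 ≤ n) {ω : ℝ → ℝ} (h : IsClassD ω) :
    ∃ β : ℕ, ∃ C : ℝ, ∀ k : ℕ, |kernelCoeff n ω k| ≤ C * ((k : ℝ) + 1) ^ β := by
  obtain ⟨β, C, hC, h1⟩ := h.exists_inv_ballMoment_le hn
  obtain ⟨C', hC', h2⟩ := (SymbolBound.choose 0 (n - 1)).bound
  have hn' : (0 : ℝ) < n := by exact_mod_cast hn
  refine ⟨(n - 1) + β, C' * C / (2 * n), fun k => ?_⟩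
  have hm := h.weight.ballMoment_pos n k
  rw [abs_of_pos (h.weight.kernelCoeff_pos hn k)]
  have h3 := h2 k
  rw [abs_of_nonneg (by positivity)] at h3
  calc kernelCoeff n ω k =
      ((k + (n - 1)).choose (n - 1) : ℝ) * (ballMoment n ω k)⁻¹ / (2 * n) := by
        unfold kernelCoeff; field_simp
    _ ≤ (C' * ((k : ℝ) + 1) ^ (n - 1)) * (C * ((k : ℝ) + 1) ^ β) / (2 * n) := by
        gcongr
        exact h1 k
    _ = _ := by rw [pow_add]; ring

theorem IsClassD.summable_kernelCoeff {n : ℕ} (hn : 1 ≤ n) {ω : ℝ → ℝ} (h : IsClassD ω) {w : ℂ}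
    (hw : ‖w‖ < 1) : Summable fun k => ‖(kernelCoeff n ω k : ℂ) * w ^ k‖ := by
  obtain ⟨β, C, h1⟩ := h.exists_kernelCoeff_le hn
  exact summable_poly_mul_pow h1 hw

theorem IsClassD.summable_kernelCoeff_real {n : ℕ} (hn : 1 ≤ n) {ω : ℝ → ℝ} (h : IsClassD ω)
    {t : ℝ} (ht0 : 0 ≤ t) (ht : t < 1) : Summable fun k => kernelCoeff n ω k * t ^ k := by
  have := h.summable_kernelCoeff hn (w := (t : ℂ))
    (by rwa [Complex.norm_real, Real.norm_eq_abs, abs_of_nonneg ht0])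
  refine this.congr fun k => ?_
  rw [norm_mul, norm_pow, Complex.norm_real, Complex.norm_real, Real.norm_eq_abs, Real.norm_eq_abs,
    abs_of_nonneg ht0, abs_of_pos (h.weight.kernelCoeff_pos hn k)]

theorem IsClassD.norm_kernelFun_le {n : ℕ} (hn : 1 ≤ n) {ω : ℝ → ℝ} (h : IsClassD ω)
    {t : ℝ} (ht : t < 1) {w : ℂ} (hw : ‖w‖ ≤ t) :
    ‖kernelFun n ω w‖ ≤ ∑' k, kernelCoeff n ω k * t ^ k := by
  have ht0 : 0 ≤ t := (norm_nonneg w).trans hw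
  refine tsum_of_norm_bounded (h.summable_kernelCoeff_real hn ht0 ht).hasSum fun k => ?_
  rw [norm_mul, norm_pow, Complex.norm_real, Real.norm_eq_abs,
    abs_of_pos (h.weight.kernelCoeff_pos hn k)]
  have := h.weight.kernelCoeff_pos hn k
  gcongr

theorem IsClassD.differentiableOn_kernelFun {n : ℕ} (hn : 1 ≤ n) {ω : ℝ → ℝ} (h : IsClassD ω) :
    DifferentiableOn ℂ (kernelFun n ω) (Metric.ball 0 1) := by
  intro w hw
  have hw : ‖w‖ < 1 := by simpa using hw
  obtain ⟨t, ht1, ht2⟩ := exists_between hw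
  have ht0 : 0 ≤ t := (norm_nonneg w).trans ht1.le
  have := Complex.differentiableOn_tsum_of_summable_norm (h.summable_kernelCoeff_real hn ht0 ht2)
    (F := fun k (w : ℂ) => (kernelCoeff n ω k : ℂ) * w ^ k) (U := Metric.ball 0 t)
    (fun k => by fun_prop) Metric.isOpen_ball (fun k v hv => by
      have hv : ‖v‖ < t := by simpa using hv
      rw [norm_mul, norm_pow, Complex.norm_real, Real.norm_eq_abs,
        abs_of_pos (h.weight.kernelCoeff_pos hn k)]
      have := h.weight.kernelCoeff_pos hn k
      gcongr)
  exact (this.differentiableAt (Metric.isOpen_ball.mem_nhds (by simpa using ht1))).differentiableWithinAt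

theorem norm_inner_lt_one {n : ℕ} {z ξ : Cn n} (hz : z ∈ unitBall n) (hξ : ξ ∈ unitBall n) :
    ‖(inner ℂ z ξ : ℂ)‖ < 1 := by
  have hz : ‖z‖ < 1 := by simpa [unitBall] using hz
  have hξ : ‖ξ‖ < 1 := by simpa [unitBall] using hξ
  have := norm_inner_le_norm (𝕜 := ℂ) z ξ
  nlinarith [norm_nonneg z, norm_nonneg ξ]

theorem norm_inner_le_left {n : ℕ} {z ξ : Cn n} (hξ : ξ ∈ unitBall n) :
    ‖(inner ℂ z ξ : ℂ)‖ ≤ ‖z‖ := by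
  have hξ : ‖ξ‖ < 1 := by simpa [unitBall] using hξ
  have := norm_inner_le_norm (𝕜 := ℂ) z ξ
  nlinarith [norm_nonneg z, norm_nonneg ξ]

theorem isOpen_unitBall (n : ℕ) : IsOpen (unitBall n) := Metric.isOpen_ball

theorem DifferentiableOn.aestronglyMeasurable_weightedVolume {n : ℕ} {f : Cn n → ℂ}
    (hf : DifferentiableOn ℂ f (unitBall n)) (ω : ℝ → ℝ) :
    AEStronglyMeasurable f (weightedVolume n ω) := by
  have h1 : AEStronglyMeasurable f (volume.restrict (unitBall n)) :=
    hf.continuousOn.aestronglyMeasurable (measurableSet_unitBall n)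
  have h2 : AEStronglyMeasurable f (normalizedVolume n) := by
    unfold normalizedVolume
    exact h1.smul_measure _
  exact h2.mono_ac (weightedVolume_absolutelyContinuous n ω)

theorem IsClassD.memBergmanTwo_kernel {n : ℕ} (hn : 1 ≤ n) {ω : ℝ → ℝ} (h : IsClassD ω)
    (hm : Measurable ω) {z : Cn n} (hz : z ∈ unitBall n) :
    MemBergmanTwo n ω fun ξ => kernelFun n ω (inner ℂ z ξ) := by
  have hd : DifferentiableOn ℂ (fun ξ => kernelFun n ω (inner ℂ z ξ)) (unitBall n) := by
    refine (h.differentiableOn_kernelFun hn).comp (t := Metric.ball 0 1)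
      (f := fun ξ : Cn n => (inner ℂ z ξ : ℂ)) ?_ fun ξ hξ => by
      simpa using norm_inner_lt_one hz hξ
    exact (innerSL ℂ z).differentiable.differentiableOn
  have hz' : ‖z‖ < 1 := by simpa [unitBall] using hz
  have := h.weight.isFiniteMeasure hn hm
  refine ⟨hd, MemLp.of_bound (hd.aestronglyMeasurable_weightedVolume ω)
    (∑' k, kernelCoeff n ω k * ‖z‖ ^ k) ?_⟩
  filter_upwards [ae_weightedVolume_mem_unitBall n ω] with ξ hξ
  exact h.norm_kernelFun_le hn hz' (norm_inner_le_left hξ)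

theorem exists_unit_smul_eq {n : ℕ} (hn : 1 ≤ n) (z : Cn n) :
    ∃ e : Cn n, ‖e‖ = 1 ∧ z = (‖z‖ : ℂ) • e := by
  by_cases h : z = 0
  · exact ⟨baseVec hn, norm_baseVec hn, by simp [h]⟩
  · have h1 : (‖z‖ : ℂ) ≠ 0 := by simpa using h
    refine ⟨(‖z‖ : ℂ)⁻¹ • z, ?_, ?_⟩
    · rw [norm_smul, norm_inv, Complex.norm_real, norm_norm, inv_mul_cancel₀ (norm_ne_zero_iff.2 h)]
    · rw [smul_smul, mul_inv_cancel₀ h1, one_smul]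

/-- The two circle actions used for averaging: `false` rotates the orthogonal complement of e and
fixes the e-coordinate, `true` multiplies the whole vector by a unimodular scalar. -/
theorem measurable_twist_circle {n : ℕ} (e : Cn n) (b : Bool) :
    Measurable (Function.uncurry fun (θ : ℝ) (w : Cn n) =>
      twist e (if b then circleMap 0 1 θ else 1) (circleMap 0 1 θ) w) := by
  have : Continuous (circleMap (0 : ℂ) 1) := continuous_circleMap 0 1
  refine Continuous.measurable ?_
  cases b
  · simp only [twist, Bool.false_eq_true, ↓reduceIte]; fun_prop
  · simp only [twist, ↓reduceIte]; fun_prop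

theorem measurePreserving_twist {n : ℕ} {ω : ℝ → ℝ} (hm : Measurable ω) {e : Cn n} (he : ‖e‖ = 1)
    {a c : ℂ} (ha : ‖a‖ = 1) (hc : ‖c‖ = 1) :
    MeasurePreserving (twist e a c) (weightedVolume n ω) (weightedVolume n ω) := by
  obtain ⟨U, hU⟩ := exists_isometry_eq_twist he ha hc
  have : (twist e a c) = U := funext fun w => (hU w).symm
  rw [this]
  exact measurePreserving_weightedVolume hm U

/-- Integration of a holomorphic function against a power of one coordinate. -/
theorem integral_mul_conj_inner_pow {n : ℕ} (hn : 1 ≤ n) {ω : ℝ → ℝ} (h : IsRadialWeight ω)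
    (hm : Measurable ω) {e : Cn n} (he : ‖e‖ = 1) {f : Cn n → ℂ}
    (hf : DifferentiableOn ℂ f (unitBall n)) (hfi : Integrable f (weightedVolume n ω)) (k : ℕ) :
    ∫ w, f w * conj (inner ℂ e w : ℂ) ^ k ∂(weightedVolume n ω) =
      ((k.factorial : ℂ)⁻¹ * iteratedDeriv k (fun l : ℂ => f (l • e)) 0) *
        ((kernelCoeff n ω k)⁻¹ : ℝ) := by
  classical
  have := h.isFiniteMeasure hn hm
  set μ := weightedVolume n ω
  set B := unitBall n
  have hball : ∀ᵐ x ∂μ, x ∈ B := ae_weightedVolume_mem_unitBall n ω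
  have hB : ∀ w, w ∈ B ↔ ‖w‖ < 1 := fun w => by simp [B, unitBall]
  have hconj : Continuous fun w : Cn n => conj (inner ℂ e w : ℂ) :=
    Complex.continuous_conj.comp (by fun_prop)
  -- Nothing is known of f outside the ball; cutting it off gives a Borel function, as the averaging
  -- argument needs.
  set f' : Cn n → ℂ := B.indicator f with hf'
  have hf'm : Measurable f' := by
    have := hf.continuousOn.measurable_piecewise (g := fun _ => (0 : ℂ)) continuousOn_const
      (measurableSet_unitBall n)
    rw [hf', ← piecewise_eq_indicator]
    exact this
  have hf'e : ∀ w ∈ B, f' w = f w := fun w hw => indicator_of_mem hw f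
  have hinn : ∀ w, ‖w‖ < 1 → ‖(inner ℂ e w : ℂ)‖ < 1 := fun w hw => by
    have := norm_inner_le_norm (𝕜 := ℂ) e w
    rw [he, one_mul] at this
    linarith
  set g₁ : Cn n → ℂ := fun w => f' w * conj (inner ℂ e w : ℂ) ^ k with hg₁
  have hg₁m : Measurable g₁ := hf'm.mul (hconj.measurable.pow_const k)
  have hg₁e : ∀ᵐ w ∂μ, f w * conj (inner ℂ e w : ℂ) ^ k = g₁ w := by
    filter_upwards [hball] with w hw
    rw [hg₁]; simp only; rw [hf'e w hw]
  have hg₁i : Integrable g₁ μ := by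
    have h1 : Integrable (fun w => f w * conj (inner ℂ e w : ℂ) ^ k) μ := by
      refine hfi.mul_bdd (c := 1) (hconj.pow k).aestronglyMeasurable ?_
      filter_upwards [hball] with w hw
      rw [norm_pow, RCLike.norm_conj]
      exact pow_le_one₀ (norm_nonneg _) (hinn w ((hB w).1 hw)).le
    exact h1.congr hg₁e
  set g₂ : Cn n → ℂ := fun w => f' ((inner ℂ e w : ℂ) • e) * conj (inner ℂ e w : ℂ) ^ k with hg₂
  have hg₂m : Measurable g₂ := by
    refine Measurable.mul (hf'm.comp (Continuous.measurable (by fun_prop))) (hconj.measurable.pow_const k)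
  have hnc : ∀ θ, ‖circleMap 0 1 θ‖ = 1 := fun θ => by simp
  -- Rotating the orthogonal complement of e fixes ⟨w, e⟩. As l ↦ f(twist e 1 l w) is holomorphic
  -- near the closed disc, its mean value is the value of f at the projection of w onto the line of
  -- e.
  have havg₁ : ∀ᵐ w ∂μ, (2 * Real.pi)⁻¹ • (∫ θ in (0 : ℝ)..(2 * Real.pi),
      g₁ (twist e 1 (circleMap 0 1 θ) w)) = g₂ w := by
    filter_upwards [hball] with w hw
    have hw1 := (hB w).1 hw
    have hmv : Real.circleAverage (fun l : ℂ => f (twist e 1 l w)) 0 1 = f (twist e 1 0 w) := by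
      refine DiffContOnCl.circleAverage ?_
      rw [abs_one]
      refine DifferentiableOn.diffContOnCl ?_
      intro l hl
      have hl : ‖l‖ ≤ 1 := by
        have := Metric.closure_ball_subset_closedBall hl
        simpa using this
      have hin : twist e 1 l w ∈ B :=
        (hB _).2 ((norm_twist_le he (by simp) hl w).trans_lt hw1)
      refine DifferentiableAt.differentiableWithinAt ?_
      refine DifferentiableAt.comp l (hf.differentiableAt ((isOpen_unitBall n).mem_nhds hin)) ?_
      unfold twist
      fun_prop
    rw [Real.circleAverage_def, twist_one_zero] at hmv
    have e1 : ∀ θ : ℝ, g₁ (twist e 1 (circleMap 0 1 θ) w) =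
        f (twist e 1 (circleMap 0 1 θ) w) * conj (inner ℂ e w : ℂ) ^ k := by
      intro θ
      have hin : twist e 1 (circleMap 0 1 θ) w ∈ B :=
        (hB _).2 ((norm_twist_le he (by simp) (hnc θ).le w).trans_lt hw1)
      rw [hg₁]; simp only
      rw [hf'e _ hin, inner_twist he, one_mul]
    simp_rw [e1]
    rw [intervalIntegral.integral_mul_const, ← smul_mul_assoc, hmv, hg₂]
    simp only
    rw [hf'e]
    rw [hB, norm_smul, he, mul_one]
    exact hinn w hw1
  obtain ⟨hi₁, he₁⟩ := integral_average (measurable_twist_circle e false)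
    (fun θ => measurePreserving_twist hm he (by simp) (hnc θ)) hg₁m hg₁i
  simp only [Bool.false_eq_true, if_false] at hi₁ he₁
  have hg₂i : Integrable g₂ μ := hi₁.congr havg₁
  rw [integral_congr_ae havg₁] at he₁
  obtain ⟨-, he₂⟩ := integral_average (measurable_twist_circle e true)
    (fun θ => measurePreserving_twist hm he (by simp) (hnc θ)) hg₂m hg₂i
  simp only [if_true] at he₂
  set φ : ℂ → ℂ := fun l => f (l • e) with hφ
  have hφd : DifferentiableOn ℂ φ (Metric.ball 0 1) := by
    refine hf.comp (f := fun l : ℂ => l • e) (by fun_prop) fun l hl => ?_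
    have hl : ‖l‖ < 1 := by simpa using hl
    change l • e ∈ B
    rw [hB, norm_smul, he, mul_one]; exact hl
  -- On that line f is a function of one variable, and rotation by scalars extracts its k-th Taylor
  -- coefficient.
  have havg₂ : ∀ᵐ w ∂μ, (2 * Real.pi)⁻¹ • (∫ θ in (0 : ℝ)..(2 * Real.pi),
      g₂ (twist e (circleMap 0 1 θ) (circleMap 0 1 θ) w)) =
      ((k.factorial : ℂ)⁻¹ * iteratedDeriv k φ 0) * ((‖(inner ℂ e w : ℂ)‖ ^ (2 * k) : ℝ) : ℂ) := by
    filter_upwards [hball] with w hw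
    have hu := hinn w ((hB w).1 hw)
    rw [← circleAverage_mul_conj_pow hφd hu k, Real.circleAverage_def]
    congr 2
    ext θ
    rw [hg₂]
    simp only
    rw [inner_twist he, hf'e]
    rw [hB, norm_smul, he, mul_one, norm_mul, hnc, one_mul]
    exact hu
  rw [integral_congr_ae havg₂] at he₂
  rw [integral_congr_ae hg₁e, ← he₁, ← he₂, integral_const_mul, integral_complex_ofReal]
  congr 2
  have hk := lintegral_weightedVolume_pow hn h hm he k
  rw [integral_eq_lintegral_of_nonneg_ae (Filter.Eventually.of_forall fun w => by positivity)
    (Continuous.aestronglyMeasurable (by fun_prop))]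
  have e3 : ∀ w : Cn n, ENNReal.ofReal (‖(inner ℂ e w : ℂ)‖ ^ (2 * k)) =
      ‖(inner ℂ e w : ℂ)‖ₑ ^ (2 * k) := fun w => by
    rw [ENNReal.ofReal_pow (norm_nonneg _), ofReal_norm]
  simp_rw [e3]
  rw [hk, ENNReal.toReal_ofReal (inv_pos.2 (h.kernelCoeff_pos hn k)).le]

/-- The explicit kernel has the reproducing property. -/
theorem IsClassD.isReproducingAt_kernel {n : ℕ} (hn : 1 ≤ n) {ω : ℝ → ℝ} (h : IsClassD ω)
    (hm : Measurable ω) {z : Cn n} (hz : z ∈ unitBall n) :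
    IsReproducingAt n ω z fun ξ => kernelFun n ω (inner ℂ z ξ) := by
  refine ⟨h.memBergmanTwo_kernel hn hm hz, fun f hf => ?_⟩
  have := h.weight.isFiniteMeasure hn hm
  have hfi : Integrable f (weightedVolume n ω) := hf.2.integrable (by norm_num)
  obtain ⟨e, he, hze⟩ := exists_unit_smul_eq hn z
  set t := ‖z‖ with ht
  have ht1 : t < 1 := by simpa [unitBall] using hz
  have ht0 : 0 ≤ t := norm_nonneg z
  have hinn : ∀ ξ, (inner ℂ z ξ : ℂ) = t * inner ℂ e ξ := fun ξ => by
    conv_lhs => rw [hze]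
    rw [inner_smul_left, Complex.conj_ofReal]
  set φ : ℂ → ℂ := fun l => f (l • e) with hφ
  have hφd : DifferentiableOn ℂ φ (Metric.ball 0 1) := by
    refine hf.1.comp (f := fun l : ℂ => l • e) (by fun_prop) fun l hl => ?_
    have hl : ‖l‖ < 1 := by simpa using hl
    rw [unitBall, mem_ball_zero_iff, norm_smul, he, mul_one]; exact hl
  have hconj : Continuous fun w : Cn n => conj (inner ℂ e w : ℂ) :=
    Complex.continuous_conj.comp (by fun_prop)
  set F : ℕ → Cn n → ℂ := fun k w =>
    ((kernelCoeff n ω k * t ^ k : ℝ) : ℂ) * (f w * conj (inner ℂ e w : ℂ) ^ k) with hF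
  have hFn : ∀ k, ∀ w ∈ unitBall n, ‖F k w‖ ≤ kernelCoeff n ω k * t ^ k * ‖f w‖ := by
    intro k w hw
    have hu : ‖(inner ℂ e w : ℂ)‖ ≤ 1 := (norm_inner_le_left hw).trans he.le
    have := h.weight.kernelCoeff_pos hn k
    simp only [hF, norm_mul, norm_pow, Complex.norm_real, RCLike.norm_conj]
    rw [Real.norm_of_nonneg this.le, Real.norm_of_nonneg ht0]
    gcongr
    exact mul_le_of_le_one_right (norm_nonneg _) (pow_le_one₀ (norm_nonneg _) hu)
  have hFi : ∀ k, Integrable (F k) (weightedVolume n ω) := by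
    intro k
    refine (hfi.mul_bdd (c := 1) (hconj.pow k).aestronglyMeasurable ?_).const_mul _
    filter_upwards [ae_weightedVolume_mem_unitBall n ω] with w hw
    rw [Pi.pow_apply, norm_pow, RCLike.norm_conj]
    exact pow_le_one₀ (norm_nonneg _) ((norm_inner_le_left hw).trans he.le)
  -- Termwise integration is allowed since |⟨w, e⟩| ≤ 1 and t < 1. The coefficients `kernelCoeff`
  -- cancel the squared norms, which leaves the Taylor series of f along e at the point t.
  have hmain := hasSum_integral_of_summable_integral_norm hFi (by
    refine ((h.summable_kernelCoeff_real hn ht0 ht1).mul_right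
      (∫ w, ‖f w‖ ∂(weightedVolume n ω))).of_nonneg_of_le
      (fun k => integral_nonneg fun w => norm_nonneg _) fun k => ?_
    rw [← integral_const_mul]
    refine integral_mono_ae (hFi k).norm (hfi.norm.const_mul _) ?_
    filter_upwards [ae_weightedVolume_mem_unitBall n ω] with w hw
    exact hFn k w hw)
  have hval : ∀ k, ∫ w, F k w ∂(weightedVolume n ω) =
      ((k.factorial : ℂ)⁻¹ * iteratedDeriv k φ 0) * (t : ℂ) ^ k := by
    intro k
    have hk : (kernelCoeff n ω k : ℂ) ≠ 0 := by
      exact_mod_cast (h.weight.kernelCoeff_pos hn k).ne'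
    simp only [hF]
    rw [integral_const_mul, integral_mul_conj_inner_pow hn h.weight hm he hf.1 hfi k]
    push_cast
    simp only [hφ]
    field_simp
  have hlim : ∀ᵐ w ∂(weightedVolume n ω), ∑' k, F k w = f w * conj (kernelFun n ω (inner ℂ z w)) := by
    filter_upwards with w
    rw [kernelFun, Complex.conj_tsum, ← tsum_mul_left]
    refine tsum_congr fun k => ?_
    simp only [hF]
    rw [hinn]
    simp only [map_mul, map_pow, Complex.conj_ofReal]
    push_cast
    ring
  rw [integral_congr_ae hlim] at hmain
  have hT := Complex.hasSum_taylorSeries_on_ball hφd (z := (t : ℂ)) (by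
    simp only [mem_ball_zero_iff, Complex.norm_real]
    rwa [Real.norm_of_nonneg ht0])
  have hT' : HasSum (fun k => ∫ w, F k w ∂(weightedVolume n ω)) (φ t) := by
    refine hT.congr_fun ?_
    intro k
    rw [hval]
    simp only [sub_zero, smul_eq_mul]
    ring
  have hφz : φ t = f z := by
    simp only [hφ]
    rw [← hze]
  rw [← hφz]
  exact (hmain.unique hT').symm

/-- The difference of two representing functions lies in A²_ω and is orthogonal to itself. Equality
is almost everywhere because the chosen representative is unconstrained outside the ball. -/
theorem IsClassD.bergmanKernel_ae_eq {n : ℕ} (hn : 1 ≤ n) {ω : ℝ → ℝ} (h : IsClassD ω)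
    (hm : Measurable ω) {z : Cn n} (hz : z ∈ unitBall n) :
    bergmanKernel n ω z =ᵐ[weightedVolume n ω] fun ξ => kernelFun n ω (inner ℂ z ξ) := by
  have hK := h.isReproducingAt_kernel hn hm hz
  have hB : IsReproducingAt n ω z (bergmanKernel n ω z) := Classical.epsilon_spec ⟨_, hK⟩
  set K : Cn n → ℂ := fun ξ => kernelFun n ω (inner ℂ z ξ)
  set B := bergmanKernel n ω z
  have hD : MemBergmanTwo n ω (fun ξ => B ξ - K ξ) :=
    ⟨hB.1.1.sub hK.1.1, hB.1.2.sub hK.1.2⟩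
  have h1 := hB.2 _ hD
  have h2 := hK.2 _ hD
  have hconj : ∀ {g : Cn n → ℂ}, MemLp g 2 (weightedVolume n ω) →
      MemLp (fun ξ => conj (g ξ)) 2 (weightedVolume n ω) := fun hg => hg.star
  have hi1 : Integrable (fun ξ => (B ξ - K ξ) * conj (B ξ)) (weightedVolume n ω) :=
    MemLp.integrable_mul hD.2 (hconj hB.1.2)
  have hi2 : Integrable (fun ξ => (B ξ - K ξ) * conj (K ξ)) (weightedVolume n ω) :=
    MemLp.integrable_mul hD.2 (hconj hK.1.2)
  have h3 : ∫ ξ, ((‖B ξ - K ξ‖ ^ 2 : ℝ) : ℂ) ∂(weightedVolume n ω) = 0 := by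
    have : ∀ ξ, ((‖B ξ - K ξ‖ ^ 2 : ℝ) : ℂ) =
        (B ξ - K ξ) * conj (B ξ) - (B ξ - K ξ) * conj (K ξ) := fun ξ => by
      rw [← mul_sub, ← map_sub, Complex.mul_conj, Complex.normSq_eq_norm_sq]
    simp_rw [this]
    rw [integral_sub hi1 hi2, ← h1, ← h2, sub_self]
  rw [integral_complex_ofReal, Complex.ofReal_eq_zero,
    integral_eq_zero_iff_of_nonneg (fun ξ => by positivity)
      (by
        have := hD.2.integrable_norm_pow (p := 2) (by norm_num)
        simpa using this)] at h3
  filter_upwards [h3] with ξ hξ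
  have : ‖B ξ - K ξ‖ = 0 := by simpa using hξ
  exact sub_eq_zero.1 (norm_eq_zero.1 this)

/-! ### Parseval on the sphere -/

theorem measurePreserving_sphereMeasure {n : ℕ} (U : Cn n ≃ₗᵢ[ℂ] Cn n) :
    MeasurePreserving U (sphereMeasure n) (sphereMeasure n) := by
  have hU : Measurable U := U.continuous.measurable
  refine ⟨hU, Measure.ext_of_lintegral _ fun f hf => ?_⟩
  rw [lintegral_map hf hU, lintegral_sphereMeasure_isometry U hf]

theorem lintegral_circle_poly (a : ℕ → ℂ) (N : ℕ) :
    ∫⁻ θ in Ioc 0 (2 * Real.pi), ‖∑ k ∈ Finset.range N, a k * circleMap 0 1 θ ^ k‖ₑ ^ 2 =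
      ENNReal.ofReal (2 * Real.pi) * ∑ k ∈ Finset.range N, ‖a k‖ₑ ^ 2 := by
  set p : Polynomial ℂ := ∑ k ∈ Finset.range N, Polynomial.monomial k (a k) with hp
  have hev : ∀ c : ℂ, p.eval c = ∑ k ∈ Finset.range N, a k * c ^ k := fun c => by
    simp [hp, Polynomial.eval_finsetSum]
  have hco : ∀ k ∈ Finset.range N, p.coeff k = a k := fun k hk => by
    simp only [hp, Polynomial.finsetSum_coeff, Polynomial.coeff_monomial]
    rw [Finset.sum_eq_single_of_mem k hk (fun b _ hb => by simp [hb])]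
    simp
  have hsup : p.support ⊆ Finset.range N := by
    intro k hk
    by_contra hkN
    rw [Polynomial.mem_support_iff] at hk
    apply hk
    simp only [hp, Polynomial.finsetSum_coeff, Polynomial.coeff_monomial]
    refine Finset.sum_eq_zero fun b hb => ?_
    rw [if_neg]
    rintro rfl
    exact hkN hb
  have h := p.sum_sq_norm_coeff_eq_circleAverage
  rw [Finset.sum_subset hsup (fun k _ hk => by
    rw [Polynomial.notMem_support_iff] at hk; simp [hk]), Real.circleAverage_def,
    intervalIntegral.integral_of_le (by positivity), smul_eq_mul] at h
  simp_rw [hev] at h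
  rw [Finset.sum_congr rfl (fun k hk => by rw [hco k hk]), eq_inv_mul_iff_mul_eq₀ (by positivity)] at h
  have e1 : ∀ c : ℂ, ‖c‖ₑ ^ 2 = ENNReal.ofReal (‖c‖ ^ 2) := fun c => by
    rw [ENNReal.ofReal_pow (norm_nonneg _), ofReal_norm]
  simp_rw [e1]
  have hc : Continuous (circleMap (0 : ℂ) 1) := continuous_circleMap 0 1
  rw [← ofReal_integral_eq_lintegral_ofReal, ← h, ENNReal.ofReal_mul (by positivity),
    ENNReal.ofReal_sum_of_nonneg (fun k _ => by positivity)]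
  · exact Continuous.integrableOn_Ioc (by fun_prop)
  · exact Filter.Eventually.of_forall fun θ => by positivity

/-- Rotation by scalars reduces to Parseval on each circle; the remaining moduli are the norms of
powers on the sphere. -/
theorem lintegral_sphere_poly {n : ℕ} (hn : 1 ≤ n) {e : Cn n} (he : ‖e‖ = 1) (a : ℕ → ℂ) (N : ℕ) :
    ∫⁻ ζ, ‖∑ k ∈ Finset.range N, a k * (inner ℂ e ζ : ℂ) ^ k‖ₑ ^ 2 ∂(sphereMeasure n) =
      ∑ k ∈ Finset.range N, ‖a k‖ₑ ^ 2 * ((k + (n - 1)).choose (n - 1) : ℝ≥0∞)⁻¹ := by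
  have hpi : ENNReal.ofReal (2 * Real.pi) ≠ 0 := (ENNReal.ofReal_pos.2 (by positivity)).ne'
  rw [← ENNReal.mul_right_inj hpi ENNReal.ofReal_ne_top]
  rw [lintegral_average (measurable_twist_circle e true) (fun θ => by
    obtain ⟨U, hU⟩ := exists_isometry_eq_twist he (a := circleMap 0 1 θ) (c := circleMap 0 1 θ)
      (by simp) (by simp)
    have : (twist e (circleMap 0 1 θ) (circleMap 0 1 θ)) = U := funext fun w => (hU w).symm
    simp only [↓reduceIte]
    change MeasurePreserving (twist e (circleMap 0 1 θ) (circleMap 0 1 θ)) _ _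
    rw [this]
    exact measurePreserving_sphereMeasure U) (by fun_prop)]
  simp only [↓reduceIte, inner_twist he]
  have : ∀ ζ : Cn n, ∫⁻ θ in Ioc 0 (2 * Real.pi), ‖∑ k ∈ Finset.range N,
      a k * (circleMap 0 1 θ * (inner ℂ e ζ : ℂ)) ^ k‖ₑ ^ 2 =
      ENNReal.ofReal (2 * Real.pi) * ∑ k ∈ Finset.range N, ‖a k‖ₑ ^ 2 *
        ‖(inner ℂ e ζ : ℂ)‖ₑ ^ (2 * k) := by
    intro ζ
    have := lintegral_circle_poly (fun k => a k * (inner ℂ e ζ : ℂ) ^ k) N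
    simp only [enorm_mul, mul_pow, enorm_pow] at this ⊢
    simp_rw [pow_mul]
    simp_rw [← pow_mul, mul_comm 2, pow_mul]
    rw [← this]
    congr 1; ext θ
    congr 3; ext k
    ring
  simp_rw [this]
  rw [lintegral_const_mul' _ _ ENNReal.ofReal_ne_top, lintegral_finsetSum _ (by fun_prop)]
  congr 1
  refine Finset.sum_congr rfl fun k _ => ?_
  rw [lintegral_const_mul _ (by fun_prop), lintegral_sphereMeasure_pow hn he]

theorem ae_norm_inner_le_one {n : ℕ} (hn : 1 ≤ n) {e : Cn n} (he : ‖e‖ = 1) :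
    ∀ᵐ ζ ∂(sphereMeasure n), ‖(inner ℂ e ζ : ℂ)‖ ≤ 1 := by
  filter_upwards [ae_norm_eq_one hn] with ζ hζ
  have := norm_inner_le_norm (𝕜 := ℂ) e ζ
  rwa [he, hζ, one_mul] at this

/-- Only an upper bound is needed, so Fatou's lemma along partial sums replaces a convergence
argument in L². -/
theorem lintegral_sphere_tsum_le {n : ℕ} (hn : 1 ≤ n) {e : Cn n} (he : ‖e‖ = 1) {a : ℕ → ℂ}
    (ha : Summable fun k => ‖a k‖) :
    ∫⁻ ζ, ‖∑' k, a k * (inner ℂ e ζ : ℂ) ^ k‖ₑ ^ 2 ∂(sphereMeasure n) ≤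
      ∑' k, ‖a k‖ₑ ^ 2 * ((k + (n - 1)).choose (n - 1) : ℝ≥0∞)⁻¹ := by
  have hlim : ∀ᵐ ζ ∂(sphereMeasure n), ‖∑' k, a k * (inner ℂ e ζ : ℂ) ^ k‖ₑ ^ 2 =
      Filter.liminf (fun N => ‖∑ k ∈ Finset.range N, a k * (inner ℂ e ζ : ℂ) ^ k‖ₑ ^ 2)
        Filter.atTop := by
    filter_upwards [ae_norm_inner_le_one hn he] with ζ hζ
    have hs : Summable fun k => a k * (inner ℂ e ζ : ℂ) ^ k := by
      refine Summable.of_norm (ha.of_nonneg_of_le (fun k => norm_nonneg _) fun k => ?_)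
      rw [norm_mul, norm_pow]
      exact mul_le_of_le_one_right (norm_nonneg _) (pow_le_one₀ (norm_nonneg _) hζ)
    have := hs.hasSum.tendsto_sum_nat
    have hc : Continuous fun z : ℂ => ‖z‖ₑ ^ 2 := by fun_prop
    exact ((hc.tendsto _).comp this).liminf_eq.symm
  rw [lintegral_congr_ae hlim]
  refine (lintegral_liminf_le fun N => by fun_prop).trans ?_
  refine Filter.liminf_le_of_le (by isBoundedDefault) fun b hb => ?_
  obtain ⟨N, hN⟩ := hb.exists
  rw [lintegral_sphere_poly hn he] at hN
  exact hN.trans (ENNReal.sum_le_tsum _)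

theorem summable_choose_mul_pow (N : ℕ) {t : ℝ} (ht0 : 0 ≤ t) (ht : t < 1) :
    Summable fun k => ((k + N).choose N : ℝ) * t ^ k :=
  summable_choose_mul_geometric_of_norm_lt_one N (by rwa [Real.norm_of_nonneg ht0])

theorem tsum_choose_mul_pow (N : ℕ) {t : ℝ} (ht0 : 0 ≤ t) (ht : t < 1) :
    ∑' k, ((k + N).choose N : ℝ) * t ^ k = 1 / (1 - t) ^ (N + 1) :=
  tsum_choose_mul_geometric_of_norm_lt_one N (by rwa [Real.norm_of_nonneg ht0])

/-- The coefficients of (1-Rw)^(-n) are binomial coefficients times R^k; Parseval divides their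
squares by the same binomial coefficients. After R^(2k) ≤ R^k the sum is again the binomial series,
with value (1-R)^(-n). -/
theorem lintegral_sphere_inv_one_sub_le {n : ℕ} (hn : 1 ≤ n) {e : Cn n} (he : ‖e‖ = 1) {R : ℝ}
    (hR0 : 0 ≤ R) (hR : R < 1) :
    ∫⁻ ζ, (‖1 - R * (inner ℂ e ζ : ℂ)‖ₑ⁻¹ ^ n) ^ 2 ∂(sphereMeasure n) ≤
      ENNReal.ofReal (1 / (1 - R) ^ n) := by
  have hsum := summable_choose_mul_pow (n - 1) hR0 hR
  set a : ℕ → ℂ := fun k => (((k + (n - 1)).choose (n - 1) * R ^ k : ℝ) : ℂ) with ha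
  have han : ∀ k, ‖a k‖ = ((k + (n - 1)).choose (n - 1) : ℝ) * R ^ k := fun k => by
    simp only [ha, Complex.norm_real]
    exact Real.norm_of_nonneg (by positivity)
  have h1 := lintegral_sphere_tsum_le hn he (a := a) (by simp_rw [han]; exact hsum)
  have h2 : ∀ᵐ ζ ∂(sphereMeasure n), (‖1 - R * (inner ℂ e ζ : ℂ)‖ₑ⁻¹ ^ n) ^ 2 =
      ‖∑' k, a k * (inner ℂ e ζ : ℂ) ^ k‖ₑ ^ 2 := by
    filter_upwards [ae_norm_inner_le_one hn he] with ζ hζ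
    set u : ℂ := inner ℂ e ζ
    have hw : ‖(R : ℂ) * u‖ < 1 := by
      rw [norm_mul, Complex.norm_real, Real.norm_of_nonneg hR0]
      nlinarith [norm_nonneg u]
    have h3 := tsum_choose_mul_geometric_of_norm_lt_one (n - 1) hw
    have h4 : ∑' k, a k * u ^ k = 1 / (1 - (R : ℂ) * u) ^ (n - 1 + 1) := by
      rw [← h3]
      refine tsum_congr fun k => ?_
      simp only [ha]
      push_cast
      ring
    have h5 : 1 - (R : ℂ) * u ≠ 0 := by
      intro h
      have : (R : ℂ) * u = 1 := (sub_eq_zero.1 h).symm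
      rw [this] at hw
      simp at hw
    rw [h4, Nat.sub_add_cancel hn, one_div, enorm_inv (pow_ne_zero _ h5), enorm_pow, ENNReal.inv_pow]
  rw [lintegral_congr_ae h2]
  refine h1.trans ?_
  have h6 : ∀ k, ‖a k‖ₑ ^ 2 * ((k + (n - 1)).choose (n - 1) : ℝ≥0∞)⁻¹ ≤
      ENNReal.ofReal (((k + (n - 1)).choose (n - 1) : ℝ) * R ^ k) := by
    intro k
    have hcp : (0 : ℝ) < ((k + (n - 1)).choose (n - 1) : ℝ) := by
      exact_mod_cast Nat.choose_pos (by omega)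
    rw [← ofReal_norm, han, ← ENNReal.ofReal_pow (by positivity), ← ENNReal.ofReal_natCast,
      ← ENNReal.ofReal_inv_of_pos hcp, ← ENNReal.ofReal_mul (by positivity)]
    refine ENNReal.ofReal_le_ofReal ?_
    have : R ^ k * R ^ k ≤ R ^ k := mul_le_of_le_one_right (by positivity) (pow_le_one₀ hR0 hR.le)
    calc _ = ((k + (n - 1)).choose (n - 1) : ℝ) * (R ^ k * R ^ k) := by field_simp
      _ ≤ _ := by gcongr
  refine (ENNReal.tsum_le_tsum h6).trans ?_
  rw [← ENNReal.ofReal_tsum_of_nonneg (fun k => by positivity) hsum, tsum_choose_mul_pow _ hR0 hR,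
    Nat.sub_add_cancel hn]

theorem summable_succ_pow_mul_pow (N : ℕ) {t : ℝ} (ht0 : 0 ≤ t) (ht : t < 1) :
    Summable fun k : ℕ => ((k : ℝ) + 1) ^ N * t ^ k := by
  refine ((summable_choose_mul_pow N ht0 ht).mul_left (N.factorial : ℝ)).of_nonneg_of_le
    (fun k => by positivity) fun k => ?_
  rw [← mul_assoc]
  gcongr
  exact succ_pow_le_factorial_mul_choose k N

theorem tsum_succ_pow_mul_pow_le (N : ℕ) {t : ℝ} (ht0 : 0 ≤ t) (ht : t < 1) :
    ∑' k : ℕ, ((k : ℝ) + 1) ^ N * t ^ k ≤ N.factorial / (1 - t) ^ (N + 1) := by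
  have h := (summable_choose_mul_pow N ht0 ht).mul_left (N.factorial : ℝ)
  calc _ ≤ ∑' k : ℕ, (N.factorial : ℝ) * (((k + N).choose N : ℝ) * t ^ k) := by
        refine (summable_succ_pow_mul_pow N ht0 ht).tsum_le_tsum (fun k => ?_) h
        rw [← mul_assoc]
        gcongr
        exact succ_pow_le_factorial_mul_choose k N
    _ = _ := by rw [tsum_mul_left, tsum_choose_mul_pow N ht0 ht]; ring

/-! ### The integral mean of the kernel -/

theorem IsClassD.exists_diffKernelCoeff_poly {n : ℕ} (hn : 1 ≤ n) {ω : ℝ → ℝ} (h : IsClassD ω) :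
    ∃ N : ℕ, ∃ C : ℝ, ∀ k, |diffKernelCoeff n ω k| ≤ C * ((k : ℝ) + 1) ^ N := by
  obtain ⟨β, C, hC, h1⟩ := h.exists_inv_ballMoment_le hn
  obtain ⟨C', hC', h2⟩ := (h.symbolBound_diffKernelCoeff hn 0).bound
  refine ⟨(n - 1) + n + β, C' * C, fun k => (h2 k).trans ?_⟩
  calc _ ≤ C' * (((k : ℝ) + 1) ^ (n - 1) * ((k : ℝ) + 1) ^ n * (C * ((k : ℝ) + 1) ^ β)) := by
        gcongr
        exact h1 k
    _ = _ := by rw [pow_add, pow_add]; ring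

/-- Square sum of the differenced coefficients. -/
theorem IsClassD.exists_tsum_fdiff_le {n : ℕ} (hn : 1 ≤ n) {ω : ℝ → ℝ} (h : IsClassD ω) :
    ∃ C : ℝ, 0 ≤ C ∧ ∀ R : ℝ, 0 ≤ R → R < 1 →
      ∑' k, ENNReal.ofReal ((fdiff^[n] (diffKernelCoeff n ω) k * R ^ k) ^ 2) *
        ((k + (n - 1)).choose (n - 1) : ℝ≥0∞)⁻¹ ≤
      ENNReal.ofReal (C / (1 - R) ^ n / tail ω R ^ 2) := by
  obtain ⟨C₁, hC₁, h1⟩ := h.exists_fdiff_diffKernelCoeff_le hn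
  obtain ⟨β, C₂, hC₂, h2⟩ := h.exists_tail_le_mul_ballMoment hn
  set A : ℝ := C₁ ^ 2 * (n - 1).factorial * (2 * C₂ ^ 2) with hA
  have hA0 : 0 ≤ A := by positivity
  refine ⟨A * ((n - 1).factorial + (n - 1 + 2 * β).factorial), by positivity, fun R hR0 hR => ?_⟩
  have hT := h.weight.tail_pos ⟨hR0, hR⟩
  have hR' : 0 < 1 - R := by linarith
  -- The reciprocal moment is at most C(1 + ((k+1)(1-R))^β) / ω̂(R), which frees the weight from k.
  -- The binomial coefficient in the denominator removes one of the two factors (k+1)^(n-1) of the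
  -- square. Each of the two remaining sums is of order (1-R)^(-n).
  have hbound : ∀ k, ENNReal.ofReal ((fdiff^[n] (diffKernelCoeff n ω) k * R ^ k) ^ 2) *
        ((k + (n - 1)).choose (n - 1) : ℝ≥0∞)⁻¹ ≤
      ENNReal.ofReal (A / tail ω R ^ 2 * (((k : ℝ) + 1) ^ (n - 1) * R ^ k +
        (1 - R) ^ (2 * β) * (((k : ℝ) + 1) ^ (n - 1 + 2 * β) * R ^ k))) := by
    intro k
    have hcp : (0 : ℝ) < ((k + (n - 1)).choose (n - 1) : ℝ) := by
      exact_mod_cast Nat.choose_pos (by omega)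
    have hm := h.weight.ballMoment_pos n k
    rw [← ENNReal.ofReal_natCast, ← ENNReal.ofReal_inv_of_pos hcp,
      ← ENNReal.ofReal_mul (by positivity)]
    refine ENNReal.ofReal_le_ofReal ?_
    set y : ℝ := (k : ℝ) + 1
    have hy : 0 < y := by positivity
    have h3 : (fdiff^[n] (diffKernelCoeff n ω) k) ^ 2 ≤
        (C₁ * (y ^ (n - 1) * (ballMoment n ω k)⁻¹)) ^ 2 := by
      rw [← sq_abs]
      exact pow_le_pow_left₀ (abs_nonneg _) (h1 k) 2
    have h4 : (ballMoment n ω k)⁻¹ ≤ C₂ * (1 + (y * (1 - R)) ^ β) / tail ω R := by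
      rw [inv_le_iff_one_le_mul₀ hm, div_mul_eq_mul_div, le_div_iff₀ hT, one_mul]
      exact h2 k R ⟨hR0, hR⟩
    have h5 : ((ballMoment n ω k)⁻¹) ^ 2 ≤
        (2 * C₂ ^ 2) * (1 + y ^ (2 * β) * (1 - R) ^ (2 * β)) / tail ω R ^ 2 := by
      calc ((ballMoment n ω k)⁻¹) ^ 2 ≤ (C₂ * (1 + (y * (1 - R)) ^ β) / tail ω R) ^ 2 := by
            gcongr
        _ = C₂ ^ 2 * (1 + (y * (1 - R)) ^ β) ^ 2 / tail ω R ^ 2 := by rw [div_pow, mul_pow]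
        _ ≤ C₂ ^ 2 * (2 * (1 + ((y * (1 - R)) ^ β) ^ 2)) / tail ω R ^ 2 := by
            gcongr
            nlinarith [sq_nonneg (1 - (y * (1 - R)) ^ β)]
        _ = _ := by rw [← pow_mul, mul_pow, mul_comm β 2]; ring
    have h6 : y ^ (n - 1) ≤ (n - 1).factorial * ((k + (n - 1)).choose (n - 1) : ℝ) :=
      succ_pow_le_factorial_mul_choose k (n - 1)
    have hRk : (R ^ k) ^ 2 ≤ R ^ k := by
      rw [pow_two]
      exact mul_le_of_le_one_right (by positivity) (pow_le_one₀ hR0 hR.le)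
    calc (fdiff^[n] (diffKernelCoeff n ω) k * R ^ k) ^ 2 * ((k + (n - 1)).choose (n - 1) : ℝ)⁻¹
        = (fdiff^[n] (diffKernelCoeff n ω) k) ^ 2 * (R ^ k) ^ 2 *
          ((k + (n - 1)).choose (n - 1) : ℝ)⁻¹ := by rw [mul_pow]
      _ ≤ (C₁ * (y ^ (n - 1) * (ballMoment n ω k)⁻¹)) ^ 2 * R ^ k *
          ((k + (n - 1)).choose (n - 1) : ℝ)⁻¹ := by gcongr
      _ = C₁ ^ 2 * y ^ (n - 1) * y ^ (n - 1) * ((ballMoment n ω k)⁻¹) ^ 2 * R ^ k *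
          ((k + (n - 1)).choose (n - 1) : ℝ)⁻¹ := by ring
      _ ≤ C₁ ^ 2 * y ^ (n - 1) * ((n - 1).factorial * ((k + (n - 1)).choose (n - 1) : ℝ)) *
          ((2 * C₂ ^ 2) * (1 + y ^ (2 * β) * (1 - R) ^ (2 * β)) / tail ω R ^ 2) * R ^ k *
          ((k + (n - 1)).choose (n - 1) : ℝ)⁻¹ := by gcongr
      _ = _ := by
          rw [hA, pow_add]
          field_simp
  refine (ENNReal.tsum_le_tsum hbound).trans ?_
  have hs1 := summable_succ_pow_mul_pow (n - 1) hR0 hR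
  have hs2 := (summable_succ_pow_mul_pow (n - 1 + 2 * β) hR0 hR).mul_left ((1 - R) ^ (2 * β))
  rw [← ENNReal.ofReal_tsum_of_nonneg (fun k => by positivity) ((hs1.add hs2).mul_left _)]
  refine ENNReal.ofReal_le_ofReal ?_
  rw [tsum_mul_left, hs1.tsum_add hs2, tsum_mul_left]
  have h7 := tsum_succ_pow_mul_pow_le (n - 1) hR0 hR
  have h8 := tsum_succ_pow_mul_pow_le (n - 1 + 2 * β) hR0 hR
  rw [Nat.sub_add_cancel hn] at h7
  have h9 : n - 1 + 2 * β + 1 = n + 2 * β := by omega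
  rw [h9] at h8
  calc _ ≤ A / tail ω R ^ 2 * ((n - 1).factorial / (1 - R) ^ n +
        (1 - R) ^ (2 * β) * ((n - 1 + 2 * β).factorial / (1 - R) ^ (n + 2 * β))) := by gcongr
    _ = _ := by rw [pow_add]; field_simp

/-- The radially differentiated kernel as a function of one variable. -/
noncomputable def diffKernelFun (n : ℕ) (ω : ℝ → ℝ) (w : ℂ) : ℂ :=
  ∑' k, (diffKernelCoeff n ω k : ℂ) * w ^ k

theorem IsClassD.continuousOn_diffKernelFun {n : ℕ} (hn : 1 ≤ n) {ω : ℝ → ℝ} (h : IsClassD ω) :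
    ContinuousOn (diffKernelFun n ω) (Metric.ball 0 1) := by
  obtain ⟨N, C, hC⟩ := h.exists_diffKernelCoeff_poly hn
  intro w hw
  have hw : ‖w‖ < 1 := by simpa using hw
  obtain ⟨t, ht1, ht2⟩ := exists_between hw
  have ht0 : 0 ≤ t := (norm_nonneg w).trans ht1.le
  have hs : Summable fun k => |diffKernelCoeff n ω k| * t ^ k := by
    have := summable_poly_mul_pow hC (w := (t : ℂ))
      (by rwa [Complex.norm_real, Real.norm_of_nonneg ht0])
    refine this.congr fun k => ?_
    rw [norm_mul, norm_pow, Complex.norm_real, Complex.norm_real, Real.norm_eq_abs,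
      Real.norm_of_nonneg ht0]
  have := continuousOn_tsum (f := fun k (w : ℂ) => (diffKernelCoeff n ω k : ℂ) * w ^ k)
    (s := Metric.ball 0 t) (fun k => by fun_prop) hs (fun k v hv => by
      have hv : ‖v‖ < t := by simpa using hv
      rw [norm_mul, norm_pow, Complex.norm_real, Real.norm_eq_abs]
      gcongr)
  exact (this.continuousAt (Metric.isOpen_ball.mem_nhds (by simpa using ht1))).continuousWithinAt

/-- Multiply and divide by (1-w)^n. The product with the kernel is controlled in L² by the
differenced coefficients, the reciprocal by the binomial series, and Cauchy-Schwarz combines two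
factors (1-R)^(-n/2). -/
theorem IsClassD.exists_lintegral_diffKernel_le {n : ℕ} (hn : 1 ≤ n) {ω : ℝ → ℝ} (h : IsClassD ω) :
    ∃ C : ℝ, 0 ≤ C ∧ ∀ R : ℝ, 0 ≤ R → R < 1 → ∀ e : Cn n, ‖e‖ = 1 →
      ∫⁻ ζ, ‖diffKernelFun n ω (R * inner ℂ e ζ)‖ₑ ∂(sphereMeasure n) ≤
        ENNReal.ofReal (C / (1 - R) ^ n / tail ω R) := by
  obtain ⟨N, C₁, hC₁⟩ := h.exists_diffKernelCoeff_poly hn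
  have hiter : ∀ i, ∀ w : ℂ, ‖w‖ < 1 →
      Summable fun k => ‖(fdiff^[i] (diffKernelCoeff n ω) k : ℂ) * w ^ k‖ := fun i w hw => by
    obtain ⟨C', hC'⟩ := abs_iterate_fdiff_poly_le i hC₁
    exact summable_poly_mul_pow hC' hw
  obtain ⟨C₀, hC₀, h0⟩ := norm_one_sub_pow_mul_tsum_le n (f := diffKernelCoeff n ω)
    fun i _ w hw => hiter i w hw
  obtain ⟨C₂, hC₂, h2⟩ := h.exists_tsum_fdiff_le hn
  have hT0 := h.weight.tail_pos (r := 0) ⟨le_rfl, one_pos⟩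
  -- The summand with ω̂(0)² absorbs the bounded boundary terms, since (1-R)^(-n) / ω̂(R)² is at
  -- least 1/ω̂(0)².
  set K : ℝ := 2 * (C₀ ^ 2 * tail ω 0 ^ 2 + C₂) with hK
  have hK0 : 0 ≤ K := by positivity
  refine ⟨Real.sqrt K, Real.sqrt_nonneg _, fun R hR0 hR e he => ?_⟩
  have hT := h.weight.tail_pos ⟨hR0, hR⟩
  have hR' : 0 < 1 - R := by linarith
  set μ := sphereMeasure n
  set D : Cn n → ℂ := fun ζ => ∑' k, ((fdiff^[n] (diffKernelCoeff n ω) k * R ^ k : ℝ) : ℂ) *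
    (inner ℂ e ζ : ℂ) ^ k with hD
  set f : Cn n → ℝ≥0∞ := fun ζ => ENNReal.ofReal C₀ + ‖D ζ‖ₑ with hf
  set g : Cn n → ℝ≥0∞ := fun ζ => ‖1 - R * (inner ℂ e ζ : ℂ)‖ₑ⁻¹ ^ n with hg
  have hDm : AEMeasurable (fun ζ => ‖D ζ‖ₑ) μ := by
    have hp : ∀ N : ℕ, AEMeasurable (fun ζ : Cn n => ∑ k ∈ Finset.range N,
        ((fdiff^[n] (diffKernelCoeff n ω) k * R ^ k : ℝ) : ℂ) * (inner ℂ e ζ : ℂ) ^ k) μ :=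
      fun N => Measurable.aemeasurable (by fun_prop)
    refine (aemeasurable_of_tendsto_metrizable_ae Filter.atTop hp ?_).enorm
    filter_upwards [ae_norm_inner_le_one hn he] with ζ hζ
    have hw : ‖(R : ℂ) * (inner ℂ e ζ : ℂ)‖ < 1 := by
      rw [norm_mul, Complex.norm_real, Real.norm_of_nonneg hR0]
      nlinarith [norm_nonneg (inner ℂ e ζ : ℂ)]
    have hs := (hiter n _ hw).of_norm
    have hs' : Summable fun k => ((fdiff^[n] (diffKernelCoeff n ω) k * R ^ k : ℝ) : ℂ) *
        (inner ℂ e ζ : ℂ) ^ k := hs.congr fun k => by push_cast; ring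
    exact hs'.hasSum.tendsto_sum_nat
  have hgm : Measurable g := by fun_prop
  have hpt : ∀ᵐ ζ ∂μ, ‖diffKernelFun n ω (R * inner ℂ e ζ)‖ₑ ≤ (f * g) ζ := by
    filter_upwards [ae_norm_inner_le_one hn he] with ζ hζ
    set w : ℂ := (R : ℂ) * (inner ℂ e ζ : ℂ)
    have hw : ‖w‖ < 1 := by
      rw [norm_mul, Complex.norm_real, Real.norm_of_nonneg hR0]
      nlinarith [norm_nonneg (inner ℂ e ζ : ℂ)]
    have h3 := h0 w hw
    have hDw : D ζ = ∑' k, (fdiff^[n] (diffKernelCoeff n ω) k : ℂ) * w ^ k := by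
      rw [hD]
      refine tsum_congr fun k => ?_
      simp only [w]
      push_cast
      ring
    rw [← hDw] at h3
    have h5 : 1 - w ≠ 0 := by
      intro h'
      have : w = 1 := (sub_eq_zero.1 h').symm
      rw [this] at hw
      simp at hw
    have h6 : ‖1 - w‖ₑ ≠ 0 := by simpa using h5
    change _ ≤ (ENNReal.ofReal C₀ + ‖D ζ‖ₑ) * ‖1 - w‖ₑ⁻¹ ^ n
    rw [← ENNReal.inv_pow, ← div_eq_mul_inv, ENNReal.le_div_iff_mul_le (by simp [h6]) (by simp)]
    rw [← ofReal_norm (diffKernelFun n ω w), ← ofReal_norm (1 - w), ← ofReal_norm (D ζ),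
      ← ENNReal.ofReal_pow (norm_nonneg _), ← ENNReal.ofReal_mul (norm_nonneg _),
      ← ENNReal.ofReal_add hC₀ (norm_nonneg _)]
    refine ENNReal.ofReal_le_ofReal ?_
    rw [mul_comm]
    exact h3
  have hf2 : ∫⁻ ζ, f ζ ^ (2 : ℝ) ∂μ ≤ ENNReal.ofReal (K / (1 - R) ^ n / tail ω R ^ 2) := by
    have hsq : ∀ ζ, f ζ ^ (2 : ℝ) ≤ 2 * (ENNReal.ofReal (C₀ ^ 2) + ‖D ζ‖ₑ ^ 2) := fun ζ => by
      have := ENNReal.rpow_add_le_mul_rpow_add_rpow (ENNReal.ofReal C₀) ‖D ζ‖ₑ (p := 2) (by norm_num)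
      norm_num at this
      simp only [hf]
      rw [ENNReal.ofReal_pow hC₀]
      norm_num
      exact this
    have hDa : ∫⁻ ζ, ‖D ζ‖ₑ ^ 2 ∂μ ≤ ENNReal.ofReal (C₂ / (1 - R) ^ n / tail ω R ^ 2) := by
      refine (lintegral_sphere_tsum_le hn he (a := fun k =>
        ((fdiff^[n] (diffKernelCoeff n ω) k * R ^ k : ℝ) : ℂ)) ?_).trans ?_
      · have := hiter n (R : ℂ) (by rwa [Complex.norm_real, Real.norm_of_nonneg hR0])
        refine this.congr fun k => ?_
        push_cast; rfl
      · refine le_trans (le_of_eq ?_) (h2 R hR0 hR)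
        refine tsum_congr fun k => ?_
        rw [← ofReal_norm, ← ENNReal.ofReal_pow (norm_nonneg _), Complex.norm_real, Real.norm_eq_abs,
          sq_abs]
    calc ∫⁻ ζ, f ζ ^ (2 : ℝ) ∂μ ≤ ∫⁻ ζ, 2 * (ENNReal.ofReal (C₀ ^ 2) + ‖D ζ‖ₑ ^ 2) ∂μ :=
          lintegral_mono hsq
      _ = 2 * (ENNReal.ofReal (C₀ ^ 2) + ∫⁻ ζ, ‖D ζ‖ₑ ^ 2 ∂μ) := by
          rw [lintegral_const_mul' _ _ (by norm_num), lintegral_add_left measurable_const]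
          simp [μ]
      _ ≤ 2 * (ENNReal.ofReal (C₀ ^ 2 * tail ω 0 ^ 2 / (1 - R) ^ n / tail ω R ^ 2) +
            ENNReal.ofReal (C₂ / (1 - R) ^ n / tail ω R ^ 2)) := by
          gcongr
          rw [le_div_iff₀ (by positivity), le_div_iff₀ (by positivity)]
          have h3 : tail ω R ^ 2 ≤ tail ω 0 ^ 2 := by
            gcongr
            exact h.weight.tail_anti le_rfl hR0
          have h4 : (1 - R) ^ n ≤ 1 := pow_le_one₀ hR'.le (by linarith)
          calc C₀ ^ 2 * tail ω R ^ 2 * (1 - R) ^ n ≤ C₀ ^ 2 * tail ω 0 ^ 2 * 1 := by gcongr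
            _ = _ := mul_one _
      _ = _ := by
          rw [← ENNReal.ofReal_add (by positivity) (by positivity),
            show (2 : ℝ≥0∞) = ENNReal.ofReal 2 by simp, ← ENNReal.ofReal_mul (by norm_num)]
          congr 1
          rw [hK]; ring
  have hg2 : ∫⁻ ζ, g ζ ^ (2 : ℝ) ∂μ ≤ ENNReal.ofReal (1 / (1 - R) ^ n) := by
    have := lintegral_sphere_inv_one_sub_le hn he hR0 hR
    norm_num at this ⊢
    exact this
  calc ∫⁻ ζ, ‖diffKernelFun n ω (R * inner ℂ e ζ)‖ₑ ∂μ ≤ ∫⁻ ζ, (f * g) ζ ∂μ := lintegral_mono_ae hpt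
    _ ≤ (∫⁻ ζ, f ζ ^ (2 : ℝ) ∂μ) ^ (1 / (2 : ℝ)) * (∫⁻ ζ, g ζ ^ (2 : ℝ) ∂μ) ^ (1 / (2 : ℝ)) :=
        ENNReal.lintegral_mul_le_Lp_mul_Lq μ Real.HolderConjugate.two_two
          (hDm.const_add _) hgm.aemeasurable
    _ ≤ (ENNReal.ofReal (K / (1 - R) ^ n / tail ω R ^ 2)) ^ (1 / (2 : ℝ)) *
          (ENNReal.ofReal (1 / (1 - R) ^ n)) ^ (1 / (2 : ℝ)) := by gcongr
    _ = _ := by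
        rw [← ENNReal.mul_rpow_of_nonneg _ _ (by norm_num), ← ENNReal.ofReal_mul (by positivity),
          ENNReal.ofReal_rpow_of_nonneg (by positivity) (by norm_num), ← Real.sqrt_eq_rpow]
        congr 1
        have : K / (1 - R) ^ n / tail ω R ^ 2 * (1 / (1 - R) ^ n) =
            K * (1 / ((1 - R) ^ n * tail ω R)) ^ 2 := by field_simp
        rw [this, Real.sqrt_mul hK0, Real.sqrt_sq (by positivity)]
        field_simp

/-! ### From the differentiated kernel back to the kernel -/

theorem kernelCoeff_eq {n : ℕ} (hn : 1 ≤ n) {ω : ℝ → ℝ} (k : ℕ) :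
    kernelCoeff n ω k =
      diffKernelCoeff n ω k * ((1 / 2) * ∫ x in (0 : ℝ)..1, x ^ k * (1 - x) ^ (n - 1)) := by
  obtain ⟨m, rfl⟩ : ∃ m, n = m + 1 := ⟨n - 1, by omega⟩
  rw [integral_pow_mul_one_sub_pow, kernelCoeff, diffKernelCoeff, Nat.add_sub_cancel,
    Nat.cast_choose ℝ (show m + 1 ≤ k + (m + 1) by omega), Nat.add_sub_cancel,
    show k + m + 1 = k + (m + 1) by ring, Nat.factorial_succ m]
  have h1 : ((k + (m + 1)).factorial : ℝ) ≠ 0 := by positivity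
  have h2 : (k.factorial : ℝ) ≠ 0 := by positivity
  have h3 : (m.factorial : ℝ) ≠ 0 := by positivity
  have h4 : ((m : ℝ) + 1) ≠ 0 := by positivity
  push_cast
  field_simp

/-- The Beta integral ∫ x^k (1-x)^(n-1) dx is 1/n divided by the binomial coefficient (k+n choose
n), so averaging over dilations x undoes the differentiation coefficient by coefficient. -/
theorem IsClassD.kernelFun_eq_integral {n : ℕ} (hn : 1 ≤ n) {ω : ℝ → ℝ} (h : IsClassD ω) {w : ℂ}
    (hw : ‖w‖ < 1) :
    kernelFun n ω w = ∫ x in Ioc (0 : ℝ) 1,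
      ((1 / 2 * (1 - x) ^ (n - 1) : ℝ) : ℂ) * diffKernelFun n ω (x * w) := by
  obtain ⟨N, C, hC⟩ := h.exists_diffKernelCoeff_poly hn
  have hs := summable_poly_mul_pow hC hw
  have key := hasSum_integral_of_dominated_convergence (μ := volume.restrict (Ioc (0 : ℝ) 1))
    (F := fun k (x : ℝ) => ((1 / 2 * (1 - x) ^ (n - 1) : ℝ) : ℂ) *
      ((diffKernelCoeff n ω k : ℂ) * (x * w) ^ k))
    (f := fun x : ℝ => ((1 / 2 * (1 - x) ^ (n - 1) : ℝ) : ℂ) * diffKernelFun n ω (x * w))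
    (bound := fun k _ => ‖(diffKernelCoeff n ω k : ℂ) * w ^ k‖)
    (fun k => Continuous.aestronglyMeasurable (by fun_prop))
    (fun k => ?_) (ae_of_all _ fun _ => hs) (integrable_const _) ?_
  · refine (key.tsum_eq.symm.trans ?_).symm
    rw [kernelFun]
    refine tsum_congr fun k => ?_
    rw [kernelCoeff_eq hn, intervalIntegral.integral_of_le zero_le_one]
    have : (fun x : ℝ => ((1 / 2 * (1 - x) ^ (n - 1) : ℝ) : ℂ) *
        ((diffKernelCoeff n ω k : ℂ) * (x * w) ^ k)) =
        fun x : ℝ => ((diffKernelCoeff n ω k : ℂ) * (1 / 2) * w ^ k) *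
          ((x ^ k * (1 - x) ^ (n - 1) : ℝ) : ℂ) := by
      ext x
      push_cast
      ring
    rw [this, integral_const_mul, integral_complex_ofReal]
    push_cast
    ring
  · filter_upwards [ae_restrict_mem measurableSet_Ioc] with x hx
    have h1 : |1 / 2 * (1 - x) ^ (n - 1)| ≤ 1 := by
      rw [abs_of_nonneg (mul_nonneg (by norm_num) (pow_nonneg (by linarith [hx.2]) _))]
      have : (1 - x) ^ (n - 1) ≤ 1 := pow_le_one₀ (by linarith [hx.2]) (by linarith [hx.1])
      linarith
    have h2 : ‖((x : ℂ) * w) ^ k‖ ≤ ‖w ^ k‖ := by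
      rw [mul_pow, norm_mul, norm_pow (x : ℂ), Complex.norm_real, Real.norm_of_nonneg hx.1.le]
      exact mul_le_of_le_one_left (norm_nonneg _) (pow_le_one₀ hx.1.le hx.2)
    rw [norm_mul, Complex.norm_real, Real.norm_eq_abs, norm_mul, norm_mul]
    exact (mul_le_of_le_one_left (by positivity) h1).trans (by gcongr)
  · filter_upwards [ae_restrict_mem measurableSet_Ioc] with x hx
    have hxw : ‖(x : ℂ) * w‖ < 1 := by
      rw [norm_mul, Complex.norm_real, Real.norm_of_nonneg hx.1.le]
      nlinarith [norm_nonneg w, hx.2]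
    exact ((summable_poly_mul_pow hC hxw).of_norm.hasSum).mul_left _

theorem lintegral_rpow_neg_le {α : ℝ} (hα : 0 < α) {a : ℝ} (ha : 0 < a) :
    ∫⁻ x in Ioc (0 : ℝ) 1, ENNReal.ofReal (a ^ α * (a + 1 - x) ^ (-α - 1)) ≤
      ENNReal.ofReal (1 / α) := by
  have hpos : ∀ x ∈ Icc (0 : ℝ) 1, 0 < a + 1 - x := fun x hx => by linarith [hx.2]
  have hc : ContinuousOn (fun x : ℝ => a ^ α * (a + 1 - x) ^ (-α - 1)) (Icc 0 1) :=
    continuousOn_const.mul (ContinuousOn.rpow_const (by fun_prop) fun x hx => Or.inl (hpos x hx).ne')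
  have hi : IntervalIntegrable (fun x : ℝ => a ^ α * (a + 1 - x) ^ (-α - 1)) volume 0 1 :=
    ContinuousOn.intervalIntegrable (by rwa [uIcc_of_le zero_le_one])
  rw [← ofReal_integral_eq_lintegral_ofReal
    ((intervalIntegrable_iff_integrableOn_Ioc_of_le zero_le_one).1 hi)
    ((ae_restrict_mem measurableSet_Ioc).mono fun x hx => mul_nonneg (by positivity)
      (Real.rpow_nonneg (hpos x ⟨hx.1.le, hx.2⟩).le _)),
    ← intervalIntegral.integral_of_le zero_le_one]
  refine ENNReal.ofReal_le_ofReal ?_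
  rw [intervalIntegral.integral_eq_sub_of_hasDerivAt
    (f := fun x => a ^ α * ((a + 1 - x) ^ (-α) / α)) (fun x hx => ?_) hi]
  · have h1 : a + 1 - 1 = a := by ring
    rw [h1, Real.rpow_neg ha.le]
    have h2 : a ^ α * ((a ^ α)⁻¹ / α) = 1 / α := by
      have : a ^ α ≠ 0 := by positivity
      field_simp
    rw [h2]
    have : 0 ≤ a ^ α * ((a + 1 - 0) ^ (-α) / α) := by
      have : 0 < a + 1 - 0 := by linarith
      positivity
    linarith
  · rw [uIcc_of_le zero_le_one] at hx
    have h1 : HasDerivAt (fun x : ℝ => a + 1 - x) (-1) x := by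
      simpa using (hasDerivAt_id x).const_sub (a + 1)
    have h2 := ((h1.rpow_const (p := -α) (Or.inl (hpos x hx).ne')).div_const α).const_mul (a ^ α)
    refine h2.congr_deriv ?_
    field_simp

/-- This is where reverse doubling enters the kernel estimate. It bounds 1/ω̂(ρx) by a multiple of
((1-ρ)/(1-ρx))^α / ω̂(ρ), and the extra power α > 0 prevents a logarithm. Since (1-ρ) + (1-x) ≤
2(1-ρx), the integral reduces to an explicit one. -/
theorem IsClassD.exists_lintegral_inv_tail_le {ω : ℝ → ℝ} (h : IsClassD ω) :
    ∃ C : ℝ, 0 < C ∧ ∀ ρ ∈ Ico (0 : ℝ) 1,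
      ∫⁻ x in Ioc (0 : ℝ) 1, ENNReal.ofReal (1 / (1 - ρ * x) / tail ω (ρ * x)) ≤
        ENNReal.ofReal (C / tail ω ρ) := by
  obtain ⟨α, hα, C, hC, hT⟩ := h.exists_tail_mul_rpow_le
  refine ⟨C * 2 ^ (α + 1) * (1 / α), by positivity, fun ρ hρ => ?_⟩
  have hρT := h.weight.tail_pos hρ
  have ha : 0 < 1 - ρ := by linarith [hρ.2]
  calc ∫⁻ x in Ioc (0 : ℝ) 1, ENNReal.ofReal (1 / (1 - ρ * x) / tail ω (ρ * x))
      ≤ ∫⁻ x in Ioc (0 : ℝ) 1, ENNReal.ofReal (C * 2 ^ (α + 1) / tail ω ρ) *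
          ENNReal.ofReal ((1 - ρ) ^ α * ((1 - ρ) + 1 - x) ^ (-α - 1)) := by
        refine setLIntegral_mono' measurableSet_Ioc fun x hx => ?_
        rw [← ENNReal.ofReal_mul (by positivity)]
        refine ENNReal.ofReal_le_ofReal ?_
        have hx0 := hx.1
        have hx1 := hx.2
        have hρx : ρ * x ≤ ρ := mul_le_of_le_one_right hρ.1 hx1
        have hρx0 : 0 ≤ ρ * x := mul_nonneg hρ.1 hx0.le
        have hρx1 : ρ * x ≤ x := mul_le_of_le_one_left hx0.le hρ.2.le
        have hy : 0 < 1 - ρ * x := by linarith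
        have hTx := h.weight.tail_pos ⟨hρx0, lt_of_le_of_lt hρx hρ.2⟩
        have h1 := hT (ρ * x) ρ hρx0 hρx hρ.2
        have h2 : (1 - ρ + 1 - x) ≤ 2 * (1 - ρ * x) := by linarith
        have h3 : 0 < 1 - ρ + 1 - x := by linarith
        have h4 : (1 - ρ + 1 - x) ^ (α + 1) ≤ 2 ^ (α + 1) * (1 - ρ * x) ^ (α + 1) := by
          rw [← Real.mul_rpow (by norm_num) hy.le]
          exact Real.rpow_le_rpow h3.le h2 (by positivity)
        rw [show -α - 1 = -(α + 1) by ring, Real.rpow_neg h3.le, div_div, div_mul_eq_mul_div,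
          div_le_div_iff₀ (by positivity) hρT, one_mul]
        have h5 : (1 - ρ * x) ^ (α + 1) = (1 - ρ * x) ^ α * (1 - ρ * x) := by
          rw [Real.rpow_add hy, Real.rpow_one]
        have h6 : 0 < (1 - ρ + 1 - x) ^ (α + 1) := by positivity
        have h7 : 1 ≤ 2 ^ (α + 1) * ((1 - ρ * x) ^ α * (1 - ρ * x)) *
            ((1 - ρ + 1 - x) ^ (α + 1))⁻¹ := by
          rw [← h5, ← div_eq_mul_inv, one_le_div h6]
          exact h4
        have h8 : 0 < (1 - ρ * x) ^ α := by positivity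
        have h9 : tail ω ρ ≤ C * (1 - ρ) ^ α * tail ω (ρ * x) / (1 - ρ * x) ^ α := by
          rw [le_div_iff₀ h8]; exact h1
        calc tail ω ρ ≤ C * (1 - ρ) ^ α * tail ω (ρ * x) / (1 - ρ * x) ^ α * 1 := by
              rw [mul_one]; exact h9
          _ ≤ C * (1 - ρ) ^ α * tail ω (ρ * x) / (1 - ρ * x) ^ α *
              (2 ^ (α + 1) * ((1 - ρ * x) ^ α * (1 - ρ * x)) *
            ((1 - ρ + 1 - x) ^ (α + 1))⁻¹) := by gcongr
          _ = _ := by field_simp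
    _ ≤ ENNReal.ofReal (C * 2 ^ (α + 1) / tail ω ρ) * ENNReal.ofReal (1 / α) := by
        rw [lintegral_const_mul' _ _ ENNReal.ofReal_ne_top]
        gcongr
        exact lintegral_rpow_neg_le hα ha
    _ = _ := by
        rw [← ENNReal.ofReal_mul (by positivity)]
        congr 1
        ring

/-- In the dilation formula (1-x)^(n-1) ≤ (1-ρx)^(n-1) cancels all but one factor of (1-ρx)^(-n),
which leaves the integral bounded just before. -/
theorem IsClassD.exists_lintegral_sphere_kernelFun_le {n : ℕ} (hn : 1 ≤ n) {ω : ℝ → ℝ}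
    (h : IsClassD ω) :
    ∃ C : ℝ, 0 < C ∧ ∀ ρ ∈ Ico (0 : ℝ) 1, ∀ e : Cn n, ‖e‖ = 1 →
      ∫⁻ ζ, ‖kernelFun n ω (ρ * inner ℂ e ζ)‖ₑ ∂(sphereMeasure n) ≤
        ENNReal.ofReal (C / tail ω ρ) := by
  obtain ⟨C₁, hC₁, h1⟩ := h.exists_lintegral_diffKernel_le hn
  obtain ⟨C₂, hC₂, h2⟩ := h.exists_lintegral_inv_tail_le
  refine ⟨(C₁ + 1) * C₂, by positivity, fun ρ hρ e he => ?_⟩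
  set μ := sphereMeasure n
  -- The cut-off makes the integrand jointly Borel on the whole product, as Tonelli's theorem
  -- requires.
  set D : ℂ → ℂ := (Metric.ball (0 : ℂ) 1).indicator (diffKernelFun n ω) with hD
  have hDm : Measurable D := by
    classical
    have := (h.continuousOn_diffKernelFun hn).measurable_piecewise (g := (0 : ℂ → ℂ))
      continuousOn_const Metric.isOpen_ball.measurableSet
    rwa [Set.piecewise_eq_indicator] at this
  have hρT := h.weight.tail_pos hρ
  calc ∫⁻ ζ, ‖kernelFun n ω (ρ * inner ℂ e ζ)‖ₑ ∂μ
      ≤ ∫⁻ ζ, (∫⁻ x in Ioc (0 : ℝ) 1, ENNReal.ofReal ((1 - x) ^ (n - 1)) *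
          ‖D (x * (ρ * inner ℂ e ζ))‖ₑ) ∂μ := by
        refine lintegral_mono_ae ?_
        filter_upwards [ae_norm_inner_le_one hn he] with ζ hζ
        have hw : ‖(ρ : ℂ) * (inner ℂ e ζ : ℂ)‖ < 1 := by
          rw [norm_mul, Complex.norm_real, Real.norm_of_nonneg hρ.1]
          nlinarith [norm_nonneg (inner ℂ e ζ : ℂ), hρ.1, hρ.2]
        rw [h.kernelFun_eq_integral hn hw]
        refine (enorm_integral_le_lintegral_enorm _).trans
          (setLIntegral_mono' measurableSet_Ioc fun x hx => ?_)
        have hxw : (x : ℂ) * (ρ * (inner ℂ e ζ : ℂ)) ∈ Metric.ball (0 : ℂ) 1 := by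
          rw [mem_ball_zero_iff, norm_mul, Complex.norm_real, Real.norm_of_nonneg hx.1.le]
          nlinarith [norm_nonneg ((ρ : ℂ) * (inner ℂ e ζ : ℂ)), hx.2]
        rw [hD, indicator_of_mem hxw, enorm_mul]
        gcongr
        have h0 : 0 ≤ (1 - x) ^ (n - 1) := pow_nonneg (by linarith [hx.2]) _
        rw [← ofReal_norm, Complex.norm_real, Real.norm_of_nonneg (by positivity)]
        exact ENNReal.ofReal_le_ofReal (by linarith)
    _ = ∫⁻ x in Ioc (0 : ℝ) 1, ∫⁻ ζ, ENNReal.ofReal ((1 - x) ^ (n - 1)) *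
          ‖D (x * (ρ * inner ℂ e ζ))‖ₑ ∂μ := by
        refine lintegral_lintegral_swap (Measurable.aemeasurable ?_)
        change Measurable fun z : Cn n × ℝ => ENNReal.ofReal ((1 - z.2) ^ (n - 1)) *
          ‖D (z.2 * (ρ * inner ℂ e z.1))‖ₑ
        have : Measurable fun z : Cn n × ℝ => (z.2 : ℂ) * (ρ * inner ℂ e z.1) := by
          have : Continuous fun z : Cn n × ℝ => (z.2 : ℂ) * (ρ * inner ℂ e z.1) := by fun_prop
          exact this.measurable
        exact Measurable.mul (by fun_prop) (hDm.comp this).enorm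
    _ ≤ ∫⁻ x in Ioc (0 : ℝ) 1, ENNReal.ofReal (C₁ + 1) *
          ENNReal.ofReal (1 / (1 - ρ * x) / tail ω (ρ * x)) := by
        refine setLIntegral_mono' measurableSet_Ioc fun x hx => ?_
        have hρx : ρ * x ≤ ρ := mul_le_of_le_one_right hρ.1 hx.2
        have hρx0 : 0 ≤ ρ * x := mul_nonneg hρ.1 hx.1.le
        have hρx1 : ρ * x ≤ x := mul_le_of_le_one_left hx.1.le hρ.2.le
        have hlt : ρ * x < 1 := lt_of_le_of_lt hρx hρ.2
        have hTx := h.weight.tail_pos ⟨hρx0, hlt⟩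
        have hy : 0 < 1 - ρ * x := by linarith
        rw [lintegral_const_mul' _ _ ENNReal.ofReal_ne_top]
        calc ENNReal.ofReal ((1 - x) ^ (n - 1)) * ∫⁻ ζ, ‖D (x * (ρ * inner ℂ e ζ))‖ₑ ∂μ
            ≤ ENNReal.ofReal ((1 - ρ * x) ^ (n - 1)) *
              ∫⁻ ζ, ‖diffKernelFun n ω ((ρ * x : ℝ) * inner ℂ e ζ)‖ₑ ∂μ := by
              gcongr with ζ
              · linarith [hx.2]
              · rw [show (x : ℂ) * (ρ * (inner ℂ e ζ : ℂ)) = ((ρ * x : ℝ) : ℂ) * inner ℂ e ζ by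
                  push_cast; ring]
                exact enorm_indicator_le_enorm_self _ _
          _ ≤ ENNReal.ofReal ((1 - ρ * x) ^ (n - 1)) *
              ENNReal.ofReal (C₁ / (1 - ρ * x) ^ n / tail ω (ρ * x)) := by
              gcongr
              exact h1 _ hρx0 hlt e he
          _ ≤ _ := by
              rw [← ENNReal.ofReal_mul (by positivity), ← ENNReal.ofReal_mul (by positivity)]
              refine ENNReal.ofReal_le_ofReal ?_
              obtain ⟨m, rfl⟩ : ∃ m, n = m + 1 := ⟨n - 1, by omega⟩
              rw [Nat.add_sub_cancel, pow_succ]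
              calc _ = C₁ * (1 / (1 - ρ * x) / tail ω (ρ * x)) := by field_simp
                _ ≤ _ := by gcongr; linarith
    _ ≤ ENNReal.ofReal (C₁ + 1) * ENNReal.ofReal (C₂ / tail ω ρ) := by
        rw [lintegral_const_mul' _ _ ENNReal.ofReal_ne_top]
        gcongr
        exact h2 ρ hρ
    _ = _ := by
        rw [← ENNReal.ofReal_mul (by positivity)]
        congr 1
        ring

/-! ### Almost everywhere modifications of the weights -/

theorem tail_congr {ω ω' : ℝ → ℝ} (hω : ω =ᵐ[volume.restrict (Ico 0 1)] ω') {r : ℝ} (hr : 0 ≤ r) :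
    tail ω r = tail ω' r :=
  integral_congr_ae (ae_restrict_of_ae_restrict_of_subset (Ico_subset_Ico_left hr) hω)

/-- By polar coordinates a null set of radii sweeps out a null set of the ball. Hence the measures,
the operators and both suprema depend only on the almost everywhere classes of the weights. -/
theorem ae_normalizedVolume_comp_norm {n : ℕ} (hn : 1 ≤ n) {P : ℝ → Prop}
    (hP : ∀ᵐ r ∂(volume.restrict (Ico (0 : ℝ) 1)), P r) :
    ∀ᵐ z ∂(normalizedVolume n), P ‖z‖ := by
  obtain ⟨N, hN, hNm, hN0⟩ := exists_measurable_superset_of_null (ae_iff.1 hP)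
  suffices h : ∀ᵐ z ∂(normalizedVolume n), ‖z‖ ∉ N by
    filter_upwards [h] with z hz
    by_contra h'
    exact hz (hN h')
  have hm : MeasurableSet {z : Cn n | ‖z‖ ∈ N} := measurable_norm hNm
  rw [ae_iff]
  simp only [not_not]
  rw [← lintegral_indicator_one hm, lintegral_normalizedVolume hn (measurable_one.indicator hm)]
  have h0 : ∀ᵐ r ∂(volume.restrict (Ico (0 : ℝ) 1)), r ∉ N := by
    rw [ae_iff]; simpa using hN0
  refine mul_eq_zero_of_right _ ?_
  refine (lintegral_congr_ae ?_).trans lintegral_zero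
  filter_upwards [h0, ae_restrict_mem measurableSet_Ico] with r hr hr'
  refine mul_eq_zero_of_right _ ((lintegral_congr_ae ?_).trans lintegral_zero)
  filter_upwards [ae_norm_eq_one hn] with ζ hζ
  have : ‖r • ζ‖ = r := by rw [norm_smul, hζ, mul_one, Real.norm_of_nonneg hr'.1]
  rw [indicator_of_notMem]
  simpa [this] using hr

theorem weightedVolume_congr {n : ℕ} (hn : 1 ≤ n) {ω ω' : ℝ → ℝ}
    (hω : ω =ᵐ[volume.restrict (Ico 0 1)] ω') : weightedVolume n ω = weightedVolume n ω' :=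
  withDensity_congr_ae ((ae_normalizedVolume_comp_norm hn hω).mono fun z hz => by simp only [hz])

theorem bergmanKernel_congr {n : ℕ} {ω ω' : ℝ → ℝ} (h : weightedVolume n ω = weightedVolume n ω') :
    bergmanKernel n ω = bergmanKernel n ω' := by
  unfold bergmanKernel IsReproducingAt MemBergmanTwo
  rw [h]

theorem bergmanProj_congr {n : ℕ} {ω ω' : ℝ → ℝ} (h : weightedVolume n ω = weightedVolume n ω') :
    bergmanProj n ω = bergmanProj n ω' := by
  unfold bergmanProj
  rw [h, bergmanKernel_congr h]

theorem maxBergmanProj_congr {n : ℕ} {ω ω' : ℝ → ℝ} (h : weightedVolume n ω = weightedVolume n ω') :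
    maxBergmanProj n ω = maxBergmanProj n ω' := by
  unfold maxBergmanProj
  rw [h, bergmanKernel_congr h]

theorem isBoundedOnLp_congr {n : ℕ} {ω ω' υ υ' : ℝ → ℝ} {p : ℝ}
    (h : weightedVolume n ω = weightedVolume n ω') (h' : weightedVolume n υ = weightedVolume n υ') :
    IsBoundedOnLp n ω υ p = IsBoundedOnLp n ω' υ' p := by
  unfold IsBoundedOnLp
  rw [h, h']

theorem dualTail_congr {n : ℕ} {q : ℝ} {ω ω' υ υ' : ℝ → ℝ}
    (hω : ω =ᵐ[volume.restrict (Ico 0 1)] ω') (hυ : υ =ᵐ[volume.restrict (Ico 0 1)] υ')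
    {r : ℝ} (hr : 0 ≤ r) : dualTail n q ω υ r = dualTail n q ω' υ' r := by
  refine lintegral_congr_ae (ae_restrict_of_ae_restrict_of_subset (Ico_subset_Ico_left hr) ?_)
  filter_upwards [hω, hυ] with s h1 h2
  rw [h1, h2]

theorem quantityM_congr {n : ℕ} {p q : ℝ} {ω ω' υ υ' : ℝ → ℝ}
    (hω : ω =ᵐ[volume.restrict (Ico 0 1)] ω') (hυ : υ =ᵐ[volume.restrict (Ico 0 1)] υ') :
    quantityM n p q ω υ = quantityM n p q ω' υ' :=
  iSup_congr fun r => iSup_congr fun hr => by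
    rw [tail_congr hω hr.1, tail_congr hυ hr.1, dualTail_congr hω hυ hr.1]

theorem quantityN_congr {n : ℕ} {p q : ℝ} {ω ω' υ υ' : ℝ → ℝ}
    (hω : ω =ᵐ[volume.restrict (Ico 0 1)] ω') (hυ : υ =ᵐ[volume.restrict (Ico 0 1)] υ') :
    quantityN n p q ω υ = quantityN n p q ω' υ' :=
  iSup_congr fun r => iSup_congr fun hr => by
    rw [dualTail_congr hω hυ hr.1]
    congr 3
    refine lintegral_congr_ae ?_
    filter_upwards [ae_restrict_of_ae_restrict_of_subset (Ico_subset_Ico_right hr.2.le) hυ,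
      ae_restrict_mem measurableSet_Ico] with s h1 h2
    rw [h1, tail_congr hω h2.1]

/-- A weight of class `𝒟` agrees almost everywhere with a Borel measurable weight of class `𝒟`
that is positive on the whole line. -/
theorem IsClassD.exists_measurable {ω : ℝ → ℝ} (h : IsClassD ω) :
    ∃ ω' : ℝ → ℝ, ω =ᵐ[volume.restrict (Ico 0 1)] ω' ∧ Measurable ω' ∧ (∀ t, 0 < ω' t) ∧
      IsClassD ω' := by
  have hg := h.weight.integrable.aestronglyMeasurable
  set g := hg.mk ω
  have hgm : Measurable g := hg.stronglyMeasurable_mk.measurable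
  set ω' : ℝ → ℝ := fun t => if 0 < g t then g t else 1 with hω'
  have hpos : ∀ t, 0 < ω' t := fun t => by
    simp only [hω']
    split_ifs with h1
    exacts [h1, one_pos]
  have hae : ω =ᵐ[volume.restrict (Ico 0 1)] ω' := by
    filter_upwards [hg.ae_eq_mk, ae_restrict_mem measurableSet_Ico] with t ht ht'
    have hgt : ω t = g t := ht
    have : 0 < g t := hgt ▸ h.weight.pos t ht'
    simp only [hω', if_pos this, hgt]
  refine ⟨ω', hae, Measurable.ite (measurableSet_lt measurable_const hgm) hgm measurable_const, hpos,
    ⟨fun t _ => hpos t, h.weight.integrable.congr hae⟩, ?_, ?_⟩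
  · obtain ⟨C, hC, h1⟩ := h.doubling
    refine ⟨C, hC, fun r hr => ?_⟩
    rw [← tail_congr hae hr.1, ← tail_congr hae (by linarith [hr.1] : 0 ≤ (1 + r) / 2)]
    exact h1 r hr
  · obtain ⟨K, hK, C, hC, h1⟩ := h.reverseDoubling
    refine ⟨K, hK, C, hC, fun t ht => ?_⟩
    have h2 : (1 - t) / K ≤ 1 := by
      rw [div_le_one (by linarith)]
      linarith [ht.1]
    rw [← tail_congr hae ht.1.le, ← tail_congr hae (by linarith : 0 ≤ 1 - (1 - t) / K)]
    exact h1 t ht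

/-! ### The dual weight on a geometric grid -/

/-- The points `1 - Q⁻ʲ`. -/
noncomputable def grid (Q : ℝ) (j : ℕ) : ℝ := 1 - (Q ^ j)⁻¹

theorem grid_zero (Q : ℝ) : grid Q 0 = 0 := by simp [grid]

theorem grid_succ (Q : ℝ) (j : ℕ) : grid Q (j + 1) = 1 - (1 - grid Q j) / Q := by
  simp only [grid, pow_succ, mul_inv]
  ring

theorem grid_mem {Q : ℝ} (hQ : 1 < Q) (j : ℕ) : grid Q j ∈ Ico (0 : ℝ) 1 := by
  have h0 : 0 < Q ^ j := by positivity
  have h1 : (Q ^ j)⁻¹ ≤ 1 := inv_le_one_of_one_le₀ (one_le_pow₀ hQ.le)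
  have h2 : 0 < (Q ^ j)⁻¹ := by positivity
  exact ⟨by unfold grid; linarith, by unfold grid; linarith⟩

theorem grid_strictMono {Q : ℝ} (hQ : 1 < Q) : StrictMono (grid Q) := fun i j hij => by
  have h0 : 0 < Q ^ i := by positivity
  have := inv_strictAnti₀ h0 (pow_lt_pow_right₀ hQ hij)
  unfold grid
  linarith

theorem exists_mem_Ico_grid {Q : ℝ} (hQ : 1 < Q) {s : ℝ} (hs : s ∈ Ico (0 : ℝ) 1) :
    ∃ j, s ∈ Ico (grid Q j) (grid Q (j + 1)) := by
  have h1 : 0 < 1 - s := by linarith [hs.2]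
  obtain ⟨j, hj1, hj2⟩ := exists_nat_pow_near (x := (1 - s)⁻¹)
    (by rw [one_le_inv₀ h1]; linarith [hs.1]) hQ
  refine ⟨j, ?_, ?_⟩
  · have : 1 - s ≤ (Q ^ j)⁻¹ := by rwa [le_inv_comm₀ h1 (by positivity)]
    unfold grid
    linarith
  · have : (Q ^ (j + 1))⁻¹ < 1 - s := by rwa [inv_lt_comm₀ (by positivity) h1]
    unfold grid
    linarith

theorem iUnion_Ico_grid {Q : ℝ} (hQ : 1 < Q) :
    ⋃ j, Ico (grid Q j) (grid Q (j + 1)) = Ico (0 : ℝ) 1 := by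
  ext s
  rw [mem_iUnion]
  exact ⟨fun ⟨j, hj⟩ => ⟨(grid_mem hQ j).1.trans hj.1, hj.2.trans (grid_mem hQ _).2⟩,
    exists_mem_Ico_grid hQ⟩

theorem pairwise_disjoint_Ico_grid {Q : ℝ} (hQ : 1 < Q) :
    Pairwise (Function.onFun Disjoint fun j => Ico (grid Q j) (grid Q (j + 1))) :=
  (grid_strictMono hQ).monotone.pairwise_disjoint_on_Ico_succ

theorem measurable_dualDensity {n : ℕ} {q : ℝ} {ω υ : ℝ → ℝ} (hω : Measurable ω)
    (hυ : Measurable υ) :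
    Measurable fun s => ENNReal.ofReal (ω s ^ q / υ s ^ (q - 1) * s ^ (2 * n - 1)) := by
  fun_prop

theorem dualTail_eq_add {n : ℕ} {q : ℝ} {ω υ : ℝ → ℝ} {r s : ℝ} (hrs : r ≤ s) (hs : s ≤ 1) :
    dualTail n q ω υ r = (∫⁻ t in Ico r s,
      ENNReal.ofReal (ω t ^ q / υ t ^ (q - 1) * t ^ (2 * n - 1))) + dualTail n q ω υ s := by
  unfold dualTail
  rw [← Ico_union_Ico_eq_Ico hrs hs, lintegral_union measurableSet_Ico Ico_disjoint_Ico_same]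

theorem dualTail_anti {n : ℕ} {q : ℝ} {ω υ : ℝ → ℝ} {r s : ℝ} (hrs : r ≤ s) :
    dualTail n q ω υ s ≤ dualTail n q ω υ r :=
  lintegral_mono_set (Ico_subset_Ico_left hrs)

theorem lintegral_dualDensity_pos {n : ℕ} {q : ℝ} {ω υ : ℝ → ℝ} (hω : Measurable ω)
    (hυ : Measurable υ) (hω0 : ∀ t, 0 < ω t) (hυ0 : ∀ t, 0 < υ t) {r s : ℝ} (hr : 0 ≤ r)
    (hrs : r < s) :
    0 < ∫⁻ t in Ico r s, ENNReal.ofReal (ω t ^ q / υ t ^ (q - 1) * t ^ (2 * n - 1)) := by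
  rw [setLIntegral_pos_iff (measurable_dualDensity hω hυ)]
  have : Ioo r s ⊆ (Function.support fun t =>
      ENNReal.ofReal (ω t ^ q / υ t ^ (q - 1) * t ^ (2 * n - 1))) ∩ Ico r s := fun t ht => by
    refine ⟨?_, Ioo_subset_Ico_self ht⟩
    have h1 := hω0 t
    have h2 := hυ0 t
    have h3 : 0 < t := hr.trans_lt ht.1
    rw [Function.mem_support, Ne, ENNReal.ofReal_eq_zero, not_le]
    positivity
  refine lt_of_lt_of_le ?_ (measure_mono this)
  rw [Real.volume_Ioo, ENNReal.ofReal_pos]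
  linarith

theorem dualTail_pos {n : ℕ} {q : ℝ} {ω υ : ℝ → ℝ} (hω : Measurable ω)
    (hυ : Measurable υ) (hω0 : ∀ t, 0 < ω t) (hυ0 : ∀ t, 0 < υ t) {r : ℝ}
    (hr : r ∈ Ico (0 : ℝ) 1) : 0 < dualTail n q ω υ r :=
  lintegral_dualDensity_pos hω hυ hω0 hυ0 hr.1 hr.2

theorem rpow_mul_rpow_dual {p q : ℝ} (hpq : p.HolderConjugate q) {a b : ℝ} (ha : 0 < a) (hb : 0 < b) :
    (a ^ q / b ^ (q - 1)) ^ (1 / q) * b ^ (1 / p) = a := by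
  have hq := hpq.symm.pos
  have h1 : (q - 1) * (1 / q) = 1 / p := by
    rw [one_div p, ← hpq.symm.one_sub_inv]
    field_simp
  rw [Real.div_rpow (by positivity) (by positivity), ← Real.rpow_mul ha.le, ← Real.rpow_mul hb.le, h1,
    mul_one_div_cancel hq.ne', Real.rpow_one]
  have : b ^ (1 / p) ≠ 0 := by positivity
  field_simp

/-- Hölder's inequality for `ω = (ω^q / υ^(q-1))^(1/q) υ^(1/p)` on `[r, s)`. -/
theorem pow_mul_tail_sub_le {n : ℕ} {p q : ℝ} (hpq : p.HolderConjugate q) {ω υ : ℝ → ℝ}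
    (hω : Measurable ω) (hυ : Measurable υ) (hω0 : ∀ t, 0 < ω t) (hυ0 : ∀ t, 0 < υ t)
    (hωw : IsRadialWeight ω) (hυw : IsRadialWeight υ) {r s : ℝ} (hr : 0 ≤ r) (hrs : r ≤ s) (hs : s < 1)
    (hfin : dualTail n q ω υ r ≠ ∞) :
    r ^ (2 * n - 1) * (tail ω r - tail ω s) ≤
      ((dualTail n q ω υ r).toReal - (dualTail n q ω υ s).toReal) ^ (1 / q) * tail υ r ^ (1 / p) := by
  have hq := hpq.symm.pos
  have hp := hpq.pos
  have hr1 : r < 1 := hrs.trans_lt hs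
  have hs0 : 0 ≤ s := hr.trans hrs
  have hfs : dualTail n q ω υ s ≠ ∞ := ne_top_of_le_ne_top hfin (dualTail_anti hrs)
  set I := ∫⁻ t in Ico r s, ENNReal.ofReal (ω t ^ q / υ t ^ (q - 1) * t ^ (2 * n - 1)) with hI
  have hsplit : dualTail n q ω υ r = I + dualTail n q ω υ s := dualTail_eq_add hrs hs.le
  have hIfin : I ≠ ∞ := ne_top_of_le_ne_top hfin (hsplit ▸ le_self_add)
  have hIr : (dualTail n q ω υ r).toReal - (dualTail n q ω υ s).toReal = I.toReal := by
    rw [hsplit, ENNReal.toReal_add hIfin hfs]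
    ring
  rw [hIr]
  have htail := hυw.tail_pos ⟨hr, hr1⟩
  rw [← ENNReal.ofReal_le_ofReal_iff (by positivity), ENNReal.ofReal_mul (by positivity),
    ENNReal.ofReal_mul (by positivity),
    ← ENNReal.ofReal_rpow_of_nonneg ENNReal.toReal_nonneg (by positivity), ENNReal.ofReal_toReal hIfin,
    ← ENNReal.ofReal_rpow_of_nonneg htail.le (by positivity), hυw.ofReal_tail hr]
  have h1 : tail ω r - tail ω s = ∫ t in Ico r s, ω t := by
    rw [hωw.tail_eq_add hr hrs hs.le]; ring
  rw [h1, ofReal_integral_eq_lintegral_ofReal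
    ((hωw.integrableOn_Ico hr).mono_set (Ico_subset_Ico_right hs.le))
    (ae_of_all _ fun t => (hω0 t).le), ← lintegral_const_mul' _ _ ENNReal.ofReal_ne_top]
  set f : ℝ → ℝ≥0∞ := fun t =>
    ENNReal.ofReal (ω t ^ q / υ t ^ (q - 1) * t ^ (2 * n - 1)) ^ (1 / q) with hf
  set g : ℝ → ℝ≥0∞ := fun t => ENNReal.ofReal (υ t) ^ (1 / p) with hg
  calc ∫⁻ t in Ico r s, ENNReal.ofReal (r ^ (2 * n - 1)) * ENNReal.ofReal (ω t)
      ≤ ∫⁻ t in Ico r s, (f * g) t := by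
        refine setLIntegral_mono' measurableSet_Ico fun t ht => ?_
        have h2 := hω0 t
        have h3 := hυ0 t
        have ht0 : 0 ≤ t := hr.trans ht.1
        change _ ≤ ENNReal.ofReal _ ^ (1 / q) * ENNReal.ofReal _ ^ (1 / p)
        rw [ENNReal.ofReal_rpow_of_nonneg (by positivity) (by positivity),
          ENNReal.ofReal_rpow_of_nonneg (by positivity) (by positivity),
          ← ENNReal.ofReal_mul (by positivity), ← ENNReal.ofReal_mul (by positivity)]
        refine ENNReal.ofReal_le_ofReal ?_
        rw [Real.mul_rpow (by positivity) (by positivity), mul_right_comm,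
          rpow_mul_rpow_dual hpq h2 h3, mul_comm]
        gcongr
        -- Only the power 1/q of the Jacobian comes out of the dual density; as r ≤ 1 and 1/q ≤ 1,
        -- it still dominates r^(2n-1).
        calc r ^ (2 * n - 1) ≤ (r ^ (2 * n - 1)) ^ (1 / q) := by
              refine Real.self_le_rpow_of_le_one (by positivity) (pow_le_one₀ hr hr1.le) ?_
              rw [div_le_one hq]
              exact hpq.symm.lt.le
          _ ≤ _ := by
              gcongr
              exact ht.1
    _ ≤ (∫⁻ t in Ico r s, f t ^ q) ^ (1 / q) * (∫⁻ t in Ico r s, g t ^ p) ^ (1 / p) :=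
        ENNReal.lintegral_mul_le_Lp_mul_Lq _ hpq.symm
          (Measurable.aemeasurable (by fun_prop)) (Measurable.aemeasurable (by fun_prop))
    _ ≤ _ := by
        have e1 : ∀ a : ℝ≥0∞, (a ^ (1 / q)) ^ q = a := fun a => by
          rw [← ENNReal.rpow_mul, one_div_mul_cancel hq.ne', ENNReal.rpow_one]
        have e2 : ∀ a : ℝ≥0∞, (a ^ (1 / p)) ^ p = a := fun a => by
          rw [← ENNReal.rpow_mul, one_div_mul_cancel hp.ne', ENNReal.rpow_one]
        simp only [hf, hg, e1, e2]
        gcongr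

/-- The factor in front of the dual tail is positive, so finiteness of the supremum forces the dual
tail to be finite at every r, including r = 0. -/
theorem quantityM_bound {n : ℕ} {p q : ℝ} (hpq : p.HolderConjugate q) {ω υ : ℝ → ℝ}
    (hωw : IsRadialWeight ω) (hυw : IsRadialWeight υ) (hM : quantityM n p q ω υ < ∞) :
    (∀ r ∈ Ico (0 : ℝ) 1, dualTail n q ω υ r ≠ ∞) ∧ ∃ M : ℝ, 0 < M ∧ ∀ r ∈ Ico (0 : ℝ) 1,
      tail υ r ^ (1 / p) * (dualTail n q ω υ r).toReal ^ (1 / q) ≤ M * tail ω r := by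
  have hq := hpq.symm.pos
  have key : ∀ r ∈ Ico (0 : ℝ) 1, ENNReal.ofReal (tail υ r ^ (1 / p) / tail ω r) *
      dualTail n q ω υ r ^ (1 / q) ≤ quantityM n p q ω υ := fun r hr =>
    le_iSup₂_of_le (f := fun r (_ : r ∈ Ico (0 : ℝ) 1) =>
      ENNReal.ofReal (tail υ r ^ (1 / p) / tail ω r) * dualTail n q ω υ r ^ (1 / q)) r hr le_rfl
  have hpos : ∀ r ∈ Ico (0 : ℝ) 1, 0 < tail υ r ^ (1 / p) / tail ω r := fun r hr => by
    have h1 := hωw.tail_pos hr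
    have h2 := hυw.tail_pos hr
    positivity
  have hfin : ∀ r ∈ Ico (0 : ℝ) 1, dualTail n q ω υ r ≠ ∞ := fun r hr h => by
    have := key r hr
    rw [h, ENNReal.top_rpow_of_pos (by positivity),
      ENNReal.mul_top (ENNReal.ofReal_pos.2 (hpos r hr)).ne', top_le_iff] at this
    exact hM.ne this
  refine ⟨hfin, (quantityM n p q ω υ).toReal + 1, by positivity, fun r hr => ?_⟩
  have h1 := hωw.tail_pos hr
  have h2 := ENNReal.toReal_mono hM.ne (key r hr)
  rw [ENNReal.toReal_mul, ENNReal.toReal_ofReal (hpos r hr).le, ← ENNReal.toReal_rpow,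
    div_mul_eq_mul_div, div_le_iff₀ h1] at h2
  refine h2.trans ?_
  gcongr
  linarith

/-- The decay of the dual tail D is the point; nothing of the kind is assumed. On a shell [r, s)
Hölder bounds ω̂(r) - ω̂(s) by a multiple of (D(r) - D(s))^(1/q) υ̂(r)^(1/p). Reverse doubling and
(iii) bound it below by a multiple of υ̂(r)^(1/p) D(r)^(1/q). Cancelling υ̂ gives D(r) - D(s) ≥ η
D(r). -/
theorem exists_grid_decay {n : ℕ} {p q : ℝ} (hpq : p.HolderConjugate q) {ω υ : ℝ → ℝ}
    (hω : Measurable ω) (hυ : Measurable υ) (hω0 : ∀ t, 0 < ω t) (hυ0 : ∀ t, 0 < υ t)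
    (hωD : IsClassD ω) (hυD : IsClassD υ) (hM : quantityM n p q ω υ < ∞) :
    ∃ Q : ℝ, 1 < Q ∧ ∃ θ : ℝ, 0 < θ ∧ θ < 1 ∧ ∃ M : ℝ, 0 < M ∧ ∀ j,
      tail υ (grid Q (j + 1)) ^ (1 / p) ≤ θ * tail υ (grid Q j) ^ (1 / p) ∧
      (dualTail n q ω υ (grid Q (j + 1))).toReal ^ (1 / q) ≤
        θ * (dualTail n q ω υ (grid Q j)).toReal ^ (1 / q) ∧
      tail υ (grid Q j) ^ (1 / p) * (dualTail n q ω υ (grid Q j)).toReal ^ (1 / q) ≤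
        M * tail ω (grid Q j) ∧
      tail ω (grid Q j) ≤ M * tail ω (grid Q (j + 1)) := by
  have hq := hpq.symm.pos
  have hp := hpq.pos
  obtain ⟨hfin, M, hM0, hMb⟩ := quantityM_bound hpq hωD.weight hυD.weight hM
  obtain ⟨K₁, hK₁, l₁, hl₁, hl₁', h1⟩ := hωD.exists_tail_contract
  obtain ⟨K₂, hK₂, l₂, hl₂, hl₂', h2⟩ := hυD.exists_tail_contract
  obtain ⟨β, C, hC, hβ⟩ := hωD.exists_tail_mul_pow_le
  -- One ratio at which both tails contract.
  set Q := max K₁ K₂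
  have hQ : 1 < Q := lt_max_of_lt_left hK₁
  set D : ℕ → ℝ := fun j => (dualTail n q ω υ (grid Q j)).toReal with hD
  have hDpos : ∀ j, 0 < D j := fun j => ENNReal.toReal_pos
    (dualTail_pos hω hυ hω0 hυ0 (grid_mem hQ j)).ne' (hfin _ (grid_mem hQ j))
  -- Lower bound for the Jacobian at all grid points except the first.
  set ρ := grid Q 1 ^ (2 * n - 1)
  have hρ : 0 < ρ := pow_pos ((grid_zero Q) ▸ grid_strictMono hQ zero_lt_one) _
  set η := (ρ * (1 - l₁) / M) ^ q with hη
  have hη0 : 0 < η := by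
    have : 0 < 1 - l₁ := by linarith
    positivity
  have hstep : ∀ j, D (j + 1 + 1) ≤ (1 - η) * D (j + 1) := fun j => by
    set r := grid Q (j + 1) with hr
    have hrm := grid_mem hQ (j + 1)
    have hr1 := hωD.weight.tail_pos hrm
    have hr2 := hυD.weight.tail_pos hrm
    have h3 := pow_mul_tail_sub_le (n := n) hpq hω hυ hω0 hυ0 hωD.weight hυD.weight hrm.1
      (grid_strictMono hQ (Nat.lt_succ_self (j + 1))).le (grid_mem hQ _).2 (hfin _ hrm)
    have h4 := h1 Q (le_max_left _ _) r hrm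
    rw [hr, ← grid_succ] at h4
    have h5 : ρ ≤ r ^ (2 * n - 1) :=
      pow_le_pow_left₀ (grid_mem hQ 1).1 ((grid_strictMono hQ).monotone (by omega)) _
    have h6 : ρ * ((1 - l₁) * tail ω r) ≤ (D (j + 1) - D (j + 1 + 1)) ^ (1 / q) * tail υ r ^ (1 / p) := by
      refine le_trans ?_ h3
      have : 0 ≤ r ^ (2 * n - 1) := pow_nonneg hrm.1 _
      have h7 : (1 - l₁) * tail ω r ≤ tail ω r - tail ω (grid Q (j + 1 + 1)) := by linarith
      have : 0 ≤ (1 - l₁) * tail ω r := mul_nonneg (by linarith) hr1.le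
      gcongr
    have hDD : 0 ≤ D (j + 1) - D (j + 1 + 1) := sub_nonneg.2
      (ENNReal.toReal_mono (hfin _ hrm) (dualTail_anti ((grid_strictMono hQ).monotone (by omega))))
    have h7 : ρ * (1 - l₁) / M * D (j + 1) ^ (1 / q) ≤ (D (j + 1) - D (j + 1 + 1)) ^ (1 / q) := by
      rw [div_mul_eq_mul_div, div_le_iff₀ hM0]
      have hx : 0 < tail υ r ^ (1 / p) := by positivity
      have h8 := hMb r hrm
      have hDj := hDpos (j + 1)
      have hy : 0 < D (j + 1) ^ (1 / q) := by positivity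
      have hz : 0 ≤ (D (j + 1) - D (j + 1 + 1)) ^ (1 / q) := by positivity
      refine le_of_mul_le_mul_right ?_ hr1
      calc ρ * (1 - l₁) * D (j + 1) ^ (1 / q) * tail ω r
          = ρ * ((1 - l₁) * tail ω r) * D (j + 1) ^ (1 / q) := by ring
        _ ≤ (D (j + 1) - D (j + 1 + 1)) ^ (1 / q) * tail υ r ^ (1 / p) * D (j + 1) ^ (1 / q) := by
            gcongr
        _ = (D (j + 1) - D (j + 1 + 1)) ^ (1 / q) *
            (tail υ r ^ (1 / p) * D (j + 1) ^ (1 / q)) := by ring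
        _ ≤ (D (j + 1) - D (j + 1 + 1)) ^ (1 / q) * (M * tail ω r) := by gcongr
        _ = _ := by ring
    have hl : 0 ≤ ρ * (1 - l₁) / M := div_nonneg (mul_nonneg hρ.le (by linarith)) hM0.le
    have hDj := hDpos (j + 1)
    have h8 := Real.rpow_le_rpow (by positivity) h7 hq.le
    rw [Real.mul_rpow hl (by positivity), ← Real.rpow_mul hDj.le, ← Real.rpow_mul hDD,
      one_div_mul_cancel hq.ne', Real.rpow_one, Real.rpow_one, ← hη] at h8
    linarith
  -- Otherwise the second step would make the dual tail nonpositive.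
  have hη1 : η < 1 := by
    by_contra! h'
    have h3 := hstep 0
    have h4 := hDpos (0 + 1)
    have h5 := hDpos (0 + 1 + 1)
    nlinarith
  -- At the grid point 0 the factor r^(2n-1) in Hölder's inequality vanishes for n ≥ 1. For this
  -- single step strict decrease suffices, its ratio being included in δ.
  have hfirst : D 1 < D 0 := by
    have h3 := dualTail_eq_add (n := n) (q := q) (ω := ω) (υ := υ)
      (grid_strictMono hQ zero_lt_one).le (grid_mem hQ 1).2.le
    have h4 := lintegral_dualDensity_pos (n := n) (q := q) hω hυ hω0 hυ0 (grid_mem hQ 0).1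
      (grid_strictMono hQ zero_lt_one)
    refine (ENNReal.toReal_lt_toReal (hfin _ (grid_mem hQ 1)) (hfin _ (grid_mem hQ 0))).2 ?_
    rw [h3, add_comm]
    exact ENNReal.lt_add_right (hfin _ (grid_mem hQ 1)) h4.ne'
  set δ := max (1 - η) (D 1 / D 0)
  have hδ0 : 0 < δ := lt_max_of_lt_left (by linarith)
  have hδ1 : δ < 1 := max_lt (by linarith) ((div_lt_one (hDpos 0)).2 hfirst)
  have hDstep : ∀ j, D (j + 1) ≤ δ * D j := by
    rintro (_ | j)
    · calc D 1 = D 1 / D 0 * D 0 := by have := (hDpos 0).ne'; field_simp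
        _ ≤ δ * D 0 := by
            have := hDpos 0
            gcongr
            exact le_max_right _ _
    · refine (hstep j).trans ?_
      have := hDpos (j + 1)
      gcongr
      exact le_max_left _ _
  refine ⟨Q, hQ, max (δ ^ (1 / q)) (l₂ ^ (1 / p)), lt_max_of_lt_left (by positivity),
    max_lt (Real.rpow_lt_one hδ0.le hδ1 (by positivity)) (Real.rpow_lt_one hl₂.le hl₂' (by positivity)),
    max M (C * Q ^ β), lt_max_of_lt_left hM0, fun j => ⟨?_, ?_, ?_, ?_⟩⟩
  · have h3 := h2 Q (le_max_right _ _) _ (grid_mem hQ j)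
    rw [← grid_succ] at h3
    have h4 := hυD.weight.tail_pos (grid_mem hQ j)
    have h5 := hυD.weight.tail_pos (grid_mem hQ (j + 1))
    refine (Real.rpow_le_rpow h5.le h3 (by positivity)).trans ?_
    rw [Real.mul_rpow hl₂.le h4.le]
    gcongr
    exact le_max_right _ _
  · have h4 := hDpos j
    have h5 := hDpos (j + 1)
    refine (Real.rpow_le_rpow h5.le (hDstep j) (by positivity)).trans ?_
    rw [Real.mul_rpow hδ0.le h4.le]
    gcongr
    exact le_max_left _ _
  · have h4 := hωD.weight.tail_pos (grid_mem hQ j)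
    refine (hMb _ (grid_mem hQ j)).trans ?_
    gcongr
    exact le_max_left _ _
  · have h4 := hωD.weight.tail_pos (grid_mem hQ (j + 1))
    have h3 := hβ _ _ (grid_mem hQ j).1 (grid_strictMono hQ (Nat.lt_succ_self j)).le
      (grid_mem hQ (j + 1)).2
    have hg : 0 < 1 - grid Q j := by linarith [(grid_mem hQ j).2]
    rw [Nat.succ_eq_add_one, grid_succ, sub_sub_cancel, div_pow, ← grid_succ] at h3
    have h6 : tail ω (grid Q j) ≤ C * Q ^ β * tail ω (grid Q (j + 1)) := by
      have h7 : 0 < (1 - grid Q j) ^ β := by positivity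
      rw [mul_div_assoc', div_le_iff₀ (by positivity)] at h3
      refine le_of_mul_le_mul_right (h3.trans (le_of_eq ?_)) h7
      ring
    refine h6.trans ?_
    gcongr
    exact le_max_right _ _

/-! ### Equivalence of the two weight conditions -/

/-- With natural subtraction the exponent is |i - j|, so each side of i contributes at most a
geometric series. -/
theorem tsum_pow_dist_le (t : ℝ≥0∞) (i : ℕ) :
    ∑' j, t ^ (max i j - min i j) ≤ 2 * (1 - t)⁻¹ := by
  have hsplit := Summable.sum_add_tsum_nat_add' (f := fun j => t ^ (max i j - min i j)) (k := i)
    ENNReal.summable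
  rw [← hsplit, two_mul, ← ENNReal.tsum_geometric]
  refine add_le_add ?_ (le_of_eq (tsum_congr fun j => ?_))
  · rw [← Finset.sum_range_reflect]
    calc ∑ j ∈ Finset.range i, t ^ (max i (i - 1 - j) - min i (i - 1 - j))
        = ∑ j ∈ Finset.range i, t ^ (j + 1) := Finset.sum_congr rfl fun j hj => by
          rw [Finset.mem_range] at hj
          congr 1
          omega
      _ ≤ ∑' j, t ^ (j + 1) := ENNReal.sum_le_tsum _
      _ ≤ ∑' j, t ^ j := ENNReal.tsum_comp_le_tsum_of_injective (add_left_injective 1) fun j => t ^ j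
  · congr 1
    omega

theorem geometric_decay {x : ℕ → ℝ} {θ : ℝ} (hθ : 0 ≤ θ) (hx : ∀ j, x (j + 1) ≤ θ * x j) {i j : ℕ}
    (hij : i ≤ j) : x j ≤ θ ^ (j - i) * x i := by
  obtain ⟨k, rfl⟩ := Nat.exists_eq_add_of_le hij
  rw [Nat.add_sub_cancel_left]
  induction k with
  | zero => simp
  | succ k ih =>
    calc x (i + k + 1) ≤ θ * x (i + k) := hx _
      _ ≤ θ * (θ ^ k * x i) := by gcongr; exact ih (by omega)
      _ = _ := by ring

/-- The discrete estimate behind the Schur test. -/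
theorem tsum_div_min_le {x y w : ℕ → ℝ} {θ M : ℝ} (hθ : 0 ≤ θ) (hM : 0 ≤ M) (hx0 : ∀ j, 0 < x j)
    (hy0 : ∀ j, 0 < y j) (hw0 : ∀ j, 0 < w j) (hx : ∀ j, x (j + 1) ≤ θ * x j)
    (hy : ∀ j, y (j + 1) ≤ θ * y j) (hxy : ∀ j, x j * y j ≤ M * w j) (i : ℕ) :
    ∑' j, ENNReal.ofReal (y j / w (min i j)) ≤
      ENNReal.ofReal (M / x i) * (2 * (1 - ENNReal.ofReal θ)⁻¹) := by
  refine le_trans ?_ (mul_le_mul_right (tsum_pow_dist_le _ i) _)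
  rw [← ENNReal.tsum_mul_left]
  refine ENNReal.tsum_le_tsum fun j => ?_
  have hxi := hx0 i
  rw [← ENNReal.ofReal_pow hθ, ← ENNReal.ofReal_mul (by positivity)]
  refine ENNReal.ofReal_le_ofReal ?_
  rw [div_mul_eq_mul_div, div_le_div_iff₀ (hw0 _) hxi]
  -- For j ≥ i the decay of y brings y_j back to y_i; for j ≤ i the decay of x brings x_i back to
  -- x_j. In both cases the bound on x y is then used at the index min(i, j) of w.
  rcases le_total i j with h | h
  · rw [min_eq_left h, max_eq_right h]
    calc y j * x i ≤ θ ^ (j - i) * y i * x i := by gcongr; exact geometric_decay hθ hy h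
      _ = θ ^ (j - i) * (x i * y i) := by ring
      _ ≤ θ ^ (j - i) * (M * w i) := mul_le_mul_of_nonneg_left (hxy i) (by positivity)
      _ = _ := by ring
  · rw [min_eq_right h, max_eq_left h]
    have := hy0 j
    calc y j * x i ≤ y j * (θ ^ (i - j) * x j) := by gcongr; exact geometric_decay hθ hx h
      _ = θ ^ (i - j) * (x j * y j) := by ring
      _ ≤ θ ^ (i - j) * (M * w j) := mul_le_mul_of_nonneg_left (hxy j) (by positivity)
      _ = _ := by ring

theorem lintegral_grid_le {n : ℕ} {p : ℝ} (hp : 0 < p) {ω υ : ℝ → ℝ} (hω : IsRadialWeight ω)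
    (hυ : IsRadialWeight υ) (hυ0 : ∀ t, 0 < υ t) {r s : ℝ} (hr : 0 ≤ r) (hs : s < 1) (hrs : r ≤ s) :
    ∫⁻ t in Ico r s, ENNReal.ofReal (υ t / tail ω t ^ p * t ^ (2 * n - 1)) ≤
      ENNReal.ofReal (tail υ r / tail ω s ^ p) := by
  have hWs := hω.tail_pos ⟨hr.trans hrs, hs⟩
  calc ∫⁻ t in Ico r s, ENNReal.ofReal (υ t / tail ω t ^ p * t ^ (2 * n - 1))
      ≤ ∫⁻ t in Ico r s, ENNReal.ofReal (tail ω s ^ p)⁻¹ * ENNReal.ofReal (υ t) := by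
        refine setLIntegral_mono' measurableSet_Ico fun t ht => ?_
        have ht0 : 0 ≤ t := hr.trans ht.1
        have h1 := hω.tail_anti ht0 ht.2.le
        have h2 := hυ0 t
        have h3 : t ^ (2 * n - 1) ≤ 1 := pow_le_one₀ ht0 (ht.2.le.trans hs.le)
        rw [← ENNReal.ofReal_mul (by positivity)]
        refine ENNReal.ofReal_le_ofReal ?_
        calc υ t / tail ω t ^ p * t ^ (2 * n - 1) ≤ υ t / tail ω s ^ p * 1 := by gcongr
          _ = _ := by ring
    _ ≤ ENNReal.ofReal (tail ω s ^ p)⁻¹ * ENNReal.ofReal (tail υ r) := by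
        rw [lintegral_const_mul' _ _ ENNReal.ofReal_ne_top, hυ.ofReal_tail hr]
        gcongr
    _ = _ := by
        rw [← ENNReal.ofReal_mul (by positivity)]
        congr 1
        ring

/-- On shell i the integral is at most (x_i / w_(i+1))^p. Regularity of w, the bound on x_i y_i and
the decay of y give x_i / w_(i+1) ≤ M² θ^(j-i) / y_j for i ≤ j. The sum up to shell j is therefore a
multiple of y_j^(-p), which the factor y_j cancels. -/
theorem quantityN_lt_top {n : ℕ} {p q : ℝ} (hpq : p.HolderConjugate q) {ω υ : ℝ → ℝ}
    (hω : Measurable ω) (hυ : Measurable υ) (hω0 : ∀ t, 0 < ω t) (hυ0 : ∀ t, 0 < υ t)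
    (hωD : IsClassD ω) (hυD : IsClassD υ) (hM : quantityM n p q ω υ < ∞) :
    quantityN n p q ω υ < ∞ := by
  have hq := hpq.symm.pos
  have hp := hpq.pos
  obtain ⟨hfin, -⟩ := quantityM_bound hpq hωD.weight hυD.weight hM
  obtain ⟨Q, hQ, θ, hθ0, hθ1, M, hM0, hgrid⟩ :=
    exists_grid_decay hpq hω hυ hω0 hυ0 hωD hυD hM
  set w : ℕ → ℝ := fun j => tail ω (grid Q j)
  set x : ℕ → ℝ := fun j => tail υ (grid Q j) ^ (1 / p) with hxdef
  set y : ℕ → ℝ := fun j => (dualTail n q ω υ (grid Q j)).toReal ^ (1 / q) with hydef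
  have hw0 : ∀ j, 0 < w j := fun j => hωD.weight.tail_pos (grid_mem hQ j)
  have hV0 : ∀ j, 0 < tail υ (grid Q j) := fun j => hυD.weight.tail_pos (grid_mem hQ j)
  have hx0 : ∀ j, 0 < x j := fun j => by have := hV0 j; positivity
  have hy0 : ∀ j, 0 < y j := fun j => by
    have := ENNReal.toReal_pos
      (dualTail_pos (n := n) (q := q) hω hυ hω0 hυ0 (grid_mem hQ j)).ne' (hfin _ (grid_mem hQ j))
    positivity
  set t := ENNReal.ofReal θ
  have ht1 : t < 1 := by
    rw [← ENNReal.ofReal_one]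
    exact (ENNReal.ofReal_lt_ofReal_iff one_pos).2 hθ1
  set H : ℝ → ℝ≥0∞ := fun r =>
    ∫⁻ s in Ico 0 r, ENNReal.ofReal (υ s / tail ω s ^ p * s ^ (2 * n - 1)) with hH
  set E : ℕ → ℝ≥0∞ := fun i => ENNReal.ofReal (x i / w (i + 1)) ^ p with hE
  have hsum : ∀ j, H (grid Q j) ≤ ∑ i ∈ Finset.range j, E i := by
    intro j
    induction j with
    | zero => simp [H, grid_zero]
    | succ j ih =>
      have hlt := grid_strictMono hQ (Nat.lt_succ_self j)
      rw [Finset.sum_range_succ]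
      simp only [hH]
      rw [← Ico_union_Ico_eq_Ico (grid_mem hQ j).1 hlt.le,
        lintegral_union measurableSet_Ico Ico_disjoint_Ico_same]
      refine add_le_add ih ((lintegral_grid_le hp hωD.weight hυD.weight hυ0 (grid_mem hQ j).1
        (grid_mem hQ (j + 1)).2 hlt.le).trans (le_of_eq ?_))
      have h1 := hw0 (j + 1)
      have h2 := hx0 j
      change _ = ENNReal.ofReal (x j / w (j + 1)) ^ p
      rw [ENNReal.ofReal_rpow_of_nonneg (by positivity) hp.le,
        Real.div_rpow h2.le h1.le, hxdef, ← Real.rpow_mul (hV0 j).le, one_div_mul_cancel hp.ne',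
        Real.rpow_one]
  have hEb : ∀ j, ∀ i ∈ Finset.range (j + 1), E i ≤
      ENNReal.ofReal (M ^ 2 / y j) ^ p * t ^ (max j i - min j i) := fun j i hi => by
    have hij : i ≤ j := by rw [Finset.mem_range] at hi; omega
    rw [max_eq_left hij, min_eq_right hij]
    have h1 : x i / w (i + 1) ≤ M ^ 2 / y j * θ ^ (j - i) := by
      rw [div_mul_eq_mul_div, div_le_div_iff₀ (hw0 _) (hy0 j)]
      have hxi := hx0 i
      calc x i * y j ≤ x i * (θ ^ (j - i) * y i) := by
            gcongr; exact geometric_decay hθ0.le (fun j => (hgrid j).2.1) hij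
        _ = θ ^ (j - i) * (x i * y i) := by ring
        _ ≤ θ ^ (j - i) * (M * w i) := mul_le_mul_of_nonneg_left (hgrid i).2.2.1 (by positivity)
        _ ≤ θ ^ (j - i) * (M * (M * w (i + 1))) := by gcongr; exact (hgrid i).2.2.2
        _ = _ := by ring
    have hyj := hy0 j
    calc E i ≤ ENNReal.ofReal (M ^ 2 / y j * θ ^ (j - i)) ^ p := by
          simp only [hE]; gcongr
      _ = ENNReal.ofReal (M ^ 2 / y j) ^ p * (t ^ (j - i)) ^ p := by
          rw [ENNReal.ofReal_mul (by positivity), ENNReal.mul_rpow_of_nonneg _ _ hp.le,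
            ENNReal.ofReal_pow hθ0.le]
      _ ≤ _ := by
          gcongr
          exact ENNReal.rpow_le_self_of_le_one (pow_le_one₀ zero_le ht1.le) hpq.lt.le
  -- The first summand comes from the shells; the second serves the added 1, because y_j ≤ y_0.
  set K : ℝ≥0∞ := ENNReal.ofReal (M ^ 2) ^ p * (2 * (1 - t)⁻¹) + ENNReal.ofReal (y 0) ^ p with hK
  have hKfin : K ≠ ∞ := by
    refine ENNReal.add_ne_top.2 ⟨ENNReal.mul_ne_top
      (ENNReal.rpow_ne_top_of_nonneg hp.le ENNReal.ofReal_ne_top)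
      (ENNReal.mul_ne_top (by norm_num) (ENNReal.inv_ne_top.2 (tsub_pos_of_lt ht1).ne')),
      ENNReal.rpow_ne_top_of_nonneg hp.le ENNReal.ofReal_ne_top⟩
  refine lt_of_le_of_lt (iSup₂_le fun r hr => ?_)
    (ENNReal.rpow_lt_top_of_nonneg (y := 1 / p) (by positivity) hKfin)
  obtain ⟨j, hj1, hj2⟩ := exists_mem_Ico_grid hQ hr
  have hyj := hy0 j
  have hH1 : H r + 1 ≤ ENNReal.ofReal (1 / y j) ^ p * K := by
    have h1 : H r ≤ ENNReal.ofReal (M ^ 2 / y j) ^ p * (2 * (1 - t)⁻¹) := by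
      calc H r ≤ H (grid Q (j + 1)) := lintegral_mono_set (Ico_subset_Ico_right hj2.le)
        _ ≤ ∑ i ∈ Finset.range (j + 1), E i := hsum (j + 1)
        _ ≤ ∑ i ∈ Finset.range (j + 1), ENNReal.ofReal (M ^ 2 / y j) ^ p * t ^ (max j i - min j i) :=
            Finset.sum_le_sum (hEb j)
        _ ≤ ENNReal.ofReal (M ^ 2 / y j) ^ p * ∑' i, t ^ (max j i - min j i) := by
            rw [← Finset.mul_sum]
            gcongr
            exact ENNReal.sum_le_tsum _
        _ ≤ _ := by
            gcongr
            exact tsum_pow_dist_le _ _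
    have h2 : (1 : ℝ≥0∞) ≤ ENNReal.ofReal (y 0 / y j) ^ p := by
      refine ENNReal.one_le_rpow ?_ hp
      rw [ENNReal.one_le_ofReal, one_le_div hyj]
      refine (geometric_decay hθ0.le (fun j => (hgrid j).2.1) (Nat.zero_le j)).trans ?_
      exact mul_le_of_le_one_left (hy0 0).le (pow_le_one₀ hθ0.le hθ1.le)
    refine (add_le_add h1 h2).trans (le_of_eq ?_)
    rw [hK, mul_add, ← mul_assoc (ENNReal.ofReal (1 / y j) ^ p), ← ENNReal.mul_rpow_of_nonneg _ _ hp.le,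
      ← ENNReal.mul_rpow_of_nonneg _ _ hp.le, ← ENNReal.ofReal_mul (by positivity),
      ← ENNReal.ofReal_mul (by positivity), one_div_mul_eq_div, one_div_mul_eq_div]
  have hDr : dualTail n q ω υ r ^ (1 / q) ≤ ENNReal.ofReal (y j) := by
    rw [hydef, ← ENNReal.ofReal_rpow_of_nonneg ENNReal.toReal_nonneg (by positivity),
      ENNReal.ofReal_toReal (hfin _ (grid_mem hQ j))]
    gcongr
    exact dualTail_anti hj1
  calc (H r + 1) ^ (1 / p) * dualTail n q ω υ r ^ (1 / q)
      ≤ (ENNReal.ofReal (1 / y j) ^ p * K) ^ (1 / p) * ENNReal.ofReal (y j) := by gcongr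
    _ = ENNReal.ofReal (1 / y j) * ENNReal.ofReal (y j) * K ^ (1 / p) := by
        rw [ENNReal.mul_rpow_of_nonneg _ _ (by positivity), ← ENNReal.rpow_mul,
          mul_one_div_cancel hp.ne', ENNReal.rpow_one]
        ring
    _ ≤ _ := by
        rw [← ENNReal.ofReal_mul (by positivity), one_div_mul_cancel hyj.ne', ENNReal.ofReal_one,
          one_mul]

/-- With s = 1 - Q(1-r), reverse doubling of υ bounds υ̂(r) by a multiple of the υ-mass of [s, r),
and doubling of ω makes ω̂ comparable to ω̂(r) there. -/
theorem exists_tail_div_le {n : ℕ} {p : ℝ} (hp : 0 < p) {ω υ : ℝ → ℝ}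
    (hυ0 : ∀ t, 0 < υ t) (hωD : IsClassD ω) (hυD : IsClassD υ) :
    ∃ C : ℝ, 0 < C ∧ ∀ r ∈ Ico (0 : ℝ) 1, ENNReal.ofReal (tail υ r / tail ω r ^ p) ≤
      ENNReal.ofReal C *
        ((∫⁻ s in Ico 0 r, ENNReal.ofReal (υ s / tail ω s ^ p * s ^ (2 * n - 1))) + 1) := by
  obtain ⟨Q, hQ, l, hl, hl', h2⟩ := hυD.exists_tail_contract
  obtain ⟨β, C, hC, hβ⟩ := hωD.exists_tail_mul_pow_le
  have hQ0 : 0 < Q := by linarith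
  -- For r ≥ R the point s = 1 - Q(1-r) is at least 1/2, which keeps the Jacobian away from 0. For r
  -- ≤ R the added 1 suffices.
  set R := 1 - 1 / (2 * Q) with hR
  have hRm : R ∈ Ico (0 : ℝ) 1 := by
    have h1 : 1 / (2 * Q) ≤ 1 := by rw [div_le_one (by positivity)]; linarith
    have h2 : 0 < 1 / (2 * Q) := by positivity
    exact ⟨by linarith, by linarith⟩
  have hWR := hωD.weight.tail_pos hRm
  have hV0 := hυD.weight.tail_pos (r := 0) ⟨le_rfl, one_pos⟩
  set C₁ := tail υ 0 / tail ω R ^ p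
  set C₂ := (C * Q ^ β) ^ p * (l / (1 - l)) * 2 ^ (2 * n - 1) with hC₂
  have hl1 : 0 < 1 - l := by linarith
  have hC₂0 : 0 < C₂ := by positivity
  refine ⟨max C₁ C₂, lt_max_of_lt_right hC₂0, fun r hr => ?_⟩
  have hVr := hυD.weight.tail_pos hr
  have hWr := hωD.weight.tail_pos hr
  rcases le_total r R with h | h
  · calc ENNReal.ofReal (tail υ r / tail ω r ^ p) ≤ ENNReal.ofReal (max C₁ C₂) * 1 := by
          rw [mul_one]
          refine ENNReal.ofReal_le_ofReal (le_trans ?_ (le_max_left _ _))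
          have h3 := hωD.weight.tail_anti hr.1 h
          have h4 := hυD.weight.tail_anti le_rfl hr.1
          simp only [C₁]
          gcongr
      _ ≤ _ := by
          gcongr
          exact le_add_self
  · set s := 1 - Q * (1 - r) with hs
    have hs2 : 1 / 2 ≤ s := by
      have : Q * (1 - r) ≤ Q * (1 / (2 * Q)) := by gcongr; linarith
      have h3 : Q * (1 / (2 * Q)) = 1 / 2 := by field_simp
      linarith
    have hsr : s ≤ r := by nlinarith [hr.2]
    have hsm : s ∈ Ico (0 : ℝ) 1 := ⟨by linarith, hsr.trans_lt hr.2⟩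
    have hrs : r = 1 - (1 - s) / Q := by rw [hs]; field_simp; ring
    have h3 : tail υ r ≤ l * tail υ s := by
      have := h2 Q le_rfl s hsm
      rwa [← hrs] at this
    have hWs := hωD.weight.tail_pos hsm
    have h4 : tail ω s ≤ C * Q ^ β * tail ω r := by
      have h5 := hβ s r hsm.1 hsr hr.2
      have h6 : 1 - s = Q * (1 - r) := by rw [hs]; ring
      have h7 : 0 < (1 - r) ^ β := pow_pos (by linarith [hr.2]) _
      rw [h6, mul_pow] at h5
      refine le_of_mul_le_mul_right (h5.trans (le_of_eq ?_)) h7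
      ring
    have h5 : tail υ r ≤ l / (1 - l) * ∫ t in Ico s r, υ t := by
      have := hυD.weight.tail_eq_add hsm.1 hsr hr.2.le
      rw [div_mul_eq_mul_div, le_div_iff₀ hl1]
      nlinarith
    have h6 : (tail ω s ^ p)⁻¹ * (1 / 2) ^ (2 * n - 1) * (∫ t in Ico s r, υ t) ≥
        C₂⁻¹ * (tail υ r / tail ω r ^ p) := by
      have h7 : tail ω s ^ p ≤ (C * Q ^ β) ^ p * tail ω r ^ p := by
        rw [← Real.mul_rpow (by positivity) hWr.le]
        exact Real.rpow_le_rpow hWs.le h4 hp.le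
      have h8 : ((C * Q ^ β) ^ p * tail ω r ^ p)⁻¹ ≤ (tail ω s ^ p)⁻¹ := by gcongr
      have h9 : 0 ≤ ∫ t in Ico s r, υ t := integral_nonneg fun t => (hυ0 t).le
      have h10 : (l / (1 - l))⁻¹ * tail υ r ≤ ∫ t in Ico s r, υ t := by
        rw [inv_mul_le_iff₀ (by positivity)]
        exact h5
      calc C₂⁻¹ * (tail υ r / tail ω r ^ p) = ((C * Q ^ β) ^ p * tail ω r ^ p)⁻¹ *
            (1 / 2) ^ (2 * n - 1) * ((l / (1 - l))⁻¹ * tail υ r) := by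
            rw [hC₂, one_div, inv_pow]
            field_simp
        _ ≤ _ := by gcongr
    calc ENNReal.ofReal (tail υ r / tail ω r ^ p)
        = ENNReal.ofReal C₂ * ENNReal.ofReal (C₂⁻¹ * (tail υ r / tail ω r ^ p)) := by
          rw [← ENNReal.ofReal_mul hC₂0.le]
          congr 1
          field_simp
      _ ≤ ENNReal.ofReal (max C₁ C₂) *
          ((∫⁻ s in Ico 0 r, ENNReal.ofReal (υ s / tail ω s ^ p * s ^ (2 * n - 1))) + 1) := by
          gcongr
          · exact le_max_right _ _
          refine (ENNReal.ofReal_le_ofReal h6).trans (le_trans ?_ le_self_add)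
          refine le_trans ?_ (lintegral_mono_set (Ico_subset_Ico_left hsm.1))
          rw [ENNReal.ofReal_mul (by positivity), ofReal_integral_eq_lintegral_ofReal
            ((hυD.weight.integrableOn_Ico hsm.1).mono_set (Ico_subset_Ico_right hr.2.le))
            (ae_of_all _ fun t => (hυ0 t).le), ← lintegral_const_mul' _ _ ENNReal.ofReal_ne_top]
          refine setLIntegral_mono' measurableSet_Ico fun t ht => ?_
          rw [← ENNReal.ofReal_mul (by positivity)]
          refine ENNReal.ofReal_le_ofReal ?_
          have ht0 : 0 ≤ t := hsm.1.trans ht.1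
          have h7 := hωD.weight.tail_pos ⟨ht0, ht.2.trans hr.2⟩
          have h8 := hωD.weight.tail_anti hsm.1 ht.1
          have h9 := hυ0 t
          have h10 : (1 / 2 : ℝ) ≤ t := hs2.trans ht.1
          calc (tail ω s ^ p)⁻¹ * (1 / 2) ^ (2 * n - 1) * υ t
              ≤ (tail ω t ^ p)⁻¹ * t ^ (2 * n - 1) * υ t := by gcongr
            _ = _ := by ring

theorem quantityM_lt_top {n : ℕ} {p q : ℝ} (hpq : p.HolderConjugate q) {ω υ : ℝ → ℝ}
    (hυ0 : ∀ t, 0 < υ t) (hωD : IsClassD ω) (hυD : IsClassD υ) (hN : quantityN n p q ω υ < ∞) :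
    quantityM n p q ω υ < ∞ := by
  have hp := hpq.pos
  obtain ⟨C, hC, h⟩ := exists_tail_div_le (n := n) hp hυ0 hωD hυD
  refine lt_of_le_of_lt (iSup₂_le fun r hr => ?_) (ENNReal.mul_lt_top
    (ENNReal.rpow_lt_top_of_nonneg (x := ENNReal.ofReal C) (y := 1 / p) (by positivity)
      ENNReal.ofReal_ne_top) hN)
  have hV := hυD.weight.tail_pos hr
  have hW := hωD.weight.tail_pos hr
  have h1 : ENNReal.ofReal (tail υ r ^ (1 / p) / tail ω r) =
      ENNReal.ofReal (tail υ r / tail ω r ^ p) ^ (1 / p) := by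
    rw [ENNReal.ofReal_rpow_of_nonneg (by positivity) (by positivity),
      Real.div_rpow hV.le (by positivity), ← Real.rpow_mul hW.le, mul_one_div_cancel hp.ne',
      Real.rpow_one]
  calc ENNReal.ofReal (tail υ r ^ (1 / p) / tail ω r) * dualTail n q ω υ r ^ (1 / q)
      ≤ (ENNReal.ofReal C *
        ((∫⁻ s in Ico 0 r, ENNReal.ofReal (υ s / tail ω s ^ p * s ^ (2 * n - 1))) + 1)) ^ (1 / p) *
          dualTail n q ω υ r ^ (1 / q) := by
        rw [h1]
        gcongr
        exact h r hr
    _ ≤ _ := by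
        rw [ENNReal.mul_rpow_of_nonneg _ _ (by positivity), mul_assoc]
        gcongr
        exact le_iSup₂_of_le (f := fun r (_ : r ∈ Ico (0 : ℝ) 1) =>
          ((∫⁻ s in Ico 0 r, ENNReal.ofReal (υ s / tail ω s ^ p * s ^ (2 * n - 1))) + 1) ^ (1 / p) *
            dualTail n q ω υ r ^ (1 / q)) r hr le_rfl

/-! ### Schur's test -/

/-- Schur's test with two measures. -/
theorem lintegral_rpow_lintegral_le {α β : Type*} [MeasurableSpace α] [MeasurableSpace β]
    {μ : Measure α} {τ : Measure β} [SFinite μ] [SFinite τ] {p q : ℝ} (hpq : p.HolderConjugate q)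
    {K : β → α → ℝ≥0∞} (hK : Measurable (Function.uncurry K)) {φ : α → ℝ≥0∞} (hφ : Measurable φ)
    (hφ0 : ∀ᵐ ξ ∂μ, φ ξ ≠ 0) (hφt : ∀ᵐ ξ ∂μ, φ ξ ≠ ∞) {ψ : β → ℝ≥0∞} (hψ : Measurable ψ)
    {ρ : α → ℝ≥0∞} {A B : ℝ≥0∞}
    (hA : ∀ᵐ z ∂τ, ∫⁻ ξ, K z ξ * φ ξ ^ q ∂μ ≤ A * ψ z ^ q)
    (hB : ∀ᵐ ξ ∂μ, ∫⁻ z, K z ξ * ψ z ^ p ∂τ ≤ B * (φ ξ ^ p * ρ ξ)) (hBt : B ≠ ∞) (hAt : A ≠ ∞)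
    {f : α → ℝ≥0∞} (hf : Measurable f) :
    ∫⁻ z, (∫⁻ ξ, K z ξ * f ξ ∂μ) ^ p ∂τ ≤ A ^ (p / q) * B * ∫⁻ ξ, f ξ ^ p * ρ ξ ∂μ := by
  have hp := hpq.pos
  have hq := hpq.symm.pos
  have hKz : ∀ z, Measurable (K z) := fun z => hK.comp measurable_prodMk_left
  -- Hölder for the splitting K f = (K^(1/q) φ)(K^(1/p) f/φ).
  have hholder : ∀ z, (∫⁻ ξ, K z ξ * f ξ ∂μ) ≤ (∫⁻ ξ, K z ξ * φ ξ ^ q ∂μ) ^ (1 / q) *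
      (∫⁻ ξ, K z ξ * (f ξ / φ ξ) ^ p ∂μ) ^ (1 / p) := fun z => by
    have hm := hKz z
    have key := ENNReal.lintegral_mul_le_Lp_mul_Lq μ hpq.symm
      (f := fun ξ => K z ξ ^ (1 / q) * φ ξ) (g := fun ξ => K z ξ ^ (1 / p) * (f ξ / φ ξ))
      (Measurable.aemeasurable (by fun_prop)) (Measurable.aemeasurable (by fun_prop))
    have e1 : ∀ a b : ℝ≥0∞, (a ^ (1 / q) * b) ^ q = a * b ^ q := fun a b => by
      rw [ENNReal.mul_rpow_of_nonneg _ _ hq.le, ← ENNReal.rpow_mul, one_div_mul_cancel hq.ne',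
        ENNReal.rpow_one]
    have e2 : ∀ a b : ℝ≥0∞, (a ^ (1 / p) * b) ^ p = a * b ^ p := fun a b => by
      rw [ENNReal.mul_rpow_of_nonneg _ _ hp.le, ← ENNReal.rpow_mul, one_div_mul_cancel hp.ne',
        ENNReal.rpow_one]
    simp only [e1, e2] at key
    refine le_trans (lintegral_mono_ae ?_) key
    filter_upwards [hφ0, hφt] with ξ h0 ht
    have h1 : K z ξ = K z ξ ^ (1 / q) * K z ξ ^ (1 / p) := by
      rw [← ENNReal.rpow_add_of_nonneg _ _ (by positivity) (by positivity), one_div, one_div,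
        hpq.symm.inv_add_inv_eq_one, ENNReal.rpow_one]
    simp only [Pi.mul_apply]
    calc K z ξ * f ξ = K z ξ ^ (1 / q) * K z ξ ^ (1 / p) * (φ ξ * (f ξ / φ ξ)) := by
          rw [ENNReal.mul_div_cancel h0 ht, ← h1]
      _ ≤ _ := le_of_eq (by ring)
  calc ∫⁻ z, (∫⁻ ξ, K z ξ * f ξ ∂μ) ^ p ∂τ
      ≤ ∫⁻ z, A ^ (p / q) * (∫⁻ ξ, ψ z ^ p * (K z ξ * (f ξ / φ ξ) ^ p) ∂μ) ∂τ := by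
        refine lintegral_mono_ae ?_
        filter_upwards [hA] with z hz
        have hm := hKz z
        rw [lintegral_const_mul _ (by fun_prop)]
        calc (∫⁻ ξ, K z ξ * f ξ ∂μ) ^ p
            ≤ ((A * ψ z ^ q) ^ (1 / q) * (∫⁻ ξ, K z ξ * (f ξ / φ ξ) ^ p ∂μ) ^ (1 / p)) ^ p := by
              gcongr
              refine (hholder z).trans ?_
              gcongr
          _ = _ := by
              rw [ENNReal.mul_rpow_of_nonneg _ _ hp.le, ← ENNReal.rpow_mul, ← ENNReal.rpow_mul,
                one_div_mul_cancel hp.ne', ENNReal.rpow_one,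
                ENNReal.mul_rpow_of_nonneg _ _ (by positivity), ← ENNReal.rpow_mul, mul_assoc,
                one_div_mul_eq_div]
              congr 4
              field_simp
    _ = A ^ (p / q) * ∫⁻ ξ, (∫⁻ z, ψ z ^ p * (K z ξ * (f ξ / φ ξ) ^ p) ∂τ) ∂μ := by
        rw [lintegral_const_mul' _ _ (ENNReal.rpow_ne_top_of_nonneg (by positivity) hAt),
          lintegral_lintegral_swap (Measurable.aemeasurable (by
            have : Measurable fun z : β × α => K z.1 z.2 := hK
            change Measurable fun z : β × α => ψ z.1 ^ p * (K z.1 z.2 * (f z.2 / φ z.2) ^ p)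
            fun_prop))]
    _ ≤ A ^ (p / q) * ∫⁻ ξ, B * (f ξ ^ p * ρ ξ) ∂μ := by
        refine mul_le_mul_right (lintegral_mono_ae ?_) _
        filter_upwards [hB, hφ0, hφt] with ξ hξ h0 ht
        have hm : Measurable fun z => K z ξ := hK.comp measurable_prodMk_right
        have : ∀ z, ψ z ^ p * (K z ξ * (f ξ / φ ξ) ^ p) = (f ξ / φ ξ) ^ p * (K z ξ * ψ z ^ p) :=
          fun z => by ring
        simp only [this]
        rw [lintegral_const_mul _ (by fun_prop)]
        calc (f ξ / φ ξ) ^ p * ∫⁻ z, K z ξ * ψ z ^ p ∂τ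
            ≤ (f ξ / φ ξ) ^ p * (B * (φ ξ ^ p * ρ ξ)) := by gcongr
          _ = B * ((f ξ / φ ξ * φ ξ) ^ p * ρ ξ) := by
              rw [ENNReal.mul_rpow_of_nonneg _ _ hp.le]; ring
          _ = _ := by rw [ENNReal.div_mul_cancel h0 ht]
    _ = _ := by
        rw [lintegral_const_mul' _ _ hBt, mul_assoc]

/-- The Bergman kernel in closed form, cut off outside the ball. -/
noncomputable def ballKernel (n : ℕ) (ω : ℝ → ℝ) (z ξ : Cn n) : ℂ :=
  (Metric.ball (0 : ℂ) 1).indicator (kernelFun n ω) (inner ℂ z ξ)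

theorem ballKernel_eq {n : ℕ} {ω : ℝ → ℝ} {z ξ : Cn n} (hz : z ∈ unitBall n) (hξ : ξ ∈ unitBall n) :
    ballKernel n ω z ξ = kernelFun n ω (inner ℂ z ξ) :=
  indicator_of_mem (by rw [mem_ball_zero_iff]; exact norm_inner_lt_one hz hξ) _

theorem IsClassD.measurable_ballKernel {n : ℕ} (hn : 1 ≤ n) {ω : ℝ → ℝ} (h : IsClassD ω) :
    Measurable (Function.uncurry (ballKernel n ω)) := by
  classical
  have h1 := (h.differentiableOn_kernelFun hn).continuousOn.measurable_piecewise (g := (0 : ℂ → ℂ))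
    continuousOn_const Metric.isOpen_ball.measurableSet
  rw [Set.piecewise_eq_indicator] at h1
  have h2 : Continuous fun z : Cn n × Cn n => (inner ℂ z.1 z.2 : ℂ) := by fun_prop
  exact h1.comp h2.measurable

theorem kernelFun_conj (n : ℕ) (ω : ℝ → ℝ) (w : ℂ) :
    kernelFun n ω (conj w) = conj (kernelFun n ω w) := by
  unfold kernelFun
  rw [Complex.conj_tsum]
  refine tsum_congr fun k => ?_
  rw [map_mul, map_pow, Complex.conj_ofReal]

theorem enorm_ballKernel_comm (n : ℕ) (ω : ℝ → ℝ) (z ξ : Cn n) :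
    ‖ballKernel n ω z ξ‖ₑ = ‖ballKernel n ω ξ z‖ₑ := by
  unfold ballKernel
  rw [← inner_conj_symm z ξ]
  by_cases h : (inner ℂ ξ z : ℂ) ∈ Metric.ball (0 : ℂ) 1
  · have h' : conj (inner ℂ ξ z : ℂ) ∈ Metric.ball (0 : ℂ) 1 := by
      rw [mem_ball_zero_iff] at h ⊢
      rwa [RCLike.norm_conj]
    rw [indicator_of_mem h, indicator_of_mem h', kernelFun_conj, RCLike.enorm_conj]
  · have h' : conj (inner ℂ ξ z : ℂ) ∉ Metric.ball (0 : ℂ) 1 := by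
      rw [mem_ball_zero_iff] at h ⊢
      rwa [RCLike.norm_conj]
    rw [indicator_of_notMem h, indicator_of_notMem h']

theorem IsClassD.exists_lintegral_sphere_ballKernel_le {n : ℕ} (hn : 1 ≤ n) {ω : ℝ → ℝ}
    (h : IsClassD ω) :
    ∃ C : ℝ, 0 < C ∧ ∀ z ∈ unitBall n, ∀ s ∈ Ico (0 : ℝ) 1,
      ∫⁻ ζ, ‖ballKernel n ω z (s • ζ)‖ₑ ∂(sphereMeasure n) ≤ ENNReal.ofReal (C / tail ω (‖z‖ * s)) := by
  obtain ⟨C, hC, h1⟩ := h.exists_lintegral_sphere_kernelFun_le hn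
  refine ⟨C, hC, fun z hz s hs => ?_⟩
  obtain ⟨e, he, hze⟩ := exists_unit_smul_eq hn z
  have hz1 : ‖z‖ < 1 := by simpa [unitBall] using hz
  have hρ : ‖z‖ * s ∈ Ico (0 : ℝ) 1 :=
    ⟨mul_nonneg (norm_nonneg _) hs.1, by nlinarith [norm_nonneg z, hs.1, hs.2]⟩
  refine le_trans (lintegral_mono fun ζ => ?_) (h1 _ hρ e he)
  have : (inner ℂ z (s • ζ) : ℂ) = ((‖z‖ * s : ℝ) : ℂ) * inner ℂ e ζ := by
    have h2 : s • ζ = (s : ℂ) • ζ := (Complex.coe_smul s ζ).symm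
    conv_lhs => rw [hze, h2, inner_smul_left, inner_smul_right, Complex.conj_ofReal]
    push_cast
    ring
  rw [ballKernel, this]
  exact enorm_indicator_le_enorm_self _ _

/-! ### Kernel integrals over the shells of the grid -/

theorem lintegral_sphere_mul_radial {n : ℕ} (hn : 1 ≤ n) {F : Cn n → ℝ≥0∞} (hF : Measurable F)
    (g : ℝ → ℝ≥0∞) {s : ℝ} (hs : 0 ≤ s) :
    ∫⁻ ζ, F (s • ζ) * g ‖s • ζ‖ ∂(sphereMeasure n) =
      (∫⁻ ζ, F (s • ζ) ∂(sphereMeasure n)) * g s := by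
  have hFs : Measurable fun ζ => F (s • ζ) := hF.comp (measurable_const_smul s)
  rw [← lintegral_mul_const _ hFs]
  refine lintegral_congr_ae ?_
  filter_upwards [ae_norm_eq_one hn] with ζ hζ
  rw [norm_smul, hζ, mul_one, Real.norm_of_nonneg hs]

/-- The product r s is at most each factor, hence at most the grid point of index min(i, j) + 1, and
one grid step changes ω̂ by at most the factor M. -/
theorem IsRadialWeight.div_tail_mul_le {ω : ℝ → ℝ} (h : IsRadialWeight ω) {Q M C : ℝ}
    (hQ : 1 < Q) (hC : 0 < C) (hM : 0 < M)
    (hw : ∀ j, tail ω (grid Q j) ≤ M * tail ω (grid Q (j + 1))) {i j : ℕ} {r s : ℝ}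
    (hr : r ∈ Ico (grid Q i) (grid Q (i + 1))) (hs : s ∈ Ico (grid Q j) (grid Q (j + 1))) :
    C / tail ω (r * s) ≤ C * M / tail ω (grid Q (min i j)) := by
  have hr0 : 0 ≤ r := (grid_mem hQ i).1.trans hr.1
  have hs0 : 0 ≤ s := (grid_mem hQ j).1.trans hs.1
  have hr1 : r < 1 := hr.2.trans (grid_mem hQ _).2
  have hs1 : s < 1 := hs.2.trans (grid_mem hQ _).2
  have hrs : r * s ≤ grid Q (min i j + 1) := by
    rcases le_total i j with hij | hij
    · rw [min_eq_left hij]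
      exact (mul_le_of_le_one_right hr0 hs1.le).trans hr.2.le
    · rw [min_eq_right hij]
      exact (mul_le_of_le_one_left hs0 hr1.le).trans hs.2.le
  have hrs0 : 0 ≤ r * s := mul_nonneg hr0 hs0
  have h4 := h.tail_anti hrs0 hrs
  have h5 := h.tail_pos ⟨hrs0, hrs.trans_lt (grid_mem hQ _).2⟩
  rw [div_le_div_iff₀ h5 (h.tail_pos (grid_mem hQ (min i j))), mul_assoc]
  exact mul_le_mul_of_nonneg_left ((hw _).trans (mul_le_mul_of_nonneg_left h4 hM.le)) hC.le

/-- Reduces an integral of |B_z| against a radial function to the discrete sum of `tsum_div_min_le`;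
the sequence y is free, so both Schur conditions are covered. -/
theorem lintegral_ballKernel_radial_le {n : ℕ} (hn : 1 ≤ n) {ω : ℝ → ℝ} (h : IsClassD ω) {Q M : ℝ}
    (hQ : 1 < Q) (hM : 0 < M) (hw : ∀ j, tail ω (grid Q j) ≤ M * tail ω (grid Q (j + 1))) :
    ∃ C : ℝ≥0∞, C ≠ ∞ ∧ ∀ {g : ℝ → ℝ≥0∞}, Measurable g → ∀ {y : ℕ → ℝ}, (∀ j, 0 < y j) →
      (∀ j, ∫⁻ s in Ico (grid Q j) (grid Q (j + 1)), ENNReal.ofReal (s ^ (2 * n - 1)) * g s ≤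
        ENNReal.ofReal (y j)) → ∀ (i : ℕ) (z : Cn n), ‖z‖ ∈ Ico (grid Q i) (grid Q (i + 1)) →
      ∫⁻ ξ, ‖ballKernel n ω z ξ‖ₑ * g ‖ξ‖ ∂(normalizedVolume n) ≤
        C * ∑' j, ENNReal.ofReal (y j / tail ω (grid Q (min i j))) := by
  obtain ⟨C, hC, h1⟩ := h.exists_lintegral_sphere_ballKernel_le hn
  refine ⟨((2 * n : ℕ) : ℝ≥0∞) * ENNReal.ofReal (C * M), ENNReal.mul_ne_top (ENNReal.natCast_ne_top _)
    ENNReal.ofReal_ne_top, fun {g} hg {y} hy hgy i z hz => ?_⟩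
  have hKm : Measurable fun ξ => ‖ballKernel n ω z ξ‖ₑ :=
    ((h.measurable_ballKernel hn).comp measurable_prodMk_left).enorm
  have hzB : z ∈ unitBall n := mem_ball_zero_iff.2 (hz.2.trans (grid_mem hQ _).2)
  have hpt : ∀ j, ∀ s ∈ Ico (grid Q j) (grid Q (j + 1)), ENNReal.ofReal (s ^ (2 * n - 1)) *
      ∫⁻ ζ, ‖ballKernel n ω z (s • ζ)‖ₑ * g ‖s • ζ‖ ∂(sphereMeasure n) ≤
      ENNReal.ofReal (C * M / tail ω (grid Q (min i j))) *
        (ENNReal.ofReal (s ^ (2 * n - 1)) * g s) := fun j s hs => by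
    have hs0 : 0 ≤ s := (grid_mem hQ j).1.trans hs.1
    have h2 := (h1 z hzB s ⟨hs0, hs.2.trans (grid_mem hQ _).2⟩).trans
      (ENNReal.ofReal_le_ofReal (h.weight.div_tail_mul_le hQ hC hM hw hz hs))
    rw [lintegral_sphere_mul_radial hn hKm g hs0, mul_left_comm]
    gcongr
  have hFm : Measurable fun ξ => ‖ballKernel n ω z ξ‖ₑ * g ‖ξ‖ := by fun_prop
  rw [lintegral_normalizedVolume hn hFm, mul_assoc]
  refine mul_le_mul_right ?_ _
  rw [← iUnion_Ico_grid hQ, lintegral_iUnion (fun _ => measurableSet_Ico) (pairwise_disjoint_Ico_grid hQ),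
    ← ENNReal.tsum_mul_left]
  refine ENNReal.tsum_le_tsum fun j => ?_
  refine (setLIntegral_mono' measurableSet_Ico (hpt j)).trans ?_
  rw [lintegral_const_mul' _ _ ENNReal.ofReal_ne_top]
  refine (mul_le_mul_right (hgy j) _).trans (le_of_eq ?_)
  have hwm := h.weight.tail_pos (grid_mem hQ (min i j))
  rw [← ENNReal.ofReal_mul (by positivity), ← ENNReal.ofReal_mul (by positivity)]
  congr 1
  ring

/-! ### The Schur weights -/

theorem lintegral_weightedVolume_eq (n : ℕ) {ω : ℝ → ℝ} (hm : Measurable ω) {g : Cn n → ℝ≥0∞}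
    (hg : Measurable g) : ∫⁻ x, g x ∂(weightedVolume n ω) =
      ∫⁻ x, ENNReal.ofReal (ω ‖x‖) * g x ∂(normalizedVolume n) := by
  have hω : Measurable fun x : Cn n => ENNReal.ofReal (ω ‖x‖) :=
    (hm.comp measurable_norm).ennreal_ofReal
  rw [weightedVolume, lintegral_withDensity_eq_lintegral_mul _ hω hg]
  rfl

theorem weightedVolume_eq_withDensity (n : ℕ) {ω υ : ℝ → ℝ} (hω : Measurable ω) (hυ : Measurable υ)
    (hυ0 : ∀ t, 0 < υ t) : weightedVolume n ω =
      (weightedVolume n υ).withDensity fun z => ENNReal.ofReal (ω ‖z‖ / υ ‖z‖) := by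
  have h1 : Measurable fun x : Cn n => ENNReal.ofReal (υ ‖x‖) := by fun_prop
  have h2 : Measurable fun x : Cn n => ENNReal.ofReal (ω ‖x‖ / υ ‖x‖) := by fun_prop
  rw [weightedVolume, weightedVolume, ← withDensity_mul _ h1 h2]
  congr 1
  ext z
  rw [Pi.mul_apply, ← ENNReal.ofReal_mul (hυ0 _).le, mul_div_cancel₀ _ (hυ0 _).ne']

theorem exists_measurable_eq_on_grid {Q : ℝ} (hQ : 1 < Q) (a : ℕ → ℝ) :
    ∃ F : ℝ → ℝ, Measurable F ∧ ∀ j, ∀ s ∈ Ico (grid Q j) (grid Q (j + 1)), F s = a j := by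
  obtain ⟨F, hF, h⟩ := exists_measurable_piecewise
    (fun j => Ico (grid Q j) (grid Q (j + 1))) (fun _ => measurableSet_Ico) (fun j _ => a j)
    (fun _ => measurable_const) (fun i j hij s hs =>
      absurd hs.2 ((pairwise_disjoint_Ico_grid hQ hij).notMem_of_mem_left hs.1))
  exact ⟨F, hF, fun j s hs => h j hs⟩

/-- The two properties that determine φ: φ^p υ/ω is constant on each shell, and ω φ^q is the dual
density up to a shell constant. -/
theorem dual_weight_rpow {p q : ℝ} (hpq : p.HolderConjugate q) {a b y : ℝ} (ha : 0 < a) (hb : 0 < b)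
    (hy : 0 < y) :
    ((a / b) ^ (1 / p) * y ^ (-(1 / p))) ^ p = a / b * y⁻¹ ∧
      a * ((a / b) ^ (1 / p) * y ^ (-(1 / p))) ^ q = a ^ q / b ^ (q - 1) * y ^ (1 - q) := by
  have hp := hpq.pos
  have hpq1 : q / p = q - 1 := hpq.symm.div_conj_eq_sub_one
  constructor
  · rw [Real.mul_rpow (by positivity) (by positivity), ← Real.rpow_mul (by positivity),
      ← Real.rpow_mul hy.le, one_div_mul_cancel hp.ne', neg_mul, one_div_mul_cancel hp.ne',
      Real.rpow_one, Real.rpow_neg_one]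
  · rw [Real.mul_rpow (by positivity) (by positivity), ← Real.rpow_mul (by positivity),
      ← Real.rpow_mul hy.le, neg_mul, one_div_mul_eq_div, hpq1, Real.div_rpow ha.le hb.le, neg_sub,
      ← mul_assoc, mul_div_assoc', mul_comm a, ← Real.rpow_add_one ha.ne', sub_add_cancel]

theorem rpow_neg_conj {p q : ℝ} (hpq : p.HolderConjugate q) {x : ℝ} (hx : 0 < x) :
    (x ^ (-(1 / q))) ^ p = x ^ (1 - p) ∧ (x ^ (-(1 / q))) ^ q = x⁻¹ := by
  have hq := hpq.symm.pos
  have hpq2 : p / q = p - 1 := hpq.div_conj_eq_sub_one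
  constructor
  · rw [← Real.rpow_mul hx.le, neg_mul, one_div_mul_eq_div, hpq2, neg_sub]
  · rw [← Real.rpow_mul hx.le, neg_mul, one_div_mul_cancel hq.ne', Real.rpow_neg_one]

theorem lintegral_dual_weight_le {n : ℕ} {q : ℝ} {ω υ φ : ℝ → ℝ} (hω0 : ∀ t, 0 < ω t)
    {r r' y : ℝ} (hr : 0 ≤ r) (hr' : r' ≤ 1) (hy : 0 < y)
    (hfin : dualTail n q ω υ r ≠ ∞) (hyD : y ^ q = (dualTail n q ω υ r).toReal)
    (hφ : ∀ s ∈ Ico r r', 0 < φ s ∧ ω s * φ s ^ q = ω s ^ q / υ s ^ (q - 1) * y ^ (1 - q)) :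
    ∫⁻ s in Ico r r', ENNReal.ofReal (s ^ (2 * n - 1)) *
      (ENNReal.ofReal (ω s) * ENNReal.ofReal (φ s) ^ q) ≤ ENNReal.ofReal y := by
  calc _ = ∫⁻ s in Ico r r', ENNReal.ofReal (y ^ (1 - q)) *
        ENNReal.ofReal (ω s ^ q / υ s ^ (q - 1) * s ^ (2 * n - 1)) := by
        refine setLIntegral_congr_fun measurableSet_Ico fun s hs => ?_
        obtain ⟨h2, h3⟩ := hφ s hs
        have hs0 : 0 ≤ s := hr.trans hs.1
        have h4 := hω0 s
        rw [ENNReal.ofReal_rpow_of_pos h2, ← ENNReal.ofReal_mul h4.le, h3,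
          ← ENNReal.ofReal_mul (by positivity), ← ENNReal.ofReal_mul (by positivity)]
        congr 1
        ring
    _ ≤ ENNReal.ofReal (y ^ (1 - q)) * dualTail n q ω υ r := by
        rw [lintegral_const_mul' _ _ ENNReal.ofReal_ne_top]
        exact mul_le_mul_right (lintegral_mono_set (Ico_subset_Ico_right hr')) _
    _ = _ := by
        rw [← ENNReal.ofReal_toReal hfin, ← ENNReal.ofReal_mul (by positivity), ← hyD,
          ← Real.rpow_add hy, sub_add_cancel, Real.rpow_one]

theorem lintegral_tail_weight_le {n : ℕ} {p : ℝ} {υ ψ : ℝ → ℝ} (hυ : IsRadialWeight υ)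
    {r r' x : ℝ} (hr : 0 ≤ r) (hr' : r' ≤ 1) (hx : 0 < x)
    (hxV : x ^ p = tail υ r) (hψ : ∀ s ∈ Ico r r', 0 < ψ s ∧ ψ s ^ p = x ^ (1 - p)) :
    ∫⁻ s in Ico r r', ENNReal.ofReal (s ^ (2 * n - 1)) *
      (ENNReal.ofReal (υ s) * ENNReal.ofReal (ψ s) ^ p) ≤ ENNReal.ofReal x := by
  calc _ ≤ ∫⁻ s in Ico r r', ENNReal.ofReal (x ^ (1 - p)) * ENNReal.ofReal (υ s) := by
        refine setLIntegral_mono' measurableSet_Ico fun s hs => ?_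
        obtain ⟨h2, h3⟩ := hψ s hs
        have hs0 : 0 ≤ s := hr.trans hs.1
        have hs1 : s ^ (2 * n - 1) ≤ 1 := pow_le_one₀ hs0 (hs.2.le.trans hr')
        rw [ENNReal.ofReal_rpow_of_pos h2, h3, mul_comm (ENNReal.ofReal (υ s))]
        exact mul_le_of_le_one_left' (ENNReal.ofReal_le_one.2 hs1)
    _ ≤ ENNReal.ofReal (x ^ (1 - p)) * ENNReal.ofReal (tail υ r) := by
        rw [lintegral_const_mul' _ _ ENNReal.ofReal_ne_top, hυ.ofReal_tail hr]
        exact mul_le_mul_right (lintegral_mono_set (Ico_subset_Ico_right hr')) _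
    _ = _ := by
        rw [← ENNReal.ofReal_mul (by positivity), ← hxV, ← Real.rpow_add hx, sub_add_cancel,
          Real.rpow_one]

/-- On shell j take φ = (ω/υ)^(1/p) y_j^(-1/p) and ψ = x_j^(-1/q). The shell integrals of ω φ^q and
υ ψ^p are then at most y_j and x_j, while ψ^q = 1/x_j and φ^p υ/ω = 1/y_j. Both Schur conditions
become instances of the discrete estimate, which is symmetric in x and y. -/
theorem exists_schur_weights {n : ℕ} (hn : 1 ≤ n) {p q : ℝ}
    (hpq : p.HolderConjugate q) {ω υ : ℝ → ℝ}
    (hω : Measurable ω) (hυ : Measurable υ) (hω0 : ∀ t, 0 < ω t) (hυ0 : ∀ t, 0 < υ t)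
    (hωD : IsClassD ω) (hυD : IsClassD υ) (hM : quantityM n p q ω υ < ∞) :
    ∃ φ ψ : ℝ → ℝ, Measurable φ ∧ Measurable ψ ∧ ∃ B : ℝ≥0∞, B ≠ ∞ ∧
      (∀ s ∈ Ico (0 : ℝ) 1, 0 < φ s) ∧
      (∀ z : Cn n, ‖z‖ < 1 → ∫⁻ ξ, ‖ballKernel n ω z ξ‖ₑ *
        (ENNReal.ofReal (ω ‖ξ‖) * ENNReal.ofReal (φ ‖ξ‖) ^ q) ∂(normalizedVolume n) ≤
          B * ENNReal.ofReal (ψ ‖z‖) ^ q) ∧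
      (∀ ξ : Cn n, ‖ξ‖ < 1 → ∫⁻ z, ‖ballKernel n ω ξ z‖ₑ *
        (ENNReal.ofReal (υ ‖z‖) * ENNReal.ofReal (ψ ‖z‖) ^ p) ∂(normalizedVolume n) ≤
          B * (ENNReal.ofReal (φ ‖ξ‖) ^ p * ENNReal.ofReal (υ ‖ξ‖ / ω ‖ξ‖))) := by
  have hq := hpq.symm.pos
  have hp := hpq.pos
  obtain ⟨hfin, -⟩ := quantityM_bound hpq hωD.weight hυD.weight hM
  obtain ⟨Q, hQ, θ, hθ0, hθ1, M, hM0, hgrid⟩ :=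
    exists_grid_decay hpq hω hυ hω0 hυ0 hωD hυD hM
  obtain ⟨C₁, hC₁, hrad⟩ := lintegral_ballKernel_radial_le hn hωD hQ hM0 fun j => (hgrid j).2.2.2
  obtain ⟨w, hw⟩ : ∃ w : ℕ → ℝ, ∀ j, w j = tail ω (grid Q j) := ⟨_, fun _ => rfl⟩
  obtain ⟨x, hx⟩ : ∃ x : ℕ → ℝ, ∀ j, x j = tail υ (grid Q j) ^ (1 / p) := ⟨_, fun _ => rfl⟩
  obtain ⟨y, hy⟩ : ∃ y : ℕ → ℝ, ∀ j, y j = (dualTail n q ω υ (grid Q j)).toReal ^ (1 / q) :=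
    ⟨_, fun _ => rfl⟩
  have hV0 : ∀ j, 0 < tail υ (grid Q j) := fun j => hυD.weight.tail_pos (grid_mem hQ j)
  have hD0 : ∀ j, 0 < (dualTail n q ω υ (grid Q j)).toReal := fun j => ENNReal.toReal_pos
    (dualTail_pos (n := n) (q := q) hω hυ hω0 hυ0 (grid_mem hQ j)).ne' (hfin _ (grid_mem hQ j))
  have hxV : ∀ j, x j ^ p = tail υ (grid Q j) := fun j => by
    rw [hx, ← Real.rpow_mul (hV0 j).le, one_div_mul_cancel hp.ne', Real.rpow_one]
  have hyD : ∀ j, y j ^ q = (dualTail n q ω υ (grid Q j)).toReal := fun j => by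
    rw [hy, ← Real.rpow_mul (hD0 j).le, one_div_mul_cancel hq.ne', Real.rpow_one]
  have hw0 : ∀ j, 0 < w j := fun j => hw j ▸ hωD.weight.tail_pos (grid_mem hQ j)
  have hx0 : ∀ j, 0 < x j := fun j => by rw [hx]; exact Real.rpow_pos_of_pos (hV0 j) _
  have hy0 : ∀ j, 0 < y j := fun j => by rw [hy]; exact Real.rpow_pos_of_pos (hD0 j) _
  simp only [← hw, ← hx, ← hy] at hgrid hrad
  obtain ⟨F, hF, hFg⟩ := exists_measurable_eq_on_grid hQ fun j => y j ^ (-(1 / p))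
  obtain ⟨G, hG, hGg⟩ := exists_measurable_eq_on_grid hQ fun j => x j ^ (-(1 / q))
  have ht1 : ENNReal.ofReal θ < 1 := by
    rw [← ENNReal.ofReal_one]
    exact (ENNReal.ofReal_lt_ofReal_iff one_pos).2 hθ1
  obtain ⟨B, hB⟩ : ∃ B, B = C₁ * (ENNReal.ofReal M * (2 * (1 - ENNReal.ofReal θ)⁻¹)) := ⟨_, rfl⟩
  have hBt : B ≠ ∞ := hB ▸ ENNReal.mul_ne_top hC₁ (ENNReal.mul_ne_top ENNReal.ofReal_ne_top
    (ENNReal.mul_ne_top (by norm_num) (ENNReal.inv_ne_top.2 (tsub_pos_of_lt ht1).ne')))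
  have hsum1 : ∀ i, C₁ * ∑' j, ENNReal.ofReal (y j / w (min i j)) ≤ B * ENNReal.ofReal (x i)⁻¹ :=
    fun i => by
      refine (mul_le_mul_right (tsum_div_min_le hθ0.le hM0.le hx0 hy0 hw0 (fun j => (hgrid j).1)
        (fun j => (hgrid j).2.1) (fun j => (hgrid j).2.2.1) i) _).trans (le_of_eq ?_)
      rw [div_eq_mul_inv, ENNReal.ofReal_mul hM0.le, hB]
      ring
  have hsum2 : ∀ i, C₁ * ∑' j, ENNReal.ofReal (x j / w (min i j)) ≤ B * ENNReal.ofReal (y i)⁻¹ :=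
    fun i => by
      refine (mul_le_mul_right (tsum_div_min_le hθ0.le hM0.le hy0 hx0 hw0 (fun j => (hgrid j).2.1)
        (fun j => (hgrid j).1) (fun j => by rw [mul_comm]; exact (hgrid j).2.2.1) i) _).trans
        (le_of_eq ?_)
      rw [div_eq_mul_inv, ENNReal.ofReal_mul hM0.le, hB]
      ring
  have hφ0 : ∀ j, ∀ s ∈ Ico (grid Q j) (grid Q (j + 1)), 0 < (ω s / υ s) ^ (1 / p) * F s :=
    fun j s hs => by
      have h1 := hω0 s
      have h2 := hυ0 s
      have h3 := hy0 j
      rw [hFg j s hs]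
      positivity
  refine ⟨fun s => (ω s / υ s) ^ (1 / p) * F s, G, by fun_prop, hG, B, hBt, fun s hs => ?_,
    fun z hz => ?_, fun ξ hξ => ?_⟩
  · obtain ⟨j, hj⟩ := exists_mem_Ico_grid hQ hs
    exact hφ0 j s hj
  · obtain ⟨i, hi⟩ := exists_mem_Ico_grid hQ ⟨norm_nonneg z, hz⟩
    have hGi : ENNReal.ofReal (G ‖z‖) ^ q = ENNReal.ofReal (x i)⁻¹ := by
      rw [hGg i _ hi, ENNReal.ofReal_rpow_of_pos (Real.rpow_pos_of_pos (hx0 i) _),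
        (rpow_neg_conj hpq (hx0 i)).2]
    rw [hGi]
    refine (hrad (g := fun s => ENNReal.ofReal (ω s) *
      ENNReal.ofReal ((ω s / υ s) ^ (1 / p) * F s) ^ q) (by fun_prop) hy0
      (fun j => lintegral_dual_weight_le hω0 (grid_mem hQ j).1 (grid_mem hQ _).2.le (hy0 j)
        (hfin _ (grid_mem hQ j)) (hyD j) fun s hs => ⟨hφ0 j s hs, ?_⟩) i z hi).trans (hsum1 i)
    rw [hFg j s hs]
    exact (dual_weight_rpow hpq (hω0 s) (hυ0 s) (hy0 j)).2
  · obtain ⟨i, hi⟩ := exists_mem_Ico_grid hQ ⟨norm_nonneg ξ, hξ⟩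
    have hFi : ENNReal.ofReal ((ω ‖ξ‖ / υ ‖ξ‖) ^ (1 / p) * F ‖ξ‖) ^ p *
        ENNReal.ofReal (υ ‖ξ‖ / ω ‖ξ‖) = ENNReal.ofReal (y i)⁻¹ := by
      have h4 := hω0 ‖ξ‖
      have h5 := hυ0 ‖ξ‖
      have h6 := hy0 i
      rw [ENNReal.ofReal_rpow_of_pos (hφ0 i _ hi), hFg i _ hi,
        (dual_weight_rpow hpq h4 h5 h6).1, ← ENNReal.ofReal_mul (by positivity)]
      congr 1
      field_simp
    rw [hFi]
    refine (hrad (g := fun s => ENNReal.ofReal (υ s) * ENNReal.ofReal (G s) ^ p) (by fun_prop) hx0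
      (fun j => lintegral_tail_weight_le hυD.weight (grid_mem hQ j).1 (grid_mem hQ _).2.le (hx0 j)
        (hxV j) fun s hs => ?_) i ξ hi).trans (hsum2 i)
    rw [hGg j s hs]
    exact ⟨Real.rpow_pos_of_pos (hx0 j) _, (rpow_neg_conj hpq (hx0 j)).1⟩

theorem exists_lintegral_ballKernel_rpow_le {n : ℕ} (hn : 1 ≤ n) {p q : ℝ}
    (hpq : p.HolderConjugate q) {ω υ : ℝ → ℝ}
    (hω : Measurable ω) (hυ : Measurable υ) (hω0 : ∀ t, 0 < ω t) (hυ0 : ∀ t, 0 < υ t)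
    (hωD : IsClassD ω) (hυD : IsClassD υ) (hM : quantityM n p q ω υ < ∞) :
    ∃ C : ℝ≥0∞, C ≠ ∞ ∧ ∀ f : Cn n → ℝ≥0∞, Measurable f →
      ∫⁻ z, (∫⁻ ξ, ‖ballKernel n ω z ξ‖ₑ * f ξ ∂(weightedVolume n ω)) ^ p ∂(weightedVolume n υ) ≤
        C * ∫⁻ ξ, f ξ ^ p ∂(weightedVolume n υ) := by
  have hq := hpq.symm.pos
  have hp := hpq.pos
  have := sigmaFinite_weightedVolume n hω
  have := sigmaFinite_weightedVolume n hυ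
  obtain ⟨φ, ψ, hφ, hψ, B, hBt, hφ0, hA, hB⟩ := exists_schur_weights hn hpq hω hυ hω0 hυ0 hωD hυD hM
  have hKm : Measurable (Function.uncurry fun z ξ => ‖ballKernel n ω z ξ‖ₑ) :=
    (hωD.measurable_ballKernel hn).enorm
  have hKz : ∀ z, Measurable fun ξ => ‖ballKernel n ω z ξ‖ₑ := fun z =>
    ((hωD.measurable_ballKernel hn).comp measurable_prodMk_left).enorm
  have hKξ : ∀ ξ, Measurable fun z => ‖ballKernel n ω z ξ‖ₑ := fun ξ =>
    ((hωD.measurable_ballKernel hn).comp measurable_prodMk_right).enorm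
  have hball : ∀ τ : ℝ → ℝ, ∀ᵐ z ∂(weightedVolume n τ), ‖z‖ < 1 := fun τ => by
    filter_upwards [ae_weightedVolume_mem_unitBall n τ] with z hz
    exact mem_ball_zero_iff.1 hz
  refine ⟨B ^ (p / q) * B, ENNReal.mul_ne_top (ENNReal.rpow_ne_top_of_nonneg (by positivity) hBt) hBt,
    fun f hf => ?_⟩
  -- The factor ρ = υ/ω converts ω dV on the right side of Schur's test back into υ dV.
  have hschur := lintegral_rpow_lintegral_le (μ := weightedVolume n ω) (τ := weightedVolume n υ) hpq
    (K := fun z ξ => ‖ballKernel n ω z ξ‖ₑ) hKm (φ := fun ξ => ENNReal.ofReal (φ ‖ξ‖)) (by fun_prop)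
    (ψ := fun z => ENNReal.ofReal (ψ ‖z‖)) (ρ := fun ξ => ENNReal.ofReal (υ ‖ξ‖ / ω ‖ξ‖))
    (A := B) (B := B) ?_ (ae_of_all _ fun _ => ENNReal.ofReal_ne_top) (by fun_prop) ?_ ?_ hBt hBt hf
  · refine hschur.trans (le_of_eq ?_)
    congr 1
    rw [lintegral_weightedVolume_eq n hω (by fun_prop), lintegral_weightedVolume_eq n hυ (by fun_prop)]
    refine lintegral_congr fun ξ => ?_
    rw [mul_comm (f ξ ^ p), ← mul_assoc, ← ENNReal.ofReal_mul (hω0 _).le,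
      mul_div_cancel₀ _ (hω0 _).ne']
  · filter_upwards [hball ω] with ξ hξ
    exact (ENNReal.ofReal_pos.2 (hφ0 _ ⟨norm_nonneg ξ, hξ⟩)).ne'
  · filter_upwards [hball υ] with z hz
    have hz' := hKz z
    rw [lintegral_weightedVolume_eq n hω (by fun_prop)]
    refine le_trans (le_of_eq (lintegral_congr fun ξ => ?_)) (hA z hz)
    rw [mul_left_comm]
  · filter_upwards [hball ω] with ξ hξ
    have hz' := hKξ ξ
    rw [lintegral_weightedVolume_eq n hυ (by fun_prop)]
    refine le_trans (le_of_eq (lintegral_congr fun z => ?_)) (hB ξ hξ)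
    rw [enorm_ballKernel_comm, mul_left_comm]

/-- Hölder in L^p(υ dV) against the density ω/υ: since (ω/υ)^q υ is the dual density, its q-norm is
finite exactly when the dual tail at 0 is. -/
theorem integrable_of_memLp {n : ℕ} (hn : 1 ≤ n) {p q : ℝ}
    (hpq : p.HolderConjugate q) {ω υ : ℝ → ℝ}
    (hω : Measurable ω) (hυ : Measurable υ) (hω0 : ∀ t, 0 < ω t) (hυ0 : ∀ t, 0 < υ t)
    (hD : dualTail n q ω υ 0 ≠ ∞) {f : Cn n → ℂ}
    (hf : MemLp f (ENNReal.ofReal p) (weightedVolume n υ)) : Integrable f (weightedVolume n ω) := by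
  have hq := hpq.symm.pos
  have hp := hpq.pos
  have hd := weightedVolume_eq_withDensity n hω hυ hυ0
  set g : Cn n → ℝ≥0∞ := fun z => ENNReal.ofReal (ω ‖z‖ / υ ‖z‖) with hg
  have hgm : Measurable g := by fun_prop
  have hac : weightedVolume n ω ≪ weightedVolume n υ := hd ▸ withDensity_absolutelyContinuous _ _
  refine ⟨hf.1.mono_ac hac, ?_⟩
  rw [hasFiniteIntegral_iff_enorm, hd, lintegral_withDensity_eq_lintegral_mul₀ hgm.aemeasurable
    hf.1.enorm]
  refine lt_of_le_of_lt (ENNReal.lintegral_mul_le_Lp_mul_Lq _ hpq.symm hgm.aemeasurable hf.1.enorm)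
    (ENNReal.mul_lt_top (ENNReal.rpow_lt_top_of_nonneg (by positivity) ?_)
      (ENNReal.rpow_lt_top_of_nonneg (by positivity) ?_))
  · rw [lintegral_weightedVolume hn hυ (by fun_prop)]
    refine ENNReal.mul_ne_top (ENNReal.natCast_ne_top _) (ne_of_eq_of_ne ?_ hD)
    refine setLIntegral_congr_fun measurableSet_Ico fun r hr => ?_
    have h1 : ∫⁻ ζ, g (r • ζ) ^ q ∂(sphereMeasure n) = ENNReal.ofReal (ω r / υ r) ^ q := by
      calc _ = ∫⁻ _, ENNReal.ofReal (ω r / υ r) ^ q ∂(sphereMeasure n) := by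
            refine lintegral_congr_ae ?_
            filter_upwards [ae_norm_eq_one hn] with ζ hζ
            simp only [hg, norm_smul, hζ, mul_one, Real.norm_of_nonneg hr.1]
        _ = _ := by simp
    have h2 := hω0 r
    have h3 := hυ0 r
    have hr0 := hr.1
    rw [h1, ENNReal.ofReal_rpow_of_pos (by positivity), ← ENNReal.ofReal_mul (by positivity),
      Real.div_rpow h2.le h3.le, Real.rpow_sub_one h3.ne']
    congr 1
    field_simp
  · have h1 := hf.2
    rw [eLpNorm_lt_top_iff_lintegral_rpow_enorm_lt_top (by simpa using hp) (by simp),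
      ENNReal.toReal_ofReal hp.le] at h1
    exact h1.ne

/-! ### Boundedness of the two projections -/

theorem IsClassD.bergmanKernel_ae_eq_ballKernel {n : ℕ} (hn : 1 ≤ n) {ω : ℝ → ℝ} (h : IsClassD ω)
    (hm : Measurable ω) {z : Cn n} (hz : z ∈ unitBall n) :
    bergmanKernel n ω z =ᵐ[weightedVolume n ω] ballKernel n ω z := by
  filter_upwards [h.bergmanKernel_ae_eq hn hm hz, ae_weightedVolume_mem_unitBall n ω] with ξ h1 h2
  rw [h1, ballKernel_eq hz h2]

theorem IsClassD.bergmanProj_eq {n : ℕ} (hn : 1 ≤ n) {ω : ℝ → ℝ} (h : IsClassD ω)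
    (hm : Measurable ω) (f : Cn n → ℂ) {z : Cn n} (hz : z ∈ unitBall n) :
    bergmanProj n ω f z = ∫ ξ, f ξ * conj (ballKernel n ω z ξ) ∂(weightedVolume n ω) := by
  refine integral_congr_ae ?_
  filter_upwards [h.bergmanKernel_ae_eq_ballKernel hn hm hz] with ξ h1
  rw [h1]

theorem IsClassD.maxBergmanProj_eq {n : ℕ} (hn : 1 ≤ n) {ω : ℝ → ℝ} (h : IsClassD ω)
    (hm : Measurable ω) (f : Cn n → ℂ) {z : Cn n} (hz : z ∈ unitBall n) :
    maxBergmanProj n ω f z =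
      ∫ ξ, f ξ * ((‖ballKernel n ω z ξ‖ : ℝ) : ℂ) ∂(weightedVolume n ω) := by
  refine integral_congr_ae ?_
  filter_upwards [h.bergmanKernel_ae_eq_ballKernel hn hm hz] with ξ h1
  rw [h1]

theorem aestronglyMeasurable_kernel_operator {n : ℕ} {ω υ : ℝ → ℝ} (hω : Measurable ω)
    (hυ : Measurable υ) {κ : Cn n → Cn n → ℂ} (hκ : Measurable (Function.uncurry κ))
    {T f : Cn n → ℂ} (hf : AEStronglyMeasurable f (weightedVolume n ω))
    (hT : ∀ z ∈ unitBall n, T z = ∫ ξ, f ξ * κ z ξ ∂(weightedVolume n ω)) :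
    AEStronglyMeasurable T (weightedVolume n υ) := by
  have := sigmaFinite_weightedVolume n hω
  have := sigmaFinite_weightedVolume n hυ
  have h1 : AEStronglyMeasurable (fun x : Cn n × Cn n => f x.2 * Function.uncurry κ x)
      ((weightedVolume n υ).prod (weightedVolume n ω)) :=
    hf.comp_snd.mul hκ.aestronglyMeasurable
  refine h1.integral_prod_right'.congr ?_
  filter_upwards [ae_weightedVolume_mem_unitBall n υ] with z hz
  exact (hT z hz).symm

theorem isBoundedOnLp_of_kernel {n : ℕ} (hn : 1 ≤ n) {p q : ℝ}
    (hpq : p.HolderConjugate q) {ω υ : ℝ → ℝ}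
    (hω : Measurable ω) (hυ : Measurable υ) (hω0 : ∀ t, 0 < ω t) (hυ0 : ∀ t, 0 < υ t)
    (hωD : IsClassD ω) (hυD : IsClassD υ) (hM : quantityM n p q ω υ < ∞)
    {κ : Cn n → Cn n → ℂ} (hκ : Measurable (Function.uncurry κ))
    (hκK : ∀ z ξ, ‖κ z ξ‖ₑ = ‖ballKernel n ω z ξ‖ₑ) {T : (Cn n → ℂ) → Cn n → ℂ}
    (hT : ∀ f, ∀ z ∈ unitBall n, T f z = ∫ ξ, f ξ * κ z ξ ∂(weightedVolume n ω)) :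
    IsBoundedOnLp n ω υ p T := by
  have hp := hpq.pos
  obtain ⟨C, hC, hCb⟩ := exists_lintegral_ballKernel_rpow_le hn hpq hω hυ hω0 hυ0 hωD hυD hM
  obtain ⟨hfin, -⟩ := quantityM_bound hpq hωD.weight hυD.weight hM
  have hCp : C ^ (1 / p) ≠ ∞ := ENNReal.rpow_ne_top_of_nonneg (by positivity) hC
  refine ⟨(C ^ (1 / p)).toNNReal, fun f hf => ?_⟩
  have hfi := integrable_of_memLp hn hpq hω hυ hω0 hυ0 (hfin 0 ⟨le_rfl, one_pos⟩) hf
  have hTm : AEStronglyMeasurable (T f) (weightedVolume n υ) :=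
    aestronglyMeasurable_kernel_operator hω hυ hκ hfi.1 (hT f)
  have hac : weightedVolume n ω ≪ weightedVolume n υ :=
    weightedVolume_eq_withDensity n hω hυ hυ0 ▸ withDensity_absolutelyContinuous _ _
  -- Schur's test is stated for Borel functions. Equality υ dV-almost everywhere passes to ω dV by
  -- absolute continuity.
  set g := hf.1.mk f
  have hg : f =ᵐ[weightedVolume n υ] g := hf.1.ae_eq_mk
  have hgm : Measurable fun z => ‖g z‖ₑ := hf.1.stronglyMeasurable_mk.measurable.enorm
  have hp0 : ENNReal.ofReal p ≠ 0 := by simpa using hp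
  have hpT : (ENNReal.ofReal p).toReal = p := ENNReal.toReal_ofReal hp.le
  have hbound : eLpNorm (T f) (ENNReal.ofReal p) (weightedVolume n υ) ≤
      (C ^ (1 / p)).toNNReal * eLpNorm f (ENNReal.ofReal p) (weightedVolume n υ) := by
    rw [ENNReal.coe_toNNReal hCp, eLpNorm_eq_lintegral_rpow_enorm_toReal hp0 ENNReal.ofReal_ne_top,
      eLpNorm_eq_lintegral_rpow_enorm_toReal hp0 ENNReal.ofReal_ne_top, hpT,
      ← ENNReal.mul_rpow_of_nonneg _ _ (by positivity)]
    refine ENNReal.rpow_le_rpow ?_ (by positivity)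
    have h1 : ∫⁻ z, ‖f z‖ₑ ^ p ∂(weightedVolume n υ) = ∫⁻ z, ‖g z‖ₑ ^ p ∂(weightedVolume n υ) :=
      lintegral_congr_ae (hg.mono fun z hz => by simp only [hz])
    rw [h1]
    refine le_trans (lintegral_mono_ae ?_) (hCb _ hgm)
    filter_upwards [ae_weightedVolume_mem_unitBall n υ] with z hz
    refine ENNReal.rpow_le_rpow ?_ hp.le
    rw [hT f z hz]
    refine (enorm_integral_le_lintegral_enorm _).trans (le_of_eq (lintegral_congr_ae ?_))
    filter_upwards [hac.ae_le hg] with ξ hξ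
    rw [enorm_mul, hκK, hξ, mul_comm]
  exact ⟨hfi, ⟨hTm, hbound.trans_lt (ENNReal.mul_lt_top ENNReal.coe_lt_top hf.2)⟩, hbound⟩

theorem isBoundedOnLp_maxBergmanProj {n : ℕ} (hn : 1 ≤ n) {p q : ℝ}
    (hpq : p.HolderConjugate q) {ω υ : ℝ → ℝ}
    (hω : Measurable ω) (hυ : Measurable υ) (hω0 : ∀ t, 0 < ω t) (hυ0 : ∀ t, 0 < υ t)
    (hωD : IsClassD ω) (hυD : IsClassD υ) (hM : quantityM n p q ω υ < ∞) :
    IsBoundedOnLp n ω υ p (maxBergmanProj n ω) := by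
  refine isBoundedOnLp_of_kernel hn hpq hω hυ hω0 hυ0 hωD hυD hM
    (κ := fun z ξ => ((‖ballKernel n ω z ξ‖ : ℝ) : ℂ))
    (Complex.measurable_ofReal.comp (hωD.measurable_ballKernel hn).norm) (fun z ξ => ?_)
    fun f z hz => hωD.maxBergmanProj_eq hn hω f hz
  rw [← ofReal_norm, Complex.norm_real, norm_norm, ofReal_norm]

/-- |P f| ≤ P⁺|f| pointwise, and |f| has the same norm as f. Measurability of P f is separate and
uses the closed form of the kernel, since `bergmanKernel` is chosen independently for each z. -/
theorem IsBoundedOnLp.bergmanProj_of_max {n : ℕ} (hn : 1 ≤ n) {p : ℝ} {ω υ : ℝ → ℝ}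
    (hω : Measurable ω) (hυ : Measurable υ) (hωD : IsClassD ω)
    (h : IsBoundedOnLp n ω υ p (maxBergmanProj n ω)) : IsBoundedOnLp n ω υ p (bergmanProj n ω) := by
  obtain ⟨C, hC⟩ := h
  refine ⟨C, fun f hf => ?_⟩
  obtain ⟨h1, -, -⟩ := hC f hf
  have hnf : MemLp (fun z => ((‖f z‖ : ℝ) : ℂ)) (ENNReal.ofReal p) (weightedVolume n υ) :=
    hf.norm.ofReal
  obtain ⟨-, h2, h3⟩ := hC _ hnf
  have h4 : eLpNorm (fun z => ((‖f z‖ : ℝ) : ℂ)) (ENNReal.ofReal p) (weightedVolume n υ) =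
      eLpNorm f (ENNReal.ofReal p) (weightedVolume n υ) :=
    eLpNorm_congr_norm_ae (ae_of_all _ fun z => by rw [Complex.norm_real, norm_norm])
  rw [h4] at h3
  have hle : eLpNorm (bergmanProj n ω f) (ENNReal.ofReal p) (weightedVolume n υ) ≤
      eLpNorm (maxBergmanProj n ω fun z => ((‖f z‖ : ℝ) : ℂ)) (ENNReal.ofReal p)
        (weightedVolume n υ) := by
    refine eLpNorm_mono fun z => ?_
    rw [bergmanProj, maxBergmanProj]
    refine (norm_integral_le_integral_norm _).trans ?_
    have : ∀ ξ, ((‖f ξ‖ : ℝ) : ℂ) * ((‖bergmanKernel n ω z ξ‖ : ℝ) : ℂ) =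
        ((‖f ξ * conj (bergmanKernel n ω z ξ)‖ : ℝ) : ℂ) := fun ξ => by
      rw [norm_mul, RCLike.norm_conj]
      push_cast
      rfl
    simp only [this]
    rw [integral_complex_ofReal, Complex.norm_real]
    exact le_abs_self _
  refine ⟨h1, ⟨?_, (hle.trans h3).trans_lt (ENNReal.mul_lt_top ENNReal.coe_lt_top hf.2)⟩,
    hle.trans h3⟩
  exact aestronglyMeasurable_kernel_operator hω hυ (κ := fun z ξ => conj (ballKernel n ω z ξ))
    (RCLike.continuous_conj.measurable.comp (hωD.measurable_ballKernel hn)) h1.1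
    fun z hz => hωD.bergmanProj_eq hn hω f hz

/-! ### The projection of radial multiples of monomials -/

/-- The Taylor coefficient of the kernel along e does not depend on the measure of integration; only
the norm of the power does. Taking τ = ω and using the reproducing property identifies that
coefficient, so for general τ a ratio of moments remains. -/
theorem IsClassD.integral_kernel_mul_conj_inner_pow {n : ℕ} (hn : 1 ≤ n) {ω : ℝ → ℝ} (h : IsClassD ω)
    (hm : Measurable ω) {τ : ℝ → ℝ} (hτ : IsRadialWeight τ) (hτm : Measurable τ) {e : Cn n}
    (he : ‖e‖ = 1) {z : Cn n} (hz : z ∈ unitBall n) (k : ℕ) :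
    ∫ ξ, kernelFun n ω (inner ℂ z ξ) * conj (inner ℂ e ξ : ℂ) ^ k ∂(weightedVolume n τ) =
      conj (inner ℂ e z : ℂ) ^ k * ((ballMoment n τ k / ballMoment n ω k : ℝ) : ℂ) := by
  have hfin := h.weight.isFiniteMeasure hn hm
  have hfinτ := hτ.isFiniteMeasure hn hτm
  have hB := h.memBergmanTwo_kernel hn hm hz
  have hz1 : ‖z‖ < 1 := mem_ball_zero_iff.1 hz
  have hint : Integrable (fun ξ => kernelFun n ω (inner ℂ z ξ)) (weightedVolume n τ) := by
    refine Integrable.of_bound (hB.1.aestronglyMeasurable_weightedVolume τ)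
      (∑' k, kernelCoeff n ω k * ‖z‖ ^ k) ?_
    filter_upwards [ae_weightedVolume_mem_unitBall n τ] with ξ hξ
    exact h.norm_kernelFun_le hn hz1 (norm_inner_le_left hξ)
  have h1 := integral_mul_conj_inner_pow hn hτ hτm he hB.1 hint k
  have h2 := integral_mul_conj_inner_pow hn h.weight hm he hB.1 (hB.2.integrable (by norm_num)) k
  have hpow : MemBergmanTwo n ω fun ξ => (inner ℂ e ξ : ℂ) ^ k := by
    refine ⟨Differentiable.differentiableOn (by
      have : Differentiable ℂ fun ξ : Cn n => (innerSL ℂ e ξ : ℂ) := (innerSL ℂ e).differentiable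
      exact this.pow k), MemLp.of_bound (Continuous.aestronglyMeasurable (by fun_prop)) 1 ?_⟩
    filter_upwards [ae_weightedVolume_mem_unitBall n ω] with ξ hξ
    rw [norm_pow]
    exact pow_le_one₀ (norm_nonneg _) (he ▸ norm_inner_le_left hξ)
  have h3 := (h.isReproducingAt_kernel hn hm hz).2 _ hpow
  have h4 : ∫ ξ, kernelFun n ω (inner ℂ z ξ) * conj (inner ℂ e ξ : ℂ) ^ k ∂(weightedVolume n ω) =
      conj (inner ℂ e z : ℂ) ^ k := by
    rw [← map_pow, h3, ← integral_conj]
    refine integral_congr_ae (ae_of_all _ fun ξ => ?_)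
    simp only [map_mul, map_pow, RingHomCompTriple.comp_apply, RingHom.id_apply]
    ring
  rw [h4] at h2
  have hc := h.weight.kernelCoeff_pos hn k
  have hcτ := hτ.kernelCoeff_pos hn k
  have hm1 := h.weight.ballMoment_pos n k
  have hm2 := hτ.ballMoment_pos n k
  have h5 : ((k.factorial : ℂ)⁻¹ *
      iteratedDeriv k (fun l : ℂ => kernelFun n ω (inner ℂ z (l • e))) 0) =
      conj (inner ℂ e z : ℂ) ^ k * (kernelCoeff n ω k : ℂ) := by
    have : (kernelCoeff n ω k : ℂ) ≠ 0 := by exact_mod_cast hc.ne'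
    rw [h2, mul_assoc, ← Complex.ofReal_mul, inv_mul_cancel₀ hc.ne', Complex.ofReal_one, mul_one]
  rw [h1, h5, mul_assoc, ← Complex.ofReal_mul]
  congr 2
  have h6 : ((k + (n - 1)).choose (n - 1) : ℝ) ≠ 0 := by
    exact_mod_cast (Nat.choose_pos (by omega)).ne'
  have h7 : (n : ℝ) ≠ 0 := by exact_mod_cast (by omega : n ≠ 0)
  unfold kernelCoeff
  field_simp

/-- As g may vanish, g ω need not be a radial weight. The identity is applied to (g+1) ω and to ω,
and the two are subtracted. -/
theorem IsClassD.bergmanProj_radial {n : ℕ} (hn : 1 ≤ n) {ω : ℝ → ℝ} (h : IsClassD ω)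
    (hm : Measurable ω) (hω0 : ∀ t, 0 < ω t) {e : Cn n} (he : ‖e‖ = 1) {z : Cn n}
    (hz : z ∈ unitBall n) (k : ℕ) {g : ℝ → ℝ} (hg : Measurable g) (hg0 : ∀ s, 0 ≤ g s) {b : ℝ}
    (hgb : ∀ s, g s ≤ b) :
    bergmanProj n ω (fun ξ => (g ‖ξ‖ : ℂ) * (inner ℂ e ξ : ℂ) ^ k) z =
      (inner ℂ e z : ℂ) ^ k * ((ballMoment n (fun s => g s * ω s) k / ballMoment n ω k : ℝ) : ℂ) := by
  have hfin := h.weight.isFiniteMeasure hn hm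
  set τ : ℝ → ℝ := fun s => (g s + 1) * ω s with hτ
  have hgω : IntegrableOn (fun s => g s * ω s) (Ico 0 1) :=
    Integrable.bdd_mul (c := b) h.weight.integrable hg.aestronglyMeasurable
      (ae_of_all _ fun s => by rw [Real.norm_of_nonneg (hg0 s)]; exact hgb s)
  have hτm : Measurable τ := by fun_prop
  have hτw : IsRadialWeight τ := by
    refine ⟨fun t _ => mul_pos (by linarith [hg0 t]) (hω0 t), ?_⟩
    refine (hgω.add h.weight.integrable).congr (ae_of_all _ fun s => ?_)
    simp only [Pi.add_apply, hτ]
    ring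
  have hB := h.memBergmanTwo_kernel hn hm hz
  have h1 := h.integral_kernel_mul_conj_inner_pow hn hm hτw hτm he hz k
  have h2 := h.integral_kernel_mul_conj_inner_pow hn hm h.weight hm he hz k
  have hgm : Measurable fun z : Cn n => ENNReal.ofReal (τ ‖z‖ / ω ‖z‖) := by fun_prop
  rw [weightedVolume_eq_withDensity n hτm hm hω0, integral_withDensity_eq_integral_toReal_smul hgm
    (ae_of_all _ fun _ => ENNReal.ofReal_lt_top)] at h1
  have hz1 : ‖z‖ < 1 := mem_ball_zero_iff.1 hz
  set F : Cn n → ℂ := fun ξ => kernelFun n ω (inner ℂ z ξ) * conj (inner ℂ e ξ : ℂ) ^ k with hF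
  have hconj : Continuous fun w : Cn n => conj (inner ℂ e w : ℂ) :=
    Complex.continuous_conj.comp (by fun_prop)
  have hFm : AEStronglyMeasurable F (weightedVolume n ω) :=
    hB.2.1.mul (hconj.pow k).aestronglyMeasurable
  have hFb : ∀ᵐ ξ ∂(weightedVolume n ω), ‖F ξ‖ ≤ ∑' k, kernelCoeff n ω k * ‖z‖ ^ k := by
    filter_upwards [ae_weightedVolume_mem_unitBall n ω] with ξ hξ
    rw [hF, norm_mul, norm_pow, RCLike.norm_conj]
    have h3 := h.norm_kernelFun_le hn hz1 (norm_inner_le_left (z := z) hξ)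
    exact (mul_le_of_le_one_right (norm_nonneg _)
      (pow_le_one₀ (norm_nonneg _) (he ▸ norm_inner_le_left hξ))).trans h3
  have hFi : Integrable F (weightedVolume n ω) := Integrable.of_bound hFm _ hFb
  have hgF : Integrable (fun ξ => (g ‖ξ‖ : ℂ) * F ξ) (weightedVolume n ω) :=
    hFi.bdd_mul (c := b) (Measurable.aestronglyMeasurable (by fun_prop)) (ae_of_all _ fun ξ => by
      rw [Complex.norm_real, Real.norm_of_nonneg (hg0 _)]; exact hgb _)
  have h4 : ∫ ξ, (ENNReal.ofReal (τ ‖ξ‖ / ω ‖ξ‖)).toReal • F ξ ∂(weightedVolume n ω) =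
      (∫ ξ, (g ‖ξ‖ : ℂ) * F ξ ∂(weightedVolume n ω)) + ∫ ξ, F ξ ∂(weightedVolume n ω) := by
    rw [← integral_add hgF hFi]
    refine integral_congr_ae (ae_of_all _ fun ξ => ?_)
    have h5 : τ ‖ξ‖ / ω ‖ξ‖ = g ‖ξ‖ + 1 := by
      rw [hτ, mul_div_assoc, div_self (hω0 _).ne', mul_one]
    simp only
    rw [h5, ENNReal.toReal_ofReal (by linarith [hg0 ‖ξ‖]), Complex.real_smul]
    push_cast
    ring
  have h5 : ballMoment n τ k = ballMoment n (fun s => g s * ω s) k + ballMoment n ω k := by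
    unfold ballMoment moment
    rw [← integral_add]
    · refine integral_congr_ae (ae_of_all _ fun s => ?_)
      simp only [hτ]
      ring
    · refine Integrable.bdd_mul (c := 1) hgω (Continuous.aestronglyMeasurable (by fun_prop)) ?_
      filter_upwards [ae_restrict_mem measurableSet_Ico] with s hs
      rw [norm_pow, Real.norm_of_nonneg hs.1]
      exact pow_le_one₀ hs.1 hs.2.le
    · exact h.weight.integrableOn_mul (by fun_prop)
  have hm1 := h.weight.ballMoment_pos n k
  have h6 : ∫ ξ, (g ‖ξ‖ : ℂ) * F ξ ∂(weightedVolume n ω) = conj (inner ℂ e z : ℂ) ^ k *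
      ((ballMoment n (fun s => g s * ω s) k / ballMoment n ω k : ℝ) : ℂ) := by
    rw [h4, h2, h5] at h1
    rw [eq_sub_of_add_eq h1, ← mul_sub, ← Complex.ofReal_sub]
    congr 2
    ring
  have h7 : bergmanProj n ω (fun ξ => (g ‖ξ‖ : ℂ) * (inner ℂ e ξ : ℂ) ^ k) z =
      conj (∫ ξ, (g ‖ξ‖ : ℂ) * F ξ ∂(weightedVolume n ω)) := by
    rw [← integral_conj]
    refine integral_congr_ae ?_
    filter_upwards [h.bergmanKernel_ae_eq hn hm hz] with ξ hξ
    simp only [hξ, hF, map_mul, map_pow, Complex.conj_ofReal, Complex.conj_conj]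
    ring
  rw [h7, h6, map_mul, map_pow, Complex.conj_conj, Complex.conj_ofReal]

/-! ### Norms of radial multiples of powers of a coordinate -/

theorem lintegral_radial_mul_inner_rpow {n : ℕ} (hn : 1 ≤ n) {υ : ℝ → ℝ} (hυ : Measurable υ)
    (e : Cn n) {u : ℝ → ℝ≥0∞} (hu : Measurable u) {t : ℝ} (ht : 0 ≤ t) :
    ∫⁻ ξ, u ‖ξ‖ * ‖(inner ℂ e ξ : ℂ)‖ₑ ^ t ∂(weightedVolume n υ) =
      ((2 * n : ℕ) : ℝ≥0∞) * (∫⁻ ζ, ‖(inner ℂ e ζ : ℂ)‖ₑ ^ t ∂(sphereMeasure n)) *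
        ∫⁻ s in Ico (0 : ℝ) 1, ENNReal.ofReal (s ^ (2 * n - 1) * υ s) *
          (u s * ENNReal.ofReal s ^ t) := by
  have hI : Measurable fun ζ : Cn n => ‖(inner ℂ e ζ : ℂ)‖ₑ ^ t := by fun_prop
  have hO : Measurable fun s : ℝ => ENNReal.ofReal (s ^ (2 * n - 1) * υ s) *
    (u s * ENNReal.ofReal s ^ t) := by fun_prop
  rw [lintegral_weightedVolume hn hυ (by fun_prop), mul_assoc, ← lintegral_const_mul _ hO]
  congr 1
  refine setLIntegral_congr_fun measurableSet_Ico fun s hs => ?_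
  have h1 : ∀ ζ, ‖(inner ℂ e (s • ζ) : ℂ)‖ₑ ^ t =
      ENNReal.ofReal s ^ t * ‖(inner ℂ e ζ : ℂ)‖ₑ ^ t := fun ζ => by
    rw [← Complex.coe_smul, inner_smul_right, enorm_mul, ENNReal.mul_rpow_of_nonneg _ _ ht,
      ← ofReal_norm (s : ℂ), Complex.norm_real, Real.norm_of_nonneg hs.1]
  have h2 : ∫⁻ ζ, u ‖s • ζ‖ * ‖(inner ℂ e (s • ζ) : ℂ)‖ₑ ^ t ∂(sphereMeasure n) =
      u s * ENNReal.ofReal s ^ t * ∫⁻ ζ, ‖(inner ℂ e ζ : ℂ)‖ₑ ^ t ∂(sphereMeasure n) := by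
    rw [← lintegral_const_mul _ hI]
    refine lintegral_congr_ae ?_
    filter_upwards [ae_norm_eq_one hn] with ζ hζ
    rw [h1, norm_smul, hζ, mul_one, Real.norm_of_nonneg hs.1, mul_assoc]
  rw [h2]
  ring

theorem lintegral_sphere_inner_rpow_pos {n : ℕ} (hn : 1 ≤ n) {e : Cn n} (he : ‖e‖ = 1) {t : ℝ}
    (ht : 0 ≤ t) : ∫⁻ ζ, ‖(inner ℂ e ζ : ℂ)‖ₑ ^ t ∂(sphereMeasure n) ≠ 0 := by
  intro h0
  rw [lintegral_eq_zero_iff (by fun_prop)] at h0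
  have h1 := lintegral_sphereMeasure_pow hn he 1
  have h2 : ∫⁻ ζ, ‖(inner ℂ e ζ : ℂ)‖ₑ ^ (2 * 1) ∂(sphereMeasure n) = 0 := by
    refine (lintegral_congr_ae ?_).trans lintegral_zero
    filter_upwards [h0] with ζ hζ
    rcases (ENNReal.rpow_eq_zero_iff.1 hζ) with h | h
    · rw [h.1]; simp
    · exact absurd h.2 (not_lt.2 ht)
  rw [h2] at h1
  exact ENNReal.inv_ne_zero.2 (ENNReal.natCast_ne_top _) h1.symm

theorem lintegral_sphere_inner_rpow_ne_top {n : ℕ} (hn : 1 ≤ n) {e : Cn n} (he : ‖e‖ = 1) {t : ℝ}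
    (ht : 0 ≤ t) : ∫⁻ ζ, ‖(inner ℂ e ζ : ℂ)‖ₑ ^ t ∂(sphereMeasure n) ≠ ∞ := by
  refine ne_top_of_le_ne_top ENNReal.one_ne_top ?_
  calc ∫⁻ ζ, ‖(inner ℂ e ζ : ℂ)‖ₑ ^ t ∂(sphereMeasure n) ≤ ∫⁻ _, 1 ∂(sphereMeasure n) := by
        refine lintegral_mono_ae ?_
        filter_upwards [ae_norm_inner_le_one hn he] with ζ hζ
        refine ENNReal.rpow_le_one ?_ ht
        rw [← ofReal_norm]
        exact ENNReal.ofReal_le_one.2 hζ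
    _ = 1 := by simp

/-- Testing the boundedness of the Bergman projection on `g(|ξ|) ⟨ξ, e⟩ᵏ`. -/
theorem ofReal_ballMoment_div_rpow_le {n : ℕ} (hn : 1 ≤ n) {p : ℝ} (hp : 0 < p) {ω υ : ℝ → ℝ}
    (hω : Measurable ω) (hυ : Measurable υ) (hω0 : ∀ t, 0 < ω t)
    (hωD : IsClassD ω) (hυD : IsClassD υ) {C : ℝ≥0}
    (hC : ∀ f : Cn n → ℂ, MemLp f (ENNReal.ofReal p) (weightedVolume n υ) →
      eLpNorm (bergmanProj n ω f) (ENNReal.ofReal p) (weightedVolume n υ) ≤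
        C * eLpNorm f (ENNReal.ofReal p) (weightedVolume n υ)) (k : ℕ) {g : ℝ → ℝ}
    (hg : Measurable g) (hg0 : ∀ s, 0 ≤ g s) {b : ℝ} (hgb : ∀ s, g s ≤ b) :
    ENNReal.ofReal (ballMoment n (fun s => g s * ω s) k / ballMoment n ω k) ^ p *
        ∫⁻ s in Ico (0 : ℝ) 1, ENNReal.ofReal (s ^ (2 * n - 1) * υ s) * ENNReal.ofReal s ^ (k * p) ≤
      (C : ℝ≥0∞) ^ p * ∫⁻ s in Ico (0 : ℝ) 1, ENNReal.ofReal (s ^ (2 * n - 1) * υ s) *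
        (ENNReal.ofReal (g s) ^ p * ENNReal.ofReal s ^ (k * p)) := by
  have hfin := hυD.weight.isFiniteMeasure hn hυ
  set e := baseVec hn
  have he : ‖e‖ = 1 := norm_baseVec hn
  set f : Cn n → ℂ := fun ξ => (g ‖ξ‖ : ℂ) * (inner ℂ e ξ : ℂ) ^ k with hf
  set a := ballMoment n (fun s => g s * ω s) k / ballMoment n ω k with ha
  have ha0 : 0 ≤ a := by
    refine div_nonneg (setIntegral_nonneg measurableSet_Ico fun s hs => ?_)
      (hωD.weight.ballMoment_pos n k).le
    exact mul_nonneg (pow_nonneg hs.1 _) (mul_nonneg (hg0 s) (hω0 s).le)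
  have hfm : MemLp f (ENNReal.ofReal p) (weightedVolume n υ) := by
    refine MemLp.of_bound (Measurable.aestronglyMeasurable (by fun_prop)) b ?_
    filter_upwards [ae_weightedVolume_mem_unitBall n υ] with ξ hξ
    rw [hf, norm_mul, norm_pow, Complex.norm_real, Real.norm_of_nonneg (hg0 _)]
    exact (mul_le_of_le_one_right (hg0 _)
      (pow_le_one₀ (norm_nonneg _) (he ▸ norm_inner_le_left hξ))).trans (hgb _)
  have key := hC f hfm
  have hp0 : ENNReal.ofReal p ≠ 0 := by simpa using hp
  have hpT : (ENNReal.ofReal p).toReal = p := ENNReal.toReal_ofReal hp.le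
  have e2 : ∀ a : ℝ≥0∞, (a ^ (1 / p)) ^ p = a := fun a => by
    rw [← ENNReal.rpow_mul, one_div_mul_cancel hp.ne', ENNReal.rpow_one]
  rw [eLpNorm_eq_lintegral_rpow_enorm_toReal hp0 ENNReal.ofReal_ne_top,
    eLpNorm_eq_lintegral_rpow_enorm_toReal hp0 ENNReal.ofReal_ne_top, hpT] at key
  have key2 := ENNReal.rpow_le_rpow key hp.le
  rw [ENNReal.mul_rpow_of_nonneg _ _ hp.le, e2, e2] at key2
  have hkp : 0 ≤ (k : ℝ) * p := by positivity
  have hpowk : ∀ w : ℂ, (‖w‖ₑ ^ k) ^ p = ‖w‖ₑ ^ (k * p : ℝ) := fun w => by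
    rw [← ENNReal.rpow_natCast, ← ENNReal.rpow_mul]
  have hL : ∫⁻ z, ‖bergmanProj n ω f z‖ₑ ^ p ∂(weightedVolume n υ) =
      ∫⁻ z, ENNReal.ofReal a ^ p * ‖(inner ℂ e z : ℂ)‖ₑ ^ (k * p : ℝ) ∂(weightedVolume n υ) := by
    refine lintegral_congr_ae ?_
    filter_upwards [ae_weightedVolume_mem_unitBall n υ] with z hz
    rw [hf, hωD.bergmanProj_radial hn hω hω0 he hz k hg hg0 hgb, enorm_mul, enorm_pow,
      ENNReal.mul_rpow_of_nonneg _ _ hp.le, hpowk, mul_comm, ← ofReal_norm (Complex.ofReal _),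
      Complex.norm_real, Real.norm_of_nonneg ha0]
  have hR : ∫⁻ z, ‖f z‖ₑ ^ p ∂(weightedVolume n υ) =
      ∫⁻ z, ENNReal.ofReal (g ‖z‖) ^ p * ‖(inner ℂ e z : ℂ)‖ₑ ^ (k * p : ℝ) ∂(weightedVolume n υ) := by
    refine lintegral_congr fun z => ?_
    rw [hf, enorm_mul, enorm_pow, ENNReal.mul_rpow_of_nonneg _ _ hp.le, hpowk,
      ← ofReal_norm (Complex.ofReal _), Complex.norm_real, Real.norm_of_nonneg (hg0 _)]
  rw [hL, hR, lintegral_radial_mul_inner_rpow hn hυ e (u := fun _ => ENNReal.ofReal a ^ p)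
    measurable_const hkp, lintegral_radial_mul_inner_rpow hn hυ e
    (u := fun s => ENNReal.ofReal (g s) ^ p) (by fun_prop) hkp] at key2
  -- The spherical integral occurs on both sides; being positive and finite, it cancels.
  set S := ((2 * n : ℕ) : ℝ≥0∞) * ∫⁻ ζ, ‖(inner ℂ e ζ : ℂ)‖ₑ ^ (k * p : ℝ) ∂(sphereMeasure n)
  have hS0 : S ≠ 0 := mul_ne_zero (by exact_mod_cast (by omega : 2 * n ≠ 0))
    (lintegral_sphere_inner_rpow_pos hn he hkp)
  have hSt : S ≠ ∞ := ENNReal.mul_ne_top (ENNReal.natCast_ne_top _)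
    (lintegral_sphere_inner_rpow_ne_top hn he hkp)
  rw [mul_left_comm, ENNReal.mul_le_mul_iff_right hS0 hSt] at key2
  refine le_trans (le_of_eq ?_) key2
  rw [← lintegral_const_mul' _ _ (ENNReal.rpow_ne_top_of_nonneg hp.le ENNReal.ofReal_ne_top)]
  exact lintegral_congr fun s => by ring

/-- Taking k + 1 = ⌊1/(1-r)⌋ keeps r^k ≥ 1/e while the moment is already controlled by the tail at
r. The final alternative keeps s^(-k) bounded on [r, 1), as the test profile requires. -/
theorem IsClassD.exists_ballMoment_le_tail {n : ℕ} (hn : 1 ≤ n) {ω : ℝ → ℝ} (h : IsClassD ω) :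
    ∃ C : ℝ, 0 < C ∧ ∀ r ∈ Ico (0 : ℝ) 1, ∃ k : ℕ, ballMoment n ω k ≤ C * tail ω r ∧
      1 ≤ Real.exp 1 * r ^ k ∧ (k = 0 ∨ 1 / 2 ≤ r) := by
  obtain ⟨C, hC, hb⟩ := h.exists_moment_le_tail
  refine ⟨C, hC, fun r hr => ?_⟩
  have hr1 : 0 < 1 - r := by linarith [hr.2]
  have h1 : 1 ≤ 1 / (1 - r) := by rw [one_le_div hr1]; linarith [hr.1]
  obtain ⟨k, hk⟩ : ∃ k, ⌊1 / (1 - r)⌋₊ = k + 1 :=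
    ⟨⌊1 / (1 - r)⌋₊ - 1, by have := Nat.one_le_floor_iff _ |>.2 h1; omega⟩
  have h2 : ((k + 1 : ℕ) : ℝ) ≤ 1 / (1 - r) := hk ▸ Nat.floor_le (by positivity)
  have h3 : 1 / (1 - r) < ((k + 1 : ℕ) : ℝ) + 1 := hk ▸ Nat.lt_floor_add_one _
  push_cast at h2 h3
  have hk0 : (0 : ℝ) < (k : ℝ) + 1 := by positivity
  rw [le_div_iff₀ hr1] at h2
  rw [div_lt_iff₀ hr1] at h3
  refine ⟨k, ?_, ?_, ?_⟩
  · refine (h.weight.moment_anti (by omega : k + 1 ≤ 2 * k + (2 * n - 1))).trans ((hb (k + 1)).trans ?_)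
    refine mul_le_mul_of_nonneg_left (h.weight.tail_anti hr.1 ?_) hC.le
    push_cast
    have : 1 / ((k : ℝ) + 1 + 1) ≤ 1 - r := by
      rw [div_le_iff₀ (by positivity)]; nlinarith
    linarith
  · refine (one_le_exp_mul_one_sub_inv_pow k).trans
      (mul_le_mul_of_nonneg_left (pow_le_pow_left₀ ?_ ?_ k) (Real.exp_pos 1).le)
    · have : 1 / ((k : ℝ) + 1) ≤ 1 := by
        rw [div_le_one hk0]; linarith [(Nat.cast_nonneg k : (0 : ℝ) ≤ k)]
      linarith
    · have : 1 - r ≤ 1 / ((k : ℝ) + 1) := by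
        rw [le_div_iff₀ hk0]; linarith
      linarith
  · rcases Nat.eq_zero_or_pos k with h0 | h0
    · exact Or.inl h0
    · right
      have : (1 : ℝ) ≤ k := by exact_mod_cast h0
      nlinarith

theorem lintegral_pow_mul_rpow_ge {n k : ℕ} {p : ℝ} (hp : 0 ≤ p) {υ : ℝ → ℝ} (hυ : IsRadialWeight υ)
    (hυ0 : ∀ t, 0 < υ t) {r ρ : ℝ} (hr : 0 ≤ r) (hrρ : r ≤ ρ) :
    ENNReal.ofReal (ρ ^ (2 * n - 1) * (r ^ k) ^ p * tail υ ρ) ≤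
      ∫⁻ s in Ico (0 : ℝ) 1, ENNReal.ofReal (s ^ (2 * n - 1) * υ s) * ENNReal.ofReal s ^ (k * p) := by
  have hρ : 0 ≤ ρ := hr.trans hrρ
  rw [ENNReal.ofReal_mul (by positivity), hυ.ofReal_tail hρ,
    ← lintegral_const_mul' _ _ ENNReal.ofReal_ne_top]
  refine le_trans ?_ (lintegral_mono_set (Ico_subset_Ico_left hρ))
  refine setLIntegral_mono' measurableSet_Ico fun s hs => ?_
  have hs0 : 0 ≤ s := hρ.trans hs.1
  have h1 := hυ0 s
  rw [ENNReal.ofReal_rpow_of_nonneg hs0 (by positivity), ← ENNReal.ofReal_mul (by positivity),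
    ← ENNReal.ofReal_mul (by positivity)]
  refine ENNReal.ofReal_le_ofReal ?_
  rw [Real.rpow_mul hs0, Real.rpow_natCast]
  calc ρ ^ (2 * n - 1) * (r ^ k) ^ p * υ s ≤ s ^ (2 * n - 1) * (s ^ k) ^ p * υ s := by
        gcongr
        · exact hs.1
        · exact hrρ.trans hs.1
    _ = _ := by ring

/-- The truncated test profile. -/
theorem exists_test_profile {n k : ℕ} {p q : ℝ} (hpq : p.HolderConjugate q) {ω υ : ℝ → ℝ}
    (hω : Measurable ω) (hυ : Measurable υ) (hω0 : ∀ t, 0 < ω t) (hυ0 : ∀ t, 0 < υ t)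
    (hωw : IsRadialWeight ω) {r : ℝ} (hr : 0 ≤ r) (hk : k = 0 ∨ 1 / 2 ≤ r) (m : ℕ) :
    ∃ g : ℝ → ℝ, Measurable g ∧ (∀ s, 0 ≤ g s) ∧ (∃ b, ∀ s, g s ≤ b) ∧ ∃ I : ℝ≥0∞, I ≠ ∞ ∧
      I = ∫⁻ s in Ico r 1 ∩ {s | ω s / υ s ≤ m},
        ENNReal.ofReal (ω s ^ q / υ s ^ (q - 1) * s ^ (2 * n - 1)) ∧
      ∫⁻ s in Ico (0 : ℝ) 1, ENNReal.ofReal (s ^ (2 * n - 1) * υ s) *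
        (ENNReal.ofReal (g s) ^ p * ENNReal.ofReal s ^ (k * p)) = I ∧
      ENNReal.ofReal (r ^ k) * I ≤ ENNReal.ofReal (ballMoment n (fun s => g s * ω s) k) := by
  have hp := hpq.pos
  have hq1 : 0 ≤ q - 1 := sub_nonneg.2 hpq.symm.lt.le
  set E : Set ℝ := Ico r 1 ∩ {s | ω s / υ s ≤ m} with hE
  have hEm : MeasurableSet E :=
    measurableSet_Ico.inter (measurableSet_le (hω.div hυ) measurable_const)
  have hE01 : E ⊆ Ico 0 1 := fun s hs => ⟨hr.trans hs.1.1, hs.1.2⟩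
  -- (ω/υ)^(q-1) is the extremal of Hölder's inequality, and s^(-k) offsets the radial part of the
  -- power, so that the p-norm reproduces the dual integral. Truncation to ω/υ ≤ m keeps the profile
  -- bounded.
  set G : ℝ → ℝ := fun s => (ω s / υ s) ^ (q - 1) * (s ^ k)⁻¹ with hG
  have hGm : Measurable G := by fun_prop
  set g : ℝ → ℝ := E.indicator G with hg
  have hgm : Measurable g := hGm.indicator hEm
  have hskpos : ∀ s ∈ E, 0 < s ^ k := fun s hs => by
    rcases hk with rfl | hk
    · simp
    · have : 0 < s := by linarith [hs.1.1]
      positivity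
  have hrat : ∀ s, 0 < ω s / υ s := fun s => div_pos (hω0 s) (hυ0 s)
  have hG0 : ∀ s ∈ E, 0 ≤ G s := fun s hs => by
    have := hskpos s hs
    have := hrat s
    positivity
  have hg0 : ∀ s, 0 ≤ g s := fun s => indicator_nonneg hG0 s
  have hGb : ∀ s ∈ E, G s ≤ (m : ℝ) ^ (q - 1) * 2 ^ k := fun s hs => by
    have h1 := hskpos s hs
    have h2 := hrat s
    have h3 : (s ^ k)⁻¹ ≤ 2 ^ k := by
      rcases hk with rfl | hk
      · simp
      · rw [← inv_pow]
        have : 1 / 2 ≤ s := hk.trans hs.1.1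
        have hs' : 0 < s := by linarith
        refine pow_le_pow_left₀ (by positivity) ?_ k
        rw [inv_le_comm₀ hs' two_pos]
        linarith
    have h4 : (ω s / υ s) ^ (q - 1) ≤ (m : ℝ) ^ (q - 1) := Real.rpow_le_rpow h2.le hs.2 hq1
    exact mul_le_mul h4 h3 (by positivity) (by positivity)
  have hb0 : 0 ≤ (m : ℝ) ^ (q - 1) * 2 ^ k := by positivity
  have hgb : ∀ s, g s ≤ (m : ℝ) ^ (q - 1) * 2 ^ k := fun s => by
    by_cases hs : s ∈ E
    · rw [hg, indicator_of_mem hs]; exact hGb s hs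
    · rw [hg, indicator_of_notMem hs]; exact hb0
  have hσ : ∀ s, (ω s / υ s) ^ (q - 1) * ω s = ω s ^ q / υ s ^ (q - 1) := fun s => by
    rw [Real.div_rpow (hω0 s).le (hυ0 s).le, div_mul_eq_mul_div, ← Real.rpow_add_one (hω0 s).ne',
      sub_add_cancel]
  set I := ∫⁻ s in E, ENNReal.ofReal (ω s ^ q / υ s ^ (q - 1) * s ^ (2 * n - 1)) with hI
  have hgω : IntegrableOn (fun s => g s * ω s) (Ico 0 1) :=
    Integrable.bdd_mul (c := (m : ℝ) ^ (q - 1) * 2 ^ k) hωw.integrable hgm.aestronglyMeasurable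
      (ae_of_all _ fun s => by rw [Real.norm_of_nonneg (hg0 s)]; exact hgb s)
  have hmi : IntegrableOn (fun s => s ^ (2 * k + (2 * n - 1)) * (g s * ω s)) (Ico 0 1) := by
    refine Integrable.bdd_mul (c := 1) hgω (Continuous.aestronglyMeasurable (by fun_prop)) ?_
    filter_upwards [ae_restrict_mem measurableSet_Ico] with s hs
    rw [norm_pow, Real.norm_of_nonneg hs.1]
    exact pow_le_one₀ hs.1 hs.2.le
  have hmom : ENNReal.ofReal (r ^ k) * I ≤ ENNReal.ofReal (ballMoment n (fun s => g s * ω s) k) := by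
    unfold ballMoment moment
    rw [ofReal_integral_eq_lintegral_ofReal hmi
      ((ae_restrict_mem measurableSet_Ico).mono fun s hs =>
        mul_nonneg (pow_nonneg hs.1 _) (mul_nonneg (hg0 s) (hω0 s).le)),
      hI, ← lintegral_const_mul' _ _ ENNReal.ofReal_ne_top]
    refine le_trans ?_ (lintegral_mono_set hE01)
    refine setLIntegral_mono' hEm fun s hs => ?_
    have h1 := hskpos s hs
    have h2 := hω0 s
    have h3 := hυ0 s
    have hs0 : 0 ≤ s := hr.trans hs.1.1
    rw [← ENNReal.ofReal_mul (by positivity)]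
    refine ENNReal.ofReal_le_ofReal ?_
    rw [hg, indicator_of_mem hs, hG, ← hσ]
    calc r ^ k * ((ω s / υ s) ^ (q - 1) * ω s * s ^ (2 * n - 1))
        ≤ s ^ k * ((ω s / υ s) ^ (q - 1) * ω s * s ^ (2 * n - 1)) := by
          gcongr
          exact hs.1.1
      _ = _ := by
          have : s ^ (2 * k + (2 * n - 1)) = s ^ k * s ^ k * s ^ (2 * n - 1) := by ring
          rw [this]
          field_simp
  -- No finiteness of the dual integral is assumed: that of the truncated one follows from the
  -- moment of a bounded function, r^k being positive.
  have hIt : I ≠ ∞ := by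
    rcases eq_or_lt_of_le (pow_nonneg hr k) with h0 | h0
    · by_cases hEe : E = ∅
      · rw [hI, hEe]; simp
      · obtain ⟨s, hs⟩ := nonempty_iff_ne_empty.2 hEe
        rcases hk with rfl | hk
        · simp at h0
        · have : 0 < r := by linarith
          exact absurd h0 (pow_pos this k).ne
    · intro h'
      rw [h', ENNReal.mul_top (ENNReal.ofReal_pos.2 h0).ne'] at hmom
      exact ENNReal.ofReal_ne_top (top_le_iff.1 hmom)
  refine ⟨g, hgm, hg0, ⟨_, hgb⟩, I, hIt, rfl, ?_, hmom⟩
  rw [hI, ← lintegral_indicator hEm, ← lintegral_indicator measurableSet_Ico]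
  refine lintegral_congr fun s => ?_
  by_cases hs : s ∈ E
  · have h1 := hskpos s hs
    have h2 := hω0 s
    have h3 := hυ0 s
    have hs0 : 0 ≤ s := hr.trans hs.1.1
    have hG' := hG0 s hs
    rw [indicator_of_mem hs, indicator_of_mem (hE01 hs), hg, indicator_of_mem hs,
      ENNReal.ofReal_rpow_of_nonneg hG' hp.le, ENNReal.ofReal_rpow_of_nonneg hs0 (by positivity),
      ← ENNReal.ofReal_mul (by positivity), ← ENNReal.ofReal_mul (by positivity)]
    congr 1
    have hqp : (q - 1) * p = q := by rw [hpq.symm.sub_one_mul_conj]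
    rw [Real.rpow_mul hs0, Real.rpow_natCast, ← Real.mul_rpow hG' h1.le, hG]
    simp only
    rw [inv_mul_cancel_right₀ h1.ne', ← Real.rpow_mul (hrat s).le, hqp,
      Real.div_rpow h2.le h3.le, Real.rpow_sub_one h3.ne']
    field_simp
  · rw [indicator_of_notMem hs]
    by_cases hs' : s ∈ Ico (0 : ℝ) 1
    · rw [indicator_of_mem hs', hg, indicator_of_notMem hs, ENNReal.ofReal_zero,
        ENNReal.zero_rpow_of_pos hp, zero_mul, mul_zero]
    · rw [indicator_of_notMem hs']

/-! ### Necessity of the weight condition -/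

theorem iSup_lintegral_truncated (n : ℕ) (q : ℝ) (ω υ : ℝ → ℝ) (r : ℝ) :
    dualTail n q ω υ r = ⨆ m : ℕ, ∫⁻ s in Ico r 1 ∩ {s | ω s / υ s ≤ m},
      ENNReal.ofReal (ω s ^ q / υ s ^ (q - 1) * s ^ (2 * n - 1)) := by
  have hmono : Monotone fun m : ℕ => Ico r 1 ∩ {s | ω s / υ s ≤ m} := fun a b hab s hs =>
    ⟨hs.1, le_trans (b := (a : ℝ)) hs.2 (by exact_mod_cast hab)⟩
  have hU : ⋃ m : ℕ, Ico r 1 ∩ {s | ω s / υ s ≤ m} = Ico r 1 := by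
    rw [← inter_iUnion, inter_eq_left]
    intro s _
    obtain ⟨m, hm⟩ := exists_nat_ge (ω s / υ s)
    exact mem_iUnion.2 ⟨m, hm⟩
  rw [← setLIntegral_iUnion_of_directed _ hmono.directed_le, hU, dualTail]

/-- The test gives (I/ω̂(r))^p υ̂(r) ≤ const · I for the truncated dual integral I. Dividing by I,
which is finite, and taking p-th roots gives (iii) with a constant free of the truncation level. -/
theorem quantityM_lt_top_of_isBoundedOnLp {n : ℕ} (hn : 1 ≤ n) {p q : ℝ}
    (hpq : p.HolderConjugate q) {ω υ : ℝ → ℝ}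
    (hω : Measurable ω) (hυ : Measurable υ) (hω0 : ∀ t, 0 < ω t) (hυ0 : ∀ t, 0 < υ t)
    (hωD : IsClassD ω) (hυD : IsClassD υ) (h : IsBoundedOnLp n ω υ p (bergmanProj n ω)) :
    quantityM n p q ω υ < ∞ := by
  have hp := hpq.pos
  have hq := hpq.symm.pos
  obtain ⟨C, hC⟩ := h
  obtain ⟨C₁, hC₁, hmom⟩ := hωD.exists_ballMoment_le_tail hn
  have hVh := hυD.weight.tail_pos (r := 1 / 2) (by norm_num)
  have hV0 := hυD.weight.tail_pos (r := 0) (by norm_num)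
  have hVle := hυD.weight.tail_anti (r := 0) (s := 1 / 2) le_rfl (by norm_num)
  have hexp := Real.exp_pos 1
  obtain ⟨δ, hδ⟩ : ∃ δ, δ = (Real.exp 1)⁻¹ / C₁ := ⟨_, rfl⟩
  -- The Jacobian is small near 0, so the norm of the power is bounded below on [max(r, 1/2), 1);
  -- the ratio of tails of υ compares that tail with υ̂(r).
  obtain ⟨ε, hε⟩ : ∃ ε, ε = (1 / 2) ^ (2 * n - 1) * ((Real.exp 1)⁻¹) ^ p *
    (tail υ (1 / 2) / tail υ 0) := ⟨_, rfl⟩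
  have hδ0 : 0 < δ := by rw [hδ]; positivity
  have hε0 : 0 < ε := by rw [hε]; positivity
  obtain ⟨K, hK⟩ : ∃ K : ℝ≥0∞, K = C / ENNReal.ofReal (δ * ε ^ (1 / p)) := ⟨_, rfl⟩
  have hc0 : 0 < δ * ε ^ (1 / p) := by positivity
  refine lt_of_le_of_lt (iSup₂_le fun r hr => ?_) (hK ▸ ENNReal.div_lt_top ENNReal.coe_ne_top
    (ENNReal.ofReal_pos.2 hc0).ne' : K < ∞)
  have hW := hωD.weight.tail_pos hr
  have hV := hυD.weight.tail_pos hr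
  have hx : 0 < tail υ r ^ (1 / p) / tail ω r := by positivity
  have hx0 : ENNReal.ofReal (tail υ r ^ (1 / p) / tail ω r) ≠ 0 := (ENNReal.ofReal_pos.2 hx).ne'
  -- The dual tail is isolated so that it may be replaced by each of its truncations, whose supremum
  -- it is.
  rw [mul_comm, ← ENNReal.le_div_iff_mul_le (Or.inl hx0) (Or.inl ENNReal.ofReal_ne_top),
    iSup_lintegral_truncated, one_div, ENNReal.rpow_inv_le_iff hq]
  refine iSup_le fun m => ?_
  rw [← ENNReal.rpow_inv_le_iff hq, ENNReal.le_div_iff_mul_le (Or.inl hx0)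
    (Or.inl ENNReal.ofReal_ne_top)]
  obtain ⟨k, hk1, hk2, hk3⟩ := hmom r hr
  obtain ⟨g, hg, hg0, ⟨b, hgb⟩, I, hIt, hI, hgI, hIm⟩ :=
    exists_test_profile (n := n) (k := k) hpq hω hυ hω0 hυ0 hωD.weight hr.1 hk3 m
  rw [← hI]
  have htest := ofReal_ballMoment_div_rpow_le hn hp hω hυ hω0 hωD hυD (fun f hf => (hC f hf).2.2)
    k hg hg0 hgb
  rw [hgI] at htest
  have hmk := hωD.weight.ballMoment_pos n k
  have hrk : (Real.exp 1)⁻¹ ≤ r ^ k := by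
    rw [inv_le_iff_one_le_mul₀ hexp, mul_comm]; exact hk2
  have h1 : ENNReal.ofReal (δ / tail ω r) * I ≤
      ENNReal.ofReal (ballMoment n (fun s => g s * ω s) k / ballMoment n ω k) := by
    rw [div_eq_mul_inv (ballMoment n (fun s => g s * ω s) k), mul_comm (ballMoment n _ k),
      ENNReal.ofReal_mul (by positivity)]
    refine le_trans ?_ (mul_le_mul_right hIm _)
    rw [← mul_assoc, ← ENNReal.ofReal_mul (by positivity)]
    refine mul_le_mul_left (ENNReal.ofReal_le_ofReal ?_) _
    calc δ / tail ω r = (C₁ * tail ω r)⁻¹ * (Real.exp 1)⁻¹ := by rw [hδ]; field_simp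
      _ ≤ _ := by gcongr
  have h2 : ENNReal.ofReal (ε * tail υ r) ≤ ∫⁻ s in Ico (0 : ℝ) 1,
      ENNReal.ofReal (s ^ (2 * n - 1) * υ s) * ENNReal.ofReal s ^ (k * p) := by
    refine le_trans (ENNReal.ofReal_le_ofReal ?_) (lintegral_pow_mul_rpow_ge (k := k) (n := n) hp.le
      hυD.weight hυ0 hr.1 (le_max_left r (1 / 2)))
    have h3 : tail υ (1 / 2) / tail υ 0 * tail υ r ≤ tail υ (max r (1 / 2)) := by
      rcases le_total r (1 / 2) with hr2 | hr2
      · rw [max_eq_right hr2, div_mul_eq_mul_div, div_le_iff₀ hV0]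
        exact mul_le_mul_of_nonneg_left (hυD.weight.tail_anti le_rfl hr.1) hVh.le
      · rw [max_eq_left hr2]
        exact mul_le_of_le_one_left hV.le ((div_le_one hV0).2 hVle)
    calc ε * tail υ r = (1 / 2) ^ (2 * n - 1) * ((Real.exp 1)⁻¹) ^ p *
          (tail υ (1 / 2) / tail υ 0 * tail υ r) := by rw [hε]; ring
      _ ≤ _ := by
          have h4 : (1 / 2 : ℝ) ≤ max r (1 / 2) := le_max_right _ _
          have h5 : 0 ≤ r ^ k := pow_nonneg hr.1 _
          have h6 : 0 ≤ max r (1 / 2) := by linarith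
          have h7 : 0 ≤ max r (1 / 2) ^ (2 * n - 1) * (r ^ k) ^ p := by positivity
          gcongr
  have h3 : (ENNReal.ofReal (δ / tail ω r) * I) ^ p * ENNReal.ofReal (ε * tail υ r) ≤
      (C : ℝ≥0∞) ^ p * I :=
    (mul_le_mul' (ENNReal.rpow_le_rpow h1 hp.le) h2).trans htest
  rcases eq_or_ne I 0 with hI0 | hI0
  · rw [hI0, ENNReal.zero_rpow_of_pos (by positivity), zero_mul]
    exact zero_le
  -- Division by I leaves I^(p-1), whose p-th root is I^(1/q).
  have h4 : ENNReal.ofReal (δ / tail ω r) ^ p * ENNReal.ofReal (ε * tail υ r) * I ^ (p - 1) ≤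
      (C : ℝ≥0∞) ^ p := by
    rw [← ENNReal.mul_le_mul_iff_left hI0 hIt]
    refine le_trans (le_of_eq ?_) h3
    have : I ^ p = I ^ (p - 1) * I := by
      conv_rhs => rw [← ENNReal.rpow_one I, ← ENNReal.rpow_mul, one_mul]
      rw [← ENNReal.rpow_add _ _ hI0 hIt, sub_add_cancel]
    rw [ENNReal.mul_rpow_of_nonneg _ _ hp.le, this]
    ring
  have h5 := ENNReal.rpow_le_rpow h4 (inv_nonneg.2 hp.le)
  have hexpo : (p - 1) * p⁻¹ = q⁻¹ := by
    rw [← hpq.one_sub_inv, sub_mul, mul_inv_cancel₀ hp.ne', one_mul]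
  rw [ENNReal.rpow_rpow_inv hp.ne', ENNReal.mul_rpow_of_nonneg _ _ (inv_nonneg.2 hp.le),
    ENNReal.mul_rpow_of_nonneg _ _ (inv_nonneg.2 hp.le), ENNReal.rpow_rpow_inv hp.ne',
    ← ENNReal.rpow_mul, hexpo, ENNReal.ofReal_rpow_of_pos (by positivity),
    ← ENNReal.ofReal_mul (by positivity)] at h5
  rw [hK, ENNReal.le_div_iff_mul_le (Or.inl (ENNReal.ofReal_pos.2 hc0).ne')
    (Or.inl ENNReal.ofReal_ne_top)]
  refine le_trans (le_of_eq ?_) h5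
  rw [mul_assoc, ← ENNReal.ofReal_mul hx.le, mul_comm]
  congr 2
  rw [Real.mul_rpow hε0.le hV.le, one_div]
  ring

theorem theorem4p2 (n : ℕ) (hn : 1 ≤ n) (p q : ℝ) (hp : 1 < p) (hq : q = p / (p - 1))
    (ω υ : ℝ → ℝ) (hω : IsClassD ω) (hυ : IsClassD υ) :
    List.TFAE
      [IsBoundedOnLp n ω υ p (maxBergmanProj n ω),
       IsBoundedOnLp n ω υ p (bergmanProj n ω),
       quantityM n p q ω υ < ∞,
       quantityN n p q ω υ < ∞] := by
  have hpq : p.HolderConjugate q := (Real.holderConjugate_iff_eq_conjExponent hp).2 hq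
  -- All four statements see the weights only up to null sets, so both may be taken Borel and
  -- everywhere positive.
  obtain ⟨ω', hωω', hωm, hω0, hωD⟩ := hω.exists_measurable
  obtain ⟨υ', hυυ', hυm, hυ0, hυD⟩ := hυ.exists_measurable
  have hWω := weightedVolume_congr hn hωω'
  have hWυ := weightedVolume_congr hn hυυ'
  rw [isBoundedOnLp_congr hWω hWυ, maxBergmanProj_congr hWω,
    bergmanProj_congr hWω, quantityM_congr hωω' hυυ', quantityN_congr hωω' hυυ']
  tfae_have 1 → 2 := IsBoundedOnLp.bergmanProj_of_max hn hωm hυm hωD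
  tfae_have 2 → 3 := quantityM_lt_top_of_isBoundedOnLp hn hpq hωm hυm hω0 hυ0 hωD hυD
  tfae_have 3 → 1 := isBoundedOnLp_maxBergmanProj hn hpq hωm hυm hω0 hυ0 hωD hυD
  tfae_have 3 → 4 := quantityN_lt_top hpq hωm hυm hω0 hυ0 hωD hυD
  tfae_have 4 → 3 := quantityM_lt_top hpq hυ0 hωD hυD
  tfae_finish
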